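/- Let $H\neq\{0\}$ be a separable complex Hilbert space, let $A:\mathfrak D(A)\subset H\to H$ be a selfadjoint operator that is strictly positive, i.e. $\langle Au,u\rangle\ge c\|u\|^2$ for all $u\in\mathfrak D(A)$ and some $c>0$, and let $f:\sigma(A)\to[0,\infty)$ be continuous on the spectrum $\sigma(A)\subset(0,\infty)$. Let $E_A$ be the spectral measure of $A$; for continuous $\phi$ on $\sigma(A)$ put $\phi(A)=\int_{\sigma(A)}\phi\,dE_A$, with domain $\{u\in H:\int_{\sigma(A)}|\phi(s)|^2\,d\langle E_A(s)u,u\rangle<\infty\}$. Let $\mathcal H=\mathfrak D(A^{1/2})\times H$ with norm $\|(u,v)\|_{\mathcal H}^2=\|A^{1/2}u\|^2+\|v\|^2$, and let $\mathbb A$ be the operator on $\mathcal H$ $$\mathbb A(u,v)=(v,\,-Au-f(A)v),\qquad \mathfrak D(\mathbb A)=\{(u,v)\in\mathcal H:\ v\in\mathfrak D(A^{1/2}),\ Au+f(A)v\in H\},$$ where $Au+f(A)v\in H$ means that there is $h\in H$ (then $h=Au+f(A)v$) such that $\langle Aw,u\rangle+\langle f(A)w,v\rangle=\langle w,h\rangle$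 for all $w\in\mathfrak D(A)\cap\mathfrak D(f(A))$. Then $\mathbb A$ is the infinitesimal generator of a strongly continuous contraction semigroup $S(t)=e^{t\mathbb A}$ on $\mathcal H$ (the solution semigroup of $\ddot u+Au+f(A)\dot u=0$), and $S(t)$ is exponentially stable, i.e. there exist $\varkappa>0$ and $M\ge1$ with $\|S(t)z\|_{\mathcal H}\le Me^{-\varkappa t}\|z\|_{\mathcal H}$ for all $t\ge0$ and $z\in\mathcal H$, if and only if $$\inf_{s\in\sigma(A)}f(s)>0\qquad\text{and}\qquad\sup_{s\in\sigma(A)}\frac{f(s)}{s}<\infty.$$ -/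

import Mathlib

open MeasureTheory Filter Topology
open scoped NNReal ENNReal InnerProductSpace

noncomputable section

namespace DampedEvolution

universe u

/-! ### Spectral measures and operator-valued integrals -/

/-- A spectral measure on a measurable space `α`: an assignment of selfadjoint projections of `H`
to measurable sets (with the junk value `0` at non-measurable sets). -/
structure SpectralMeasure (α : Type*) [MeasurableSpace α]
    (H : Type*) [NormedAddCommGroup H] [InnerProductSpace ℂ H] [CompleteSpace H] where
  toFun : Set α → H →L[ℂ] H
  not_measurable : ∀ ω, ¬ MeasurableSet ω → toFun ω = 0
  isStarProjection : ∀ ω, MeasurableSet ω → IsStarProjection (toFun ω)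
  empty : toFun ∅ = 0
  univ : toFun Set.univ = 1
  inter : ∀ ω₁ ω₂, MeasurableSet ω₁ → MeasurableSet ω₂ →
    toFun (ω₁ ∩ ω₂) = toFun ω₁ * toFun ω₂
  /-- Each `ω ↦ ⟨E(ω)u, v⟩` is countably additive, i.e. a complex measure. -/
  iUnion : ∀ ω : ℕ → Set α, (∀ i, MeasurableSet (ω i)) → Pairwise (Function.onFun Disjoint ω) →
    ∀ u v : H, HasSum (fun i => ⟪v, toFun (ω i) u⟫_ℂ) ⟪v, toFun (⋃ i, ω i) u⟫_ℂ

namespace SpectralMeasure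

variable {α : Type*} [MeasurableSpace α]
  {H : Type*} [NormedAddCommGroup H] [InnerProductSpace ℂ H] [CompleteSpace H]

theorem re_inner_nonneg (E : SpectralMeasure α H) (u : H) {ω : Set α} (hω : MeasurableSet ω) :
    0 ≤ (⟪u, E.toFun ω u⟫_ℂ).re := by
  have h := E.isStarProjection ω hω
  have h1 : E.toFun ω u = E.toFun ω (E.toFun ω u) := by
    conv_lhs => rw [← h.isIdempotentElem.eq]
    rfl
  have h2 : ⟪u, E.toFun ω u⟫_ℂ = ⟪E.toFun ω u, E.toFun ω u⟫_ℂ := by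
    conv_lhs => rw [h1]
    rw [← ContinuousLinearMap.adjoint_inner_left,
      ← ContinuousLinearMap.star_eq_adjoint, h.isSelfAdjoint.star_eq]
  rw [h2]
  exact inner_self_nonneg (𝕜 := ℂ)

/-- The positive finite measure `ω ↦ ⟨E(ω)u, u⟩`. -/
def diag (E : SpectralMeasure α H) (u : H) : Measure α :=
  Measure.ofMeasurable (fun ω _ => ENNReal.ofReal (⟪u, E.toFun ω u⟫_ℂ).re)
    (by simp [E.empty])
    (by
      intro ω hω hd
      have hs := Complex.hasSum_re (E.iUnion ω hω hd u u)
      rw [← hs.tsum_eq]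
      exact ENNReal.ofReal_tsum_of_nonneg (fun i => E.re_inner_nonneg u (hω i)) hs.summable)

/-- `T = ∫ φ dE`: the domain of `T` is `{u : ∫ |φ|² d⟨E u, u⟩ < ∞}`, and there
`⟨T u, u⟩ = ∫ φ d⟨E u, u⟩`. By polarization the values `⟨T u, v⟩` on the (dense) domain, hence
`T` itself, are determined by `E` and `φ`. -/
def IsIntegral (E : SpectralMeasure α H) (φ : α → ℂ) (T : H →ₗ.[ℂ] H) : Prop :=
  (∀ u : H, u ∈ T.domain ↔ ∫⁻ s, ‖φ s‖ₑ ^ 2 ∂(E.diag u) < ∞) ∧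
    ∀ u : T.domain, ⟪(u : H), T u⟫_ℂ = ∫ s, φ s ∂(E.diag (u : H))

/-- The operator `∫ φ dE`. -/
def integral (E : SpectralMeasure α H) (φ : α → ℂ) : H →ₗ.[ℂ] H :=
  Classical.epsilon (E.IsIntegral φ)

end SpectralMeasure

/-! ### Unbounded selfadjoint operators -/

section Operators

variable {H : Type u} [NormedAddCommGroup H] [InnerProductSpace ℂ H] [CompleteSpace H]

/-- Strict positivity: `⟨A u, u⟩ ≥ c ‖u‖²` on the domain, for some `c > 0`. -/
def StrictlyPositive (A : H →ₗ.[ℂ] H) : Prop :=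
  ∃ c : ℝ, 0 < c ∧ ∀ u : A.domain, c * ‖(u : H)‖ ^ 2 ≤ (⟪(u : H), A u⟫_ℂ).re

/-- `ξ` is in the resolvent set of `A` if `A - ξ : D(A) → H` is a bijection with bounded
inverse. -/
def resolventSet (A : H →ₗ.[ℂ] H) : Set ℂ :=
  {ξ | Function.Bijective (fun u : A.domain => A u - ξ • (u : H)) ∧
    ∃ C : ℝ, ∀ u : A.domain, ‖(u : H)‖ ≤ C * ‖A u - ξ • (u : H)‖}

/-- The spectrum `σ(A)`, as a set of reals (for selfadjoint `A` there is no other spectrum). -/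
def spec (A : H →ₗ.[ℂ] H) : Set ℝ :=
  {s | (s : ℂ) ∉ resolventSet A}

/-- `E` is the spectral measure of `A`: it lives on `σ(A)` and `A = ∫ s dE(s)`. -/
def IsSpectralMeasureOf (A : H →ₗ.[ℂ] H) (E : SpectralMeasure (spec A) H) : Prop :=
  E.IsIntegral (fun s => ((s : ℝ) : ℂ)) A

open Classical in
/-- The functional calculus `φ(A) = ∫ φ dE_A`, where `E_A` is the spectral measure of `A`
(the value is junk if `A` has no spectral measure, which does not occur for selfadjoint `A`). -/
def funCalc (A : H →ₗ.[ℂ] H) (φ : spec A → ℂ) : H →ₗ.[ℂ] H :=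
  if h : ∃ E : SpectralMeasure (spec A) H, IsSpectralMeasureOf A E then
    h.choose.integral φ
  else ⊥

/-- The square root `A^{1/2}`. -/
def sqrtOp (A : H →ₗ.[ℂ] H) : H →ₗ.[ℂ] H :=
  funCalc A (fun s => ((Real.sqrt (s : ℝ) : ℝ) : ℂ))

/-! ### The phase space -/

/-- `H¹ = D(A^{1/2})`, with norm `‖u‖₁ = ‖A^{1/2} u‖`. -/
def HOne (A : H →ₗ.[ℂ] H) : Type u := (sqrtOp A).domain

instance (A : H →ₗ.[ℂ] H) : AddCommGroup (HOne A) :=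
  inferInstanceAs (AddCommGroup (sqrtOp A).domain)

instance (A : H →ₗ.[ℂ] H) : Module ℂ (HOne A) :=
  inferInstanceAs (Module ℂ (sqrtOp A).domain)

/-- `A^{1/2}` as a linear map on `H¹`. -/
def HOne.sqrtMap (A : H →ₗ.[ℂ] H) : HOne A →ₗ[ℂ] H := (sqrtOp A).toFun

/-- The inclusion of `H¹` into `H`. -/
def HOne.incl (A : H →ₗ.[ℂ] H) : HOne A →ₗ[ℂ] H := (sqrtOp A).domain.subtype

/-- The norm `‖u‖₁ = ‖A^{1/2} u‖` (a genuine norm when `A` is selfadjoint and strictly positive). -/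
instance (A : H →ₗ.[ℂ] H) : SeminormedAddCommGroup (HOne A) :=
  SeminormedAddCommGroup.induced (HOne A) H (HOne.sqrtMap A)

instance (A : H →ₗ.[ℂ] H) : NormedSpace ℂ (HOne A) :=
  NormedSpace.induced ℂ (HOne A) H (HOne.sqrtMap A)

/-- The phase space `H¹ × H` with `‖(u, v)‖² = ‖u‖₁² + ‖v‖²`. -/
abbrev Phase (A : H →ₗ.[ℂ] H) : Type u := WithLp 2 (HOne A × H)

theorem HOne.norm_def (A : H →ₗ.[ℂ] H) (u : HOne A) : ‖u‖ = ‖HOne.sqrtMap A u‖ := rfl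

theorem Phase.norm_sq (A : H →ₗ.[ℂ] H) (z : Phase A) :
    ‖z‖ ^ 2 = ‖HOne.sqrtMap A z.fst‖ ^ 2 + ‖z.snd‖ ^ 2 :=
  WithLp.prod_norm_sq_eq_of_L2 z

/-- The graph of the operator `𝔸 (u, v) = (v, - A u - f(A) v)`, with domain all `(u, v)` in the
phase space such that `v ∈ H¹` and `A u + f(A) v ∈ H`. Here `A u + f(A) v` is the functional
`w ↦ ⟨A w, u⟩ + ⟨f(A) w, v⟩` on `D(A) ∩ D(f(A))`, and it belongs to `H` if it is represented
there by a vector of `H`. -/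
def evolutionGraph (A : H →ₗ.[ℂ] H) (f : spec A → ℝ) : Set (Phase A × Phase A) :=
  {p | HOne.incl A p.2.fst = p.1.snd ∧
    ∀ (w : H) (hw : w ∈ A.domain) (hw' : w ∈ (funCalc A (fun s => (f s : ℂ))).domain),
      ⟪A ⟨w, hw⟩, HOne.incl A p.1.fst⟫_ℂ +
        ⟪funCalc A (fun s => (f s : ℂ)) ⟨w, hw'⟩, p.1.snd⟫_ℂ = ⟪w, -p.2.snd⟫_ℂ}

end Operators

/-! ### Strongly continuous semigroups -/

section Semigroups

variable {X : Type*} [SeminormedAddCommGroup X] [NormedSpace ℂ X]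

/-- Strongly continuous semigroups of bounded linear operators. -/
structure IsC0Semigroup (S : ℝ≥0 → X →L[ℂ] X) : Prop where
  zero : S 0 = ContinuousLinearMap.id ℂ X
  add : ∀ s t, S (s + t) = (S s).comp (S t)
  tendsto : ∀ z, Tendsto (fun t => S t z) (𝓝 0) (𝓝 z)

/-- The graph of the infinitesimal generator: all `(z, z')` with `(S(t) z - z) / t → z'` as
`t → 0⁺`. -/
def generatorGraph (S : ℝ≥0 → X →L[ℂ] X) : Set (X × X) :=
  {p | Tendsto (fun t : ℝ≥0 => ((t : ℝ) : ℂ)⁻¹ • (S t p.1 - p.1)) (𝓝[≠] 0) (𝓝 p.2)}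

/-- `S` is exponentially stable: `‖S(t) z‖ ≤ M e^{-ϰ t} ‖z‖` with `ϰ > 0`, `M ≥ 1`. -/
def ExponentiallyStable (S : ℝ≥0 → X →L[ℂ] X) : Prop :=
  ∃ κ : ℝ, 0 < κ ∧ ∃ M : ℝ, 1 ≤ M ∧
    ∀ (t : ℝ≥0) (z : X), ‖S t z‖ ≤ M * Real.exp (-κ * (t : ℝ)) * ‖z‖

end Semigroups

end DampedEvolution

end

open MeasureTheory Filter Topology
open scoped NNReal ENNReal InnerProductSpace

noncomputable section

namespace DampedEvolution

/-! By the spectral theorem `A` acts as multiplication by `s`. In the coordinates `(x, y) =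
(A^{1/2}u, v)`, which map the phase space isometrically onto `H × H`, the equation splits over `s ∈
σ(A)` into the planar systems `x' = √s y`, `y' = -√s x - f(s) y`, whose eigenvalues are the roots of
`μ² + f(s) μ + s = 0`. The coupling is skew, so `Re ⟨z, 𝔸 z⟩ = -∫ f d⟨E y, y⟩ ≤ 0`.

Generation. On the range of the projection `P n` belonging to `{s ≤ n, f(s) ≤ n}` the generator is a
bounded dissipative operator `G n`. The contractions `exp(t G n)` are compatible with each other and
converge strongly to a semigroup whose generator has the graph `{(z, z') : G n z = P n z' for all
n}` (`DissipativeApprox.exists_semigroup`). Testing the weak definition of `𝔸` on ranges of spectral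
projections yields the same graph (`mem_evolutionGraph_iff`). Any strongly continuous semigroup with
this generator satisfies `P n S(t) = exp(t G n) P n` (`DissipativeApprox.proj_semigroup`), so
exponential stability is decay of all truncations with common constants.

Necessity. Every neighbourhood of a point of `σ(A)` carries spectral vectors, so the roots `μ` are
approximate eigenvalues of truncations (`exists_approx_eigenvector`), and decay at rate `κ` forces
`Re μ ≤ -κ`. For the quadratic this gives `2κ ≤ f(s)` and `κ f(s) ≤ 2s`; the second bound reflects
the slow root, of size about `s / f(s)`, of an overdamped mode.

Sufficiency. The Lyapunov function `½‖z‖² + ε Re ⟨A^{-1/2}x, y⟩` decays: the lower bound of `f`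
dissipates `y`, the cross term dissipates `x`, and the error `⟨x, A^{-1/2} f(A) y⟩` is absorbed
because `f²/s ≤ C f` (`exists_norm_exp_waveGen_le`).

The spectral measure of `A` is built from the bounded inverse `B = A⁻¹`: the Riesz–Markov theorem
applied to the continuous functional calculus of `B`, extension to bounded Borel functions, and
transport under `r ↦ 1/r`. -/

theorem indicator_accumulate {X : Type*} {s : ℕ → Set X}
    (hd : Pairwise (Function.onFun Disjoint s)) (n : ℕ) :
    (⋃ i ∈ Finset.range n, s i).indicator (1 : X → ℂ) =
      ∑ i ∈ Finset.range n, (s i).indicator (1 : X → ℂ) := by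
  induction n with
  | zero => ext x; simp
  | succ n ih =>
    rw [Finset.sum_range_succ, ← ih, Finset.range_add_one, Finset.set_biUnion_insert,
      Set.union_comm, Set.indicator_union_of_disjoint]
    · rfl
    · simp only [Set.disjoint_iUnion_left]
      intro i hi
      exact hd (by simp at hi; omega)

theorem tendsto_indicator_iUnion_range {X : Type*} (s : ℕ → Set X) (x : X) :
    Tendsto (fun n => (⋃ i ∈ Finset.range n, s i).indicator (1 : X → ℂ) x) atTop
      (𝓝 ((⋃ i, s i).indicator (1 : X → ℂ) x)) := by
  by_cases hx : x ∈ ⋃ i, s i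
  · obtain ⟨i, hi⟩ := Set.mem_iUnion.1 hx
    refine tendsto_const_nhds.congr' ?_
    filter_upwards [eventually_gt_atTop i] with n hn
    have : x ∈ ⋃ i ∈ Finset.range n, s i := Set.mem_biUnion (by simpa using hn) hi
    rw [Set.indicator_of_mem hx, Set.indicator_of_mem this]
  · have : ∀ n, x ∉ ⋃ i ∈ Finset.range n, s i := by
      intro n h
      obtain ⟨i, -, hi⟩ := Set.mem_iUnion₂.1 h
      exact hx (Set.mem_iUnion.2 ⟨i, hi⟩)
    simp only [Set.indicator_of_notMem hx, Set.indicator_of_notMem (this _)]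
    exact tendsto_const_nhds

/-! ### Bounded measurable functions and their induction principles -/

section BddMeas

variable {X : Type*} [MeasurableSpace X]

/-- Bounded measurable complex functions. -/
def BddMeas (φ : X → ℂ) : Prop := Measurable φ ∧ ∃ C : ℝ, ∀ x, ‖φ x‖ ≤ C

theorem BddMeas.integrable {φ : X → ℂ} (h : BddMeas φ) (μ : Measure X) [IsFiniteMeasure μ] :
    Integrable φ μ := by
  obtain ⟨hm, C, hC⟩ := h
  exact Integrable.of_bound hm.aestronglyMeasurable C (Eventually.of_forall hC)

theorem BddMeas.indicator_one {ω : Set X} (hω : MeasurableSet ω) :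
    BddMeas (ω.indicator (1 : X → ℂ)) := by
  refine ⟨measurable_one.indicator hω, 1, fun x => ?_⟩
  by_cases hx : x ∈ ω <;> simp [hx]

theorem BddMeas.indicator {φ : X → ℂ} (hφ : Measurable φ) {ω : Set X} (hω : MeasurableSet ω)
    {C : ℝ} (hC : ∀ x ∈ ω, ‖φ x‖ ≤ C) : BddMeas (ω.indicator φ) := by
  refine ⟨hφ.indicator hω, max C 0, fun x => ?_⟩
  by_cases hx : x ∈ ω
  · simp [hx, hC x hx]
  · simp [hx]

theorem BddMeas.add {φ ψ : X → ℂ} (hφ : BddMeas φ) (hψ : BddMeas ψ) : BddMeas (φ + ψ) := by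
  obtain ⟨hm, C, hC⟩ := hφ
  obtain ⟨hm', C', hC'⟩ := hψ
  exact ⟨hm.add hm', C + C', fun x => (norm_add_le _ _).trans (add_le_add (hC x) (hC' x))⟩

theorem BddMeas.mul {φ ψ : X → ℂ} (hφ : BddMeas φ) (hψ : BddMeas ψ) : BddMeas (φ * ψ) := by
  obtain ⟨hm, C, hC⟩ := hφ
  obtain ⟨hm', C', hC'⟩ := hψ
  refine ⟨hm.mul hm', C * C', fun x => ?_⟩
  rw [Pi.mul_apply, norm_mul]
  exact mul_le_mul (hC x) (hC' x) (norm_nonneg _) ((norm_nonneg _).trans (hC x))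

theorem BddMeas.const (c : ℂ) : BddMeas (fun _ : X => c) :=
  ⟨measurable_const, ‖c‖, fun _ => le_rfl⟩

theorem BddMeas.smul {φ : X → ℂ} (c : ℂ) (hφ : BddMeas φ) : BddMeas (c • φ) :=
  (BddMeas.const c).mul hφ

theorem BddMeas.sub {φ ψ : X → ℂ} (hφ : BddMeas φ) (hψ : BddMeas ψ) : BddMeas (φ - ψ) := by
  have := hφ.add (hψ.smul (-1))
  rwa [neg_one_smul, ← sub_eq_add_neg] at this

theorem BddMeas.star {φ : X → ℂ} (hφ : BddMeas φ) : BddMeas (star φ) := by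
  obtain ⟨hm, C, hC⟩ := hφ
  exact ⟨Complex.continuous_conj.measurable.comp hm, C, fun x => by simpa using hC x⟩

theorem BddMeas.comp {Y : Type*} [MeasurableSpace Y] {φ : X → ℂ} (hφ : BddMeas φ) {g : Y → X}
    (hg : Measurable g) : BddMeas (φ ∘ g) :=
  ⟨hφ.1.comp hg, hφ.2.imp fun _ h y => h (g y)⟩

/-- Simple functions approximate with a common bound. That bound is part of the limit clause, so
dominated convergence against finite measures is available wherever the principle is applied. -/
theorem BddMeas.induction {P : (X → ℂ) → Prop}
    (hind : ∀ ω, MeasurableSet ω → P (ω.indicator 1))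
    (hadd : ∀ φ ψ, BddMeas φ → BddMeas ψ → P φ → P ψ → P (φ + ψ))
    (hsmul : ∀ (c : ℂ) φ, BddMeas φ → P φ → P (c • φ))
    (hlim : ∀ (φ : ℕ → X → ℂ) (ψ : X → ℂ) (C : ℝ), (∀ n, Measurable (φ n)) → Measurable ψ →
      (∀ n x, ‖φ n x‖ ≤ C) → (∀ x, ‖ψ x‖ ≤ C) →
      (∀ x, Tendsto (fun n => φ n x) atTop (𝓝 (ψ x))) → (∀ n, P (φ n)) → P ψ)
    {φ : X → ℂ} (hφ : BddMeas φ) : P φ := by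
  have hs : ∀ g : SimpleFunc X ℂ, BddMeas g ∧ P g := by
    intro g
    induction g using SimpleFunc.induction with
    | const c hs =>
      rename_i s
      have : ⇑(SimpleFunc.piecewise s hs (SimpleFunc.const _ c) (SimpleFunc.const _ (0 : ℂ)))
          = c • s.indicator (1 : X → ℂ) := by
        ext x
        by_cases hx : x ∈ s <;> simp [hx]
      rw [this]
      exact ⟨(BddMeas.indicator_one hs).smul c,
        hsmul c _ (BddMeas.indicator_one hs) (hind s hs)⟩
    | add _ hf hg =>
      exact ⟨hf.1.add hg.1, hadd _ _ hf.1 hg.1 hf.2 hg.2⟩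
  obtain ⟨hm, C, hC⟩ := hφ
  have hsm : StronglyMeasurable φ := hm.stronglyMeasurable
  -- Only a point of the space shows that the bound `C` is nonnegative.
  rcases isEmpty_or_nonempty X with hX | ⟨⟨x₀⟩⟩
  · have : φ = (∅ : Set X).indicator 1 := Subsingleton.elim _ _
    rw [this]
    exact hind _ .empty
  have hC0 : 0 ≤ C := (norm_nonneg _).trans (hC x₀)
  exact hlim (fun n => hsm.approxBounded C n) φ C (fun n => (hsm.approxBounded C n).measurable) hm
    (fun n x => hsm.norm_approxBounded_le hC0 n x) hC
    (fun x => hsm.tendsto_approxBounded_of_norm_le (hC x)) (fun n => (hs _).2)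

/-- Indicators of closed sets are bounded pointwise limits of continuous functions with values in
`[0, 1]`. Closed sets form a π-system generating the Borel sets, so the π-λ theorem reaches all
indicators. -/
theorem BddMeas.induction_continuous [TopologicalSpace X] [BorelSpace X] [HasOuterApproxClosed X]
    {P : (X → ℂ) → Prop}
    (hcont : ∀ g : C(X, ℝ), (∀ x, 0 ≤ g x) → (∀ x, g x ≤ 1) → P (fun x => (g x : ℂ)))
    (hadd : ∀ φ ψ, BddMeas φ → BddMeas ψ → P φ → P ψ → P (φ + ψ))
    (hsmul : ∀ (c : ℂ) φ, BddMeas φ → P φ → P (c • φ))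
    (hlim : ∀ (φ : ℕ → X → ℂ) (ψ : X → ℂ) (C : ℝ), (∀ n, Measurable (φ n)) → Measurable ψ →
      (∀ n x, ‖φ n x‖ ≤ C) → (∀ x, ‖ψ x‖ ≤ C) →
      (∀ x, Tendsto (fun n => φ n x) atTop (𝓝 (ψ x))) → (∀ n, P (φ n)) → P ψ)
    {φ : X → ℂ} (hφ : BddMeas φ) : P φ := by
  have h0 : P 0 := by
    convert hcont 0 (fun x => le_rfl) (fun x => zero_le_one) using 1
    ext x
    simp
  have h1 : P 1 := by
    convert hcont 1 (fun x => zero_le_one) (fun x => le_rfl) using 1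
    ext x
    simp
  have hbd : ∀ (s : Set X) x, ‖s.indicator (1 : X → ℂ) x‖ ≤ 1 := by
    intro s x
    by_cases hx : x ∈ s <;> simp [hx]
  refine BddMeas.induction ?_ hadd hsmul hlim hφ
  intro ω hω
  induction ω, hω using MeasurableSpace.induction_on_inter
    (BorelSpace.measurable_eq.trans (borel_eq_generateFrom_isClosed (α := X)))
    isPiSystem_isClosed with
  | empty => rwa [Set.indicator_empty]
  | basic t ht =>
    have ht : IsClosed t := ht
    refine hlim (fun n x => ((ht.apprSeq n x : ℝ) : ℂ)) _ 1 ?_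
      (measurable_one.indicator ht.measurableSet) ?_ (hbd t) ?_ ?_
    · intro n
      have : Continuous fun x => ((ht.apprSeq n x : ℝ) : ℂ) := by fun_prop
      exact this.measurable
    · intro n x
      simpa using! HasOuterApproxClosed.apprSeq_apply_le_one ht n x
    · intro x
      have h := (tendsto_pi_nhds.1 (HasOuterApproxClosed.tendsto_apprSeq ht)) x
      have h2 : Continuous fun r : ℝ≥0 => ((r : ℝ) : ℂ) := by fun_prop
      have h3 := (h2.tendsto _).comp h
      have e : t.indicator (1 : X → ℂ) x = (((t.indicator (fun _ => 1) x : ℝ≥0) : ℝ) : ℂ) := by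
        by_cases hx : x ∈ t <;> simp [hx]
      rw [e]
      exact h3
    · intro n
      exact hcont ⟨fun x => (ht.apprSeq n x : ℝ), by fun_prop⟩ (fun x => NNReal.coe_nonneg _)
        (fun x => HasOuterApproxClosed.apprSeq_apply_le_one ht n x)
  | compl t ht ih =>
    have h := hadd _ _ (BddMeas.const 1) ((BddMeas.indicator_one ht).smul (-1)) h1
      (hsmul (-1) _ (BddMeas.indicator_one ht) ih)
    convert h using 1
    ext x
    by_cases hx : x ∈ t <;> simp [hx]
  | iUnion s hd hs ih =>
    refine hlim (fun n => (⋃ i ∈ Finset.range n, s i).indicator 1) _ 1 ?_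
      (measurable_one.indicator (.iUnion hs)) (fun n => hbd _) (hbd _)
      (tendsto_indicator_iUnion_range s) ?_
    · exact fun n => measurable_one.indicator (Finset.measurableSet_biUnion _ fun i _ => hs i)
    · intro n
      rw [indicator_accumulate hd]
      have : BddMeas (∑ i ∈ Finset.range n, (s i).indicator (1 : X → ℂ)) ∧
          P (∑ i ∈ Finset.range n, (s i).indicator (1 : X → ℂ)) := by
        induction n with
        | zero => exact ⟨BddMeas.const 0, by simpa using h0⟩
        | succ n ihn =>
          rw [Finset.sum_range_succ]
          have hb := BddMeas.indicator_one (hs n)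
          exact ⟨ihn.1.add hb, hadd _ _ ihn.1 hb ihn.2 (ih n)⟩
      exact this.2

theorem tendsto_integral_of_bounded {ν : Measure X} [IsFiniteMeasure ν] {φ : ℕ → X → ℂ} {ψ : X → ℂ}
    {C : ℝ} (hm : ∀ n, Measurable (φ n)) (hC : ∀ n x, ‖φ n x‖ ≤ C)
    (hlim : ∀ x, Tendsto (fun n => φ n x) atTop (𝓝 (ψ x))) :
    Tendsto (fun n => ∫ x, φ n x ∂ν) atTop (𝓝 (∫ x, ψ x ∂ν)) :=
  tendsto_integral_of_dominated_convergence (fun _ => C) (fun n => (hm n).aestronglyMeasurable)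
    (integrable_const C) (fun n => Eventually.of_forall (hC n)) (Eventually.of_forall hlim)

end BddMeas

/-! ### Polarization and weak operator limits -/

section WeakLimits

variable {H : Type*} [NormedAddCommGroup H] [InnerProductSpace ℂ H]

theorem inner_polarization (T : H →ₗ[ℂ] H) (u v : H) :
    ⟪v, T u⟫_ℂ = (⟪u + v, T (u + v)⟫_ℂ - ⟪u - v, T (u - v)⟫_ℂ
      + Complex.I * ⟪u + Complex.I • v, T (u + Complex.I • v)⟫_ℂ
      - Complex.I * ⟪u - Complex.I • v, T (u - Complex.I • v)⟫_ℂ) / 4 := by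
  simp only [map_add, map_sub, inner_add_left, inner_add_right, map_smul, inner_smul_left,
    inner_smul_right, Complex.conj_I, inner_sub_left, inner_sub_right]
  linear_combination (- ⟪u, T v⟫_ℂ / 2 + ⟪v, T u⟫_ℂ / 2) * Complex.I_sq

theorem ext_of_inner_self {S T : H →L[ℂ] H} (h : ∀ u, ⟪u, S u⟫_ℂ = ⟪u, T u⟫_ℂ) : S = T := by
  ext u
  refine ext_inner_left ℂ fun v => ?_
  have hS := inner_polarization (S : H →ₗ[ℂ] H) u v
  have hT := inner_polarization (T : H →ₗ[ℂ] H) u v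
  simp only [ContinuousLinearMap.coe_coe] at hS hT
  rw [hS, hT]
  simp only [h]

theorem norm_le_of_norm_inner_self_le {T : H →L[ℂ] H} {C : ℝ}
    (h : ∀ u, ‖⟪u, T u⟫_ℂ‖ ≤ C * ‖u‖ ^ 2) (u : H) : ‖T u‖ ≤ 2 * C * ‖u‖ := by
  have key : ∀ u v, ‖⟪v, T u⟫_ℂ‖ ≤ C * (‖u‖ ^ 2 + ‖v‖ ^ 2) := by
    intro u v
    have hT := inner_polarization (T : H →ₗ[ℂ] H) u v
    simp only [ContinuousLinearMap.coe_coe] at hT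
    rw [hT, norm_div]
    have h1 := h (u + v)
    have h2 := h (u - v)
    have h3 := h (u + Complex.I • v)
    have h4 := h (u - Complex.I • v)
    have p1 := parallelogram_law_with_norm ℂ u v
    have p2 := parallelogram_law_with_norm ℂ u (Complex.I • v)
    have hI : ‖Complex.I • v‖ = ‖v‖ := by simp [norm_smul]
    rw [hI] at p2
    have hn : ∀ a b c d : ℂ, ‖a - b + Complex.I * c - Complex.I * d‖ ≤ ‖a‖ + ‖b‖ + ‖c‖ + ‖d‖ := by
      intro a b c d
      refine (norm_sub_le _ _).trans ?_
      refine add_le_add ((norm_add_le _ _).trans (add_le_add (norm_sub_le _ _) ?_)) ?_ <;> simp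
    have h4' : ‖(4 : ℂ)‖ = 4 := by simp
    rw [h4', div_le_iff₀ (by norm_num)]
    refine (hn _ _ _ _).trans ?_
    have : ‖u + v‖ ^ 2 + ‖u - v‖ ^ 2 + ‖u + Complex.I • v‖ ^ 2 + ‖u - Complex.I • v‖ ^ 2
        = 4 * (‖u‖ ^ 2 + ‖v‖ ^ 2) := by nlinarith
    calc _ ≤ C * (‖u + v‖ ^ 2 + ‖u - v‖ ^ 2 + ‖u + Complex.I • v‖ ^ 2
          + ‖u - Complex.I • v‖ ^ 2) := by linarith
      _ = _ := by rw [this]; ring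
  rcases eq_or_ne u 0 with rfl | hu
  · simp
  rcases eq_or_ne (T u) 0 with hTu | hTu
  · have h0 : 0 ≤ C * ‖u‖ ^ 2 := (norm_nonneg _).trans (h u)
    have hu' : 0 < ‖u‖ := norm_pos_iff.2 hu
    have : 0 ≤ C := nonneg_of_mul_nonneg_left h0 (by positivity)
    rw [hTu, norm_zero]
    positivity
  have hu' : 0 < ‖u‖ := norm_pos_iff.2 hu
  have hT' : 0 < ‖T u‖ := norm_pos_iff.2 hTu
  -- The vector `T u` is rescaled to length `‖u‖`; the two squares in `key` then coincide, which
  -- produces the factor 2.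
  have := key u (((‖u‖ / ‖T u‖ : ℝ) : ℂ) • T u)
  rw [inner_smul_left, inner_self_eq_norm_sq_to_K, norm_smul, norm_mul] at this
  simp only [Complex.conj_ofReal, Complex.norm_real, norm_div, norm_norm, norm_pow,
    Complex.coe_algebraMap] at this
  rw [div_mul_cancel₀ _ hT'.ne'] at this
  have e : ‖u‖ / ‖T u‖ * ‖T u‖ ^ 2 = ‖u‖ * ‖T u‖ := by field_simp
  rw [e] at this
  have : ‖u‖ * ‖T u‖ ≤ ‖u‖ * (2 * C * ‖u‖) := by nlinarith
  exact le_of_mul_le_mul_left this hu'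

/-- Polarization carries convergence and boundedness from the quadratic forms to the sesquilinear
forms, and a bounded sesquilinear form is given by an operator. The form is conjugate linear in the
left vector, hence the adjoint in the witness. -/
theorem exists_weak_limit [CompleteSpace H] {T : ℕ → H →L[ℂ] H} {q : H → ℂ} {C : ℝ}
    (hC : ∀ n u, ‖⟪u, T n u⟫_ℂ‖ ≤ C * ‖u‖ ^ 2)
    (hq : ∀ u, Tendsto (fun n => ⟪u, T n u⟫_ℂ) atTop (𝓝 (q u))) :
    ∃ S : H →L[ℂ] H, (∀ u, ⟪u, S u⟫_ℂ = q u) := by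
  have hp : ∀ v u, ∃ a, Tendsto (fun n => ⟪v, T n u⟫_ℂ) atTop (𝓝 a) := by
    intro v u
    have hT := fun n => inner_polarization (T n : H →ₗ[ℂ] H) u v
    simp only [ContinuousLinearMap.coe_coe] at hT
    simp only [hT]
    exact ⟨_, ((((hq _).sub (hq _)).add ((hq _).const_mul _)).sub ((hq _).const_mul _)).div_const _⟩
  choose p hp using hp
  have hbd : ∀ v u, ‖p v u‖ ≤ 2 * C * ‖v‖ * ‖u‖ := by
    intro v u
    refine le_of_tendsto (hp v u).norm (Eventually.of_forall fun n => ?_)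
    refine (norm_inner_le_norm _ _).trans ?_
    have := norm_le_of_norm_inner_self_le (hC n) u
    calc _ ≤ ‖v‖ * (2 * C * ‖u‖) := by gcongr
      _ = _ := by ring
  let B₀ : H →ₗ⋆[ℂ] H →ₗ[ℂ] ℂ := LinearMap.mk₂'ₛₗ (starRingEnd ℂ) (RingHom.id ℂ) p
    (fun v v' u => tendsto_nhds_unique (hp _ _)
      (((hp v u).add (hp v' u)).congr fun n => (inner_add_left _ _ _).symm))
    (fun c v u => tendsto_nhds_unique (hp _ _)
      (((hp v u).const_mul _).congr fun n => (inner_smul_left _ _ _).symm))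
    (fun v u u' => tendsto_nhds_unique (hp _ _)
      (((hp v u).add (hp v u')).congr fun n => by rw [map_add, inner_add_right]))
    (fun c v u => tendsto_nhds_unique (hp _ _)
      (((hp v u).const_mul c).congr fun n => by rw [map_smul, inner_smul_right]))
  let B : H →L⋆[ℂ] H →L[ℂ] ℂ := B₀.mkContinuous₂ (2 * C) hbd
  refine ⟨ContinuousLinearMap.adjoint (InnerProductSpace.continuousLinearMapOfBilin B),
    fun u => ?_⟩
  rw [ContinuousLinearMap.adjoint_inner_right,
    InnerProductSpace.continuousLinearMapOfBilin_apply]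
  exact tendsto_nhds_unique (hp u u) (hq u)

theorem tendsto_inner_of_tendsto_inner_self {T : ℕ → H →L[ℂ] H} {S : H →L[ℂ] H}
    (h : ∀ u, Tendsto (fun n => ⟪u, T n u⟫_ℂ) atTop (𝓝 ⟪u, S u⟫_ℂ)) (u v : H) :
    Tendsto (fun n => ⟪v, T n u⟫_ℂ) atTop (𝓝 ⟪v, S u⟫_ℂ) := by
  have hT := fun n => inner_polarization (T n : H →ₗ[ℂ] H) u v
  have hS := inner_polarization (S : H →ₗ[ℂ] H) u v
  simp only [ContinuousLinearMap.coe_coe] at hT hS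
  simp only [hT, hS]
  exact ((((h _).sub (h _)).add ((h _).const_mul _)).sub ((h _).const_mul _)).div_const _

end WeakLimits

/-! ### Operators represented by families of scalar measures -/

section Represents

variable {X : Type*} [MeasurableSpace X] {H : Type*} [NormedAddCommGroup H]
  [InnerProductSpace ℂ H]

/-- `T` represents `φ` with respect to the family of measures `μ`, i.e.
`⟨u, T u⟩ = ∫ φ dμ_u` for all `u`. -/
def Represents (μ : H → Measure X) (φ : X → ℂ) (T : H →L[ℂ] H) : Prop :=
  ∀ u, ⟪u, T u⟫_ℂ = ∫ x, φ x ∂(μ u)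

variable {μ : H → Measure X} {φ ψ : X → ℂ} {S T : H →L[ℂ] H}

theorem Represents.unique (hS : Represents μ φ S) (hT : Represents μ φ T) : S = T :=
  ext_of_inner_self fun u => (hS u).trans (hT u).symm

theorem Represents.add [∀ u, IsFiniteMeasure (μ u)] (hφ : BddMeas φ) (hψ : BddMeas ψ)
    (hS : Represents μ φ S) (hT : Represents μ ψ T) : Represents μ (φ + ψ) (S + T) := by
  intro u
  simp only [_root_.add_apply, inner_add_right, Pi.add_apply]
  rw [integral_add (hφ.integrable _) (hψ.integrable _), hS u, hT u]

theorem Represents.smul (c : ℂ) (hS : Represents μ φ S) : Represents μ (c • φ) (c • S) := by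
  intro u
  simp only [_root_.smul_apply, inner_smul_right, Pi.smul_apply]
  rw [integral_smul, hS u, smul_eq_mul]

theorem Represents.adjoint [CompleteSpace H] (hS : Represents μ φ S) :
    Represents μ (star φ) (ContinuousLinearMap.adjoint S) := by
  intro u
  rw [ContinuousLinearMap.adjoint_inner_right, ← inner_conj_symm, hS u, ← integral_conj]
  rfl

/-- The mass bound on `μ u` makes the quadratic forms uniformly bounded, and dominated convergence
makes them converge. -/
theorem exists_represents_of_tendsto [CompleteSpace H] [∀ u, IsFiniteMeasure (μ u)]
    (hμ : ∀ u, (μ u).real Set.univ ≤ ‖u‖ ^ 2) {φ : ℕ → X → ℂ} {ψ : X → ℂ}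
    {C : ℝ} (hm : ∀ n, Measurable (φ n)) (hC : ∀ n x, ‖φ n x‖ ≤ C)
    (hlim : ∀ x, Tendsto (fun n => φ n x) atTop (𝓝 (ψ x)))
    (hT : ∀ n, ∃ T, Represents μ (φ n) T) : ∃ S, Represents μ ψ S := by
  choose T hT using hT
  refine exists_weak_limit (T := T) (C := |C|) ?_ ?_
  · intro n u
    rw [hT n u]
    have hc : ∀ x, ‖φ n x‖ ≤ |C| := fun x => (hC n x).trans (le_abs_self C)
    refine (norm_integral_le_of_norm_le_const (Eventually.of_forall hc)).trans ?_
    exact mul_le_mul_of_nonneg_left (hμ u) (abs_nonneg C)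
  · intro u
    simp only [hT _ u]
    exact tendsto_integral_of_bounded hm hC hlim

theorem tendsto_inner_of_represents [∀ u, IsFiniteMeasure (μ u)] {φ : ℕ → X → ℂ} {ψ : X → ℂ}
    {C : ℝ} (hm : ∀ n, Measurable (φ n)) (hC : ∀ n x, ‖φ n x‖ ≤ C)
    (hlim : ∀ x, Tendsto (fun n => φ n x) atTop (𝓝 (ψ x))) {T : ℕ → H →L[ℂ] H}
    (hT : ∀ n, Represents μ (φ n) (T n)) (hS : Represents μ ψ S) (u v : H) :
    Tendsto (fun n => ⟪v, T n u⟫_ℂ) atTop (𝓝 ⟪v, S u⟫_ℂ) := by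
  refine tendsto_inner_of_tendsto_inner_self (fun u => ?_) u v
  simp only [hT _ u, hS u]
  exact tendsto_integral_of_bounded hm hC hlim

end Represents

/-! ### Bounded functional calculus of a spectral measure -/

namespace SpectralMeasure

variable {α : Type*} [MeasurableSpace α]
  {H : Type*} [NormedAddCommGroup H] [InnerProductSpace ℂ H] [CompleteSpace H]
  (E : SpectralMeasure α H)

theorem inner_toFun_left {ω : Set α} (hω : MeasurableSet ω) (u v : H) :
    ⟪E.toFun ω u, v⟫_ℂ = ⟪u, E.toFun ω v⟫_ℂ := by
  rw [← ContinuousLinearMap.adjoint_inner_right, ← ContinuousLinearMap.star_eq_adjoint,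
    (E.isStarProjection ω hω).isSelfAdjoint.star_eq]

theorem toFun_toFun {ω : Set α} (hω : MeasurableSet ω) (u : H) :
    E.toFun ω (E.toFun ω u) = E.toFun ω u :=
  congrArg (fun T : H →L[ℂ] H => T u) (E.isStarProjection ω hω).isIdempotentElem.eq

theorem inner_toFun_self {ω : Set α} (hω : MeasurableSet ω) (u : H) :
    ⟪u, E.toFun ω u⟫_ℂ = ((‖E.toFun ω u‖ ^ 2 : ℝ) : ℂ) := by
  rw [← E.toFun_toFun hω, ← E.inner_toFun_left hω, inner_self_eq_norm_sq_to_K,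
    E.toFun_toFun hω]
  norm_cast

theorem diag_apply (u : H) {ω : Set α} (hω : MeasurableSet ω) :
    E.diag u ω = ENNReal.ofReal (‖E.toFun ω u‖ ^ 2) := by
  rw [diag, Measure.ofMeasurable_apply _ hω, E.inner_toFun_self hω, Complex.ofReal_re]

theorem diag_real (u : H) {ω : Set α} (hω : MeasurableSet ω) :
    (E.diag u).real ω = ‖E.toFun ω u‖ ^ 2 := by
  rw [Measure.real, E.diag_apply u hω, ENNReal.toReal_ofReal (by positivity)]

instance (u : H) : IsFiniteMeasure (E.diag u) :=
  ⟨by rw [E.diag_apply u .univ]; exact ENNReal.ofReal_lt_top⟩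

theorem diag_real_univ (u : H) : (E.diag u).real Set.univ = ‖u‖ ^ 2 := by
  rw [E.diag_real u .univ, E.univ]
  rfl

theorem represents_indicator {ω : Set α} (hω : MeasurableSet ω) :
    Represents E.diag (ω.indicator 1) (E.toFun ω) := by
  intro u
  rw [integral_indicator hω, E.inner_toFun_self hω, ← E.diag_real u hω]
  simp

theorem exists_represents {φ : α → ℂ} (hφ : BddMeas φ) : ∃ T, Represents E.diag φ T := by
  refine BddMeas.induction (P := fun φ => ∃ T, Represents E.diag φ T) ?_ ?_ ?_ ?_ hφ
  · exact fun ω hω => ⟨_, E.represents_indicator hω⟩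
  · rintro φ ψ hφ hψ ⟨S, hS⟩ ⟨T, hT⟩
    exact ⟨_, hS.add hφ hψ hT⟩
  · rintro c φ - ⟨S, hS⟩
    exact ⟨_, hS.smul c⟩
  · intro φ ψ C hm _ hC _ hlim h
    exact exists_represents_of_tendsto (fun u => (E.diag_real_univ u).le) hm hC hlim h

open Classical in
/-- The bounded operator `∫ φ dE` for bounded measurable `φ` (and `0` for other `φ`). -/
def bcalc (φ : α → ℂ) : H →L[ℂ] H :=
  if h : BddMeas φ then (E.exists_represents h).choose else 0

theorem represents_bcalc {φ : α → ℂ} (hφ : BddMeas φ) : Represents E.diag φ (E.bcalc φ) := by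
  rw [bcalc, dif_pos hφ]
  exact (E.exists_represents hφ).choose_spec

variable {E}

theorem inner_bcalc_self {φ : α → ℂ} (hφ : BddMeas φ) (u : H) :
    ⟪u, E.bcalc φ u⟫_ℂ = ∫ s, φ s ∂(E.diag u) := E.represents_bcalc hφ u

theorem bcalc_eq {φ : α → ℂ} (hφ : BddMeas φ) {T : H →L[ℂ] H} (hT : Represents E.diag φ T) :
    E.bcalc φ = T := (E.represents_bcalc hφ).unique hT

theorem bcalc_indicator_one {ω : Set α} (hω : MeasurableSet ω) :
    E.bcalc (ω.indicator 1) = E.toFun ω :=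
  bcalc_eq (BddMeas.indicator_one hω) (E.represents_indicator hω)

theorem bcalc_add {φ ψ : α → ℂ} (hφ : BddMeas φ) (hψ : BddMeas ψ) :
    E.bcalc (φ + ψ) = E.bcalc φ + E.bcalc ψ :=
  bcalc_eq (hφ.add hψ) ((E.represents_bcalc hφ).add hφ hψ (E.represents_bcalc hψ))

theorem bcalc_smul (c : ℂ) {φ : α → ℂ} (hφ : BddMeas φ) : E.bcalc (c • φ) = c • E.bcalc φ :=
  bcalc_eq (hφ.smul c) ((E.represents_bcalc hφ).smul c)

theorem bcalc_sub {φ ψ : α → ℂ} (hφ : BddMeas φ) (hψ : BddMeas ψ) :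
    E.bcalc (φ - ψ) = E.bcalc φ - E.bcalc ψ := by
  have h : φ - ψ = φ + (-1 : ℂ) • ψ := by rw [neg_one_smul, sub_eq_add_neg]
  rw [h, bcalc_add hφ (hψ.smul _), bcalc_smul _ hψ, neg_one_smul, sub_eq_add_neg]

theorem adjoint_bcalc {φ : α → ℂ} (hφ : BddMeas φ) :
    ContinuousLinearMap.adjoint (E.bcalc φ) = E.bcalc (star φ) :=
  (bcalc_eq hφ.star (E.represents_bcalc hφ).adjoint).symm

theorem inner_bcalc_left {φ : α → ℂ} (hφ : BddMeas φ) (u v : H) :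
    ⟪E.bcalc φ u, v⟫_ℂ = ⟪u, E.bcalc (star φ) v⟫_ℂ := by
  rw [← adjoint_bcalc hφ, ContinuousLinearMap.adjoint_inner_right]

/-- Real multipliers give symmetric operators. -/
theorem inner_bcalc_left_of_real {φ : α → ℂ} (hφ : BddMeas φ) (hr : star φ = φ) (u v : H) :
    ⟪E.bcalc φ u, v⟫_ℂ = ⟪u, E.bcalc φ v⟫_ℂ := by
  rw [inner_bcalc_left hφ, hr]

theorem tendsto_inner_bcalc {φ : ℕ → α → ℂ} {ψ : α → ℂ} {C : ℝ} (hm : ∀ n, Measurable (φ n))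
    (hψ : Measurable ψ) (hC : ∀ n x, ‖φ n x‖ ≤ C) (hC' : ∀ x, ‖ψ x‖ ≤ C)
    (hlim : ∀ x, Tendsto (fun n => φ n x) atTop (𝓝 (ψ x))) (u v : H) :
    Tendsto (fun n => ⟪v, E.bcalc (φ n) u⟫_ℂ) atTop (𝓝 ⟪v, E.bcalc ψ u⟫_ℂ) :=
  tendsto_inner_of_represents hm hC hlim (fun n => E.represents_bcalc ⟨hm n, C, hC n⟩)
    (E.represents_bcalc ⟨hψ, C, hC'⟩) u v

/-- For a fixed right factor, induction on the left factor reduces to indicators. With an indicator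
on the right this is multiplicativity of `E`; taking adjoints exchanges the two sides, which frees
the right factor. -/
theorem bcalc_mul {φ ψ : α → ℂ} (hφ : BddMeas φ) (hψ : BddMeas ψ) :
    E.bcalc (φ * ψ) = E.bcalc φ * E.bcalc ψ := by
  have step : ∀ ψ : α → ℂ, BddMeas ψ →
      (∀ ω, MeasurableSet ω → E.bcalc (ω.indicator 1 * ψ) = E.bcalc (ω.indicator 1) * E.bcalc ψ) →
      ∀ φ : α → ℂ, BddMeas φ → E.bcalc (φ * ψ) = E.bcalc φ * E.bcalc ψ := by
    intro ψ hψ h φ hφ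
    refine BddMeas.induction (P := fun φ => E.bcalc (φ * ψ) = E.bcalc φ * E.bcalc ψ) h ?_ ?_ ?_ hφ
    · intro φ₁ φ₂ h₁ h₂ e₁ e₂
      rw [add_mul, bcalc_add (h₁.mul hψ) (h₂.mul hψ), e₁, e₂, bcalc_add h₁ h₂, add_mul]
    · intro c φ h₁ e₁
      rw [smul_mul_assoc, bcalc_smul c (h₁.mul hψ), e₁, bcalc_smul c h₁, smul_mul_assoc]
    · intro φ φ' C hm hm' hC hC' hlim e
      ext u
      refine ext_inner_left ℂ fun v => ?_
      obtain ⟨hψm, D, hD⟩ := hψ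
      have hb : ∀ φ : α → ℂ, (∀ x, ‖φ x‖ ≤ C) → ∀ x, ‖(φ * ψ) x‖ ≤ C * D := by
        intro φ h x
        rw [Pi.mul_apply, norm_mul]
        exact mul_le_mul (h x) (hD x) (norm_nonneg _) ((norm_nonneg _).trans (h x))
      have t1 := tendsto_inner_bcalc (E := E) (fun n => (hm n).mul hψm) (hm'.mul hψm)
        (fun n => hb _ (hC n)) (hb _ hC') (fun x => (hlim x).mul_const (ψ x)) u v
      have t2 := tendsto_inner_bcalc (E := E) hm hm' hC hC' hlim (E.bcalc ψ u) v
      refine tendsto_nhds_unique t1 (t2.congr fun n => ?_)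
      exact congrArg (fun T : H →L[ℂ] H => ⟪v, T u⟫_ℂ) (e n).symm
  refine step ψ hψ (fun ω hω => ?_) φ hφ
  have hω' := BddMeas.indicator_one hω
  -- The general function stands on the left here, so the adjoint of this identity has the indicator
  -- on the left.
  have h2 : E.bcalc (star ψ * ω.indicator 1) = E.bcalc (star ψ) * E.bcalc (ω.indicator 1) := by
    refine step _ hω' (fun ω' hω'' => ?_) _ hψ.star
    have e : ω'.indicator 1 * ω.indicator 1 = (ω' ∩ ω).indicator (1 : α → ℂ) := by
      ext x
      by_cases hx : x ∈ ω <;> by_cases hx' : x ∈ ω' <;> simp [hx, hx']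
    rw [e, bcalc_indicator_one hω, bcalc_indicator_one hω'', ← E.inter _ _ hω'' hω]
    exact bcalc_indicator_one (hω''.inter hω)
  have h3 := congrArg ContinuousLinearMap.adjoint h2
  have hs : star (ω.indicator (1 : α → ℂ)) = ω.indicator 1 := by
    ext x
    by_cases hx : x ∈ ω <;> simp [hx]
  rw [adjoint_bcalc (hψ.star.mul hω'), star_mul, star_star, hs] at h3
  rw [h3, ← ContinuousLinearMap.star_eq_adjoint, star_mul]
  rw [ContinuousLinearMap.star_eq_adjoint, ContinuousLinearMap.star_eq_adjoint,
    adjoint_bcalc hω', adjoint_bcalc hψ.star, star_star, hs]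

theorem bcalc_bcalc {φ ψ : α → ℂ} (hφ : BddMeas φ) (hψ : BddMeas ψ) (u : H) :
    E.bcalc φ (E.bcalc ψ u) = E.bcalc (φ * ψ) u := by
  rw [bcalc_mul hφ hψ]
  rfl

theorem norm_sq_bcalc {φ : α → ℂ} (hφ : BddMeas φ) (u : H) :
    ‖E.bcalc φ u‖ ^ 2 = ∫ s, ‖φ s‖ ^ 2 ∂(E.diag u) := by
  have h : ⟪E.bcalc φ u, E.bcalc φ u⟫_ℂ = ∫ s, (star φ * φ) s ∂(E.diag u) := by
    rw [inner_bcalc_left hφ, bcalc_bcalc hφ.star hφ, inner_bcalc_self (hφ.star.mul hφ)]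
  rw [inner_self_eq_norm_sq_to_K] at h
  have h2 : ∀ s, (star φ * φ) s = ((‖φ s‖ ^ 2 : ℝ) : ℂ) := by
    intro s
    simp only [Pi.mul_apply, Pi.star_apply, RCLike.star_def]
    rw [Complex.conj_mul']
    norm_cast
  simp only [h2] at h
  rw [integral_complex_ofReal] at h
  refine Complex.ofReal_injective (Eq.trans ?_ h)
  push_cast
  rfl

theorem norm_bcalc_le {φ : α → ℂ} (hφ : Measurable φ) {C : ℝ} (hC0 : 0 ≤ C)
    (hC : ∀ s, ‖φ s‖ ≤ C) (u : H) :
    ‖E.bcalc φ u‖ ≤ C * ‖u‖ := by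
  have hb : BddMeas φ := ⟨hφ, C, hC⟩
  refine le_of_sq_le_sq ?_ (by positivity)
  rw [norm_sq_bcalc hb, mul_pow, ← E.diag_real_univ u]
  have h := norm_integral_le_of_norm_le_const (μ := E.diag u) (f := fun s => ‖φ s‖ ^ 2) (C := C ^ 2)
    (Eventually.of_forall fun s => by
      rw [norm_pow, norm_norm]
      exact pow_le_pow_left₀ (norm_nonneg _) (hC s) 2)
  exact (le_abs_self _).trans h

theorem bcalc_congr_ae {φ ψ : α → ℂ} (hφ : BddMeas φ) (hψ : BddMeas ψ)
    (h : ∀ u, φ =ᵐ[E.diag u] ψ) : E.bcalc φ = E.bcalc ψ :=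
  bcalc_eq hφ fun u => by rw [inner_bcalc_self hψ, integral_congr_ae (h u)]

theorem norm_toFun_le (ω : Set α) (u : H) : ‖E.toFun ω u‖ ≤ ‖u‖ := by
  by_cases hω : MeasurableSet ω
  · rw [← bcalc_indicator_one hω]
    have := norm_bcalc_le (E := E) (BddMeas.indicator_one hω).1 zero_le_one (fun s => ?_) u
    · simpa using this
    · by_cases hx : s ∈ ω <;> simp [hx]
  · simp [E.not_measurable ω hω]

theorem toFun_comm_bcalc {ω : Set α} (hω : MeasurableSet ω) {φ : α → ℂ} (hφ : BddMeas φ) (u : H) :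
    E.toFun ω (E.bcalc φ u) = E.bcalc φ (E.toFun ω u) := by
  rw [← bcalc_indicator_one hω, bcalc_bcalc (BddMeas.indicator_one hω) hφ,
    bcalc_bcalc hφ (BddMeas.indicator_one hω), mul_comm]

end SpectralMeasure

/-- An increasing sequence of measurable sets that exhausts the space, on each of which `φ` is
bounded. -/
structure BddExhaustion {α : Type*} [MeasurableSpace α] (φ : α → ℂ) (ω : ℕ → Set α) : Prop where
  measurable : Measurable φ
  measurableSet : ∀ n, MeasurableSet (ω n)
  mono : Monotone ω
  iUnion : ⋃ n, ω n = Set.univ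
  bdd : ∀ n, ∃ C : ℝ, ∀ x ∈ ω n, ‖φ x‖ ≤ C

/-! ### Unbounded spectral integrals by truncation -/

namespace SpectralMeasure

variable {α : Type*} [MeasurableSpace α]
  {H : Type*} [NormedAddCommGroup H] [InnerProductSpace ℂ H] [CompleteSpace H]
  {E : SpectralMeasure α H} {φ : α → ℂ} {ω : ℕ → Set α}

theorem _root_.DampedEvolution.BddExhaustion.bddMeas (h : BddExhaustion φ ω) (n : ℕ) :
    BddMeas ((ω n).indicator φ) :=
  BddMeas.indicator h.measurable (h.measurableSet n) (h.bdd n).choose_spec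

theorem norm_sub_toFun_sq {ω : Set α} (hω : MeasurableSet ω) (u : H) :
    ‖u - E.toFun ω u‖ ^ 2 = ‖u‖ ^ 2 - ‖E.toFun ω u‖ ^ 2 := by
  rw [@norm_sub_sq ℂ, E.inner_toFun_self hω]
  simp only [Complex.ofReal_re, RCLike.re_to_complex]
  ring

/-- By Pythagoras `‖u - E(ω)u‖² = ‖u‖² - ‖E(ω)u‖²`, and `‖E(ω n)u‖²` is the scalar measure of `ω n`,
which is continuous along increasing unions. -/
theorem tendsto_toFun (hω : ∀ n, MeasurableSet (ω n)) (hm : Monotone ω)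
    (hu : ⋃ n, ω n = Set.univ) (u : H) :
    Tendsto (fun n => E.toFun (ω n) u) atTop (𝓝 u) := by
  have h := tendsto_measure_iUnion_atTop (μ := E.diag u) hm
  rw [hu] at h
  have h2 := (ENNReal.tendsto_toReal (measure_ne_top (E.diag u) _)).comp h
  have h3 : Tendsto (fun n => ‖E.toFun (ω n) u‖ ^ 2) atTop (𝓝 (‖u‖ ^ 2)) := by
    rw [← E.diag_real_univ u]
    refine h2.congr fun n => ?_
    exact E.diag_real u (hω n)
  have h4 : Tendsto (fun n => ‖u - E.toFun (ω n) u‖ ^ 2) atTop (𝓝 0) := by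
    simp only [norm_sub_toFun_sq (hω _)]
    rw [← sub_self (‖u‖ ^ 2)]
    exact tendsto_const_nhds.sub h3
  have h5 : Tendsto (fun n => ‖u - E.toFun (ω n) u‖) atTop (𝓝 0) := by
    have := (Real.continuous_sqrt.tendsto _).comp h4
    simpa [Function.comp_def, Real.sqrt_sq (norm_nonneg _)] using this
  rw [tendsto_iff_norm_sub_tendsto_zero]
  simpa only [norm_sub_rev] using h5

theorem eq_of_toFun_eq (hω : ∀ n, MeasurableSet (ω n)) (hm : Monotone ω)
    (hu : ⋃ n, ω n = Set.univ) {u v : H} (h : ∀ n, E.toFun (ω n) u = E.toFun (ω n) v) : u = v :=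
  tendsto_nhds_unique (tendsto_toFun hω hm hu u)
    ((tendsto_toFun hω hm hu v).congr fun n => (h n).symm)

theorem ofReal_norm_sq_bcalc {ψ : α → ℂ} (hψ : BddMeas ψ) (u : H) :
    ENNReal.ofReal (‖E.bcalc ψ u‖ ^ 2) = ∫⁻ s, ‖ψ s‖ₑ ^ 2 ∂(E.diag u) := by
  rw [norm_sq_bcalc hψ, ofReal_integral_eq_lintegral_ofReal]
  · refine lintegral_congr fun s => ?_
    rw [ENNReal.ofReal_pow (norm_nonneg _), ofReal_norm]
  · have := (hψ.star.mul hψ).integrable (E.diag u)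
    refine this.norm.congr (Eventually.of_forall fun s => ?_)
    simp [sq]
  · exact Eventually.of_forall fun s => by positivity

theorem toFun_bcalc_indicator {ψ : α → ℂ} {ω₁ ω₂ : Set α} (h₁ : MeasurableSet ω₁)
    (h₂ : BddMeas (ω₂.indicator ψ)) (h : ω₁ ⊆ ω₂) (u : H) :
    E.toFun ω₁ (E.bcalc (ω₂.indicator ψ) u) = E.bcalc (ω₁.indicator ψ) u := by
  rw [← bcalc_indicator_one h₁, bcalc_bcalc (BddMeas.indicator_one h₁) h₂]
  congr 2
  ext x
  by_cases hx : x ∈ ω₁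
  · simp [hx, h hx]
  · simp [hx]

theorem bcalc_indicator_toFun {ψ : α → ℂ} {ω₁ ω₂ : Set α} (h₁ : MeasurableSet ω₁)
    (h₂ : BddMeas (ω₂.indicator ψ)) (h : ω₁ ⊆ ω₂) (u : H) :
    E.bcalc (ω₂.indicator ψ) (E.toFun ω₁ u) = E.bcalc (ω₁.indicator ψ) u := by
  rw [← toFun_comm_bcalc h₁ h₂, toFun_bcalc_indicator h₁ h₂ h]

theorem setLIntegral_eq_bcalc (h : BddExhaustion φ ω) (n : ℕ) (u : H) :
    ∫⁻ s in ω n, ‖φ s‖ₑ ^ 2 ∂(E.diag u) = ENNReal.ofReal (‖E.bcalc ((ω n).indicator φ) u‖ ^ 2) := by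
  rw [ofReal_norm_sq_bcalc (h.bddMeas n), ← lintegral_indicator (h.measurableSet n)]
  refine lintegral_congr fun s => ?_
  by_cases hs : s ∈ ω n <;> simp [hs]

theorem lintegral_eq_iSup (h : BddExhaustion φ ω) (u : H) :
    ∫⁻ s, ‖φ s‖ₑ ^ 2 ∂(E.diag u) =
      ⨆ n, ENNReal.ofReal (‖E.bcalc ((ω n).indicator φ) u‖ ^ 2) := by
  rw [← setLIntegral_univ, ← h.iUnion, setLIntegral_iUnion_of_directed _ h.mono.directed_le]
  simp only [setLIntegral_eq_bcalc h]

/-- The vector `y` plays the role of `(∫ φ dE) u`. The truncated values have increasing squared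
norms, whose supremum is the integral, and the squared norms of their differences are differences of
these; so a finite integral makes them Cauchy. -/
theorem exists_forall_toFun_eq_iff (h : BddExhaustion φ ω) (u : H) :
    (∃ y, ∀ n, E.toFun (ω n) y = E.bcalc ((ω n).indicator φ) u) ↔
      ∫⁻ s, ‖φ s‖ₑ ^ 2 ∂(E.diag u) < ∞ := by
  rw [lintegral_eq_iSup h]
  constructor
  · rintro ⟨y, hy⟩
    refine lt_of_le_of_lt (iSup_le fun n => ?_) (ENNReal.ofReal_lt_top (r := ‖y‖ ^ 2))
    rw [← hy n]
    exact ENNReal.ofReal_le_ofReal (pow_le_pow_left₀ (norm_nonneg _) (norm_toFun_le _ _) 2)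
  · intro hlt
    set y : ℕ → H := fun n => E.bcalc ((ω n).indicator φ) u with hy
    have hE : ∀ n m, n ≤ m → E.toFun (ω n) (y m) = y n := fun n m hnm =>
      toFun_bcalc_indicator (h.measurableSet n) (h.bddMeas m) (h.mono hnm) u
    have hsub : ∀ n m, n ≤ m → ‖y m - y n‖ ^ 2 = ‖y m‖ ^ 2 - ‖y n‖ ^ 2 := by
      intro n m hnm
      rw [← hE n m hnm, norm_sub_toFun_sq (h.measurableSet n)]
    have hmono : Monotone fun n => ‖y n‖ ^ 2 := by
      intro n m hnm
      have := hsub n m hnm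
      have h0 : 0 ≤ ‖y m - y n‖ ^ 2 := by positivity
      simp only
      linarith
    have hbdd : BddAbove (Set.range fun n => ‖y n‖ ^ 2) := by
      refine ⟨(⨆ n, ENNReal.ofReal (‖y n‖ ^ 2)).toReal, ?_⟩
      rintro _ ⟨n, rfl⟩
      refine (ENNReal.ofReal_le_iff_le_toReal hlt.ne).1 ?_
      exact le_iSup (fun n => ENNReal.ofReal (‖y n‖ ^ 2)) n
    have hc := (tendsto_atTop_ciSup hmono hbdd).cauchySeq
    have hcy : CauchySeq y := by
      rw [Metric.cauchySeq_iff'] at hc ⊢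
      intro ε hε
      obtain ⟨N, hN⟩ := hc (ε ^ 2) (by positivity)
      refine ⟨N, fun n hn => ?_⟩
      have := hN n hn
      rw [Real.dist_eq, ← hsub N n hn, abs_of_nonneg (by positivity)] at this
      rw [dist_eq_norm]
      exact lt_of_pow_lt_pow_left₀ 2 hε.le this
    obtain ⟨z, hz⟩ := cauchySeq_tendsto_of_complete hcy
    refine ⟨z, fun n => ?_⟩
    refine tendsto_nhds_unique (((E.toFun (ω n)).continuous.tendsto z).comp hz)
      (tendsto_const_nhds.congr' ?_)
    filter_upwards [eventually_ge_atTop n] with m hm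
    exact (hE n m hm).symm

theorem integrable_of_lintegral_sq {μ : Measure α} [IsFiniteMeasure μ] (hφ : Measurable φ)
    (h : ∫⁻ s, ‖φ s‖ₑ ^ 2 ∂μ < ∞) : Integrable φ μ := by
  refine ⟨hφ.aestronglyMeasurable, ?_⟩
  have : ∫⁻ s, (1 + ‖φ s‖ₑ ^ 2) ∂μ < ∞ := by
    rw [lintegral_add_left measurable_const]
    simp [h, measure_lt_top]
  refine lt_of_le_of_lt (lintegral_mono fun s => ?_) this
  rcases le_total ‖φ s‖ₑ 1 with h1 | h1
  · exact h1.trans le_self_add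
  · refine le_trans ?_ le_add_self
    rw [sq]
    exact le_mul_of_one_le_left' h1

/-- The graph of `∫ φ dE`. -/
def integralGraph (E : SpectralMeasure α H) (φ : α → ℂ) (ω : ℕ → Set α) :
    Submodule ℂ (H × H) where
  carrier := {p | ∀ n, E.toFun (ω n) p.2 = E.bcalc ((ω n).indicator φ) p.1}
  add_mem' := by
    intro a b ha hb n
    simp [ha n, hb n]
  zero_mem' := by simp
  smul_mem' := by
    intro c a ha n
    simp [ha n]

/-- The operator is recovered from its graph, which is single valued because the projections `E(ω
n)` separate points. The quadratic form identity passes to the limit by dominated convergence, as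
`φ` is integrable wherever `|φ|²` is. -/
theorem exists_isIntegral_graph (h : BddExhaustion φ ω) :
    ∃ T, E.IsIntegral φ T ∧ T.graph = E.integralGraph φ ω := by
  have hg : ∀ x ∈ E.integralGraph φ ω, x.1 = 0 → x.2 = 0 := by
    intro x hx h0
    refine eq_of_toFun_eq (E := E) h.measurableSet h.mono h.iUnion fun n => ?_
    rw [hx n, h0, map_zero, map_zero]
  refine ⟨(E.integralGraph φ ω).toLinearPMap, ?_, Submodule.toLinearPMap_graph_eq _ hg⟩
  have hgr := Submodule.toLinearPMap_graph_eq _ hg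
  have hdom : ∀ u, u ∈ (E.integralGraph φ ω).toLinearPMap.domain ↔
      ∫⁻ s, ‖φ s‖ₑ ^ 2 ∂(E.diag u) < ∞ := by
    intro u
    rw [← exists_forall_toFun_eq_iff h, LinearPMap.mem_domain_iff, hgr]
    rfl
  refine ⟨hdom, fun u => ?_⟩
  have hmem : ((u : H), (E.integralGraph φ ω).toLinearPMap u) ∈ E.integralGraph φ ω := by
    have := LinearPMap.mem_graph (E.integralGraph φ ω).toLinearPMap u
    rwa [hgr] at this
  have t1 := (tendsto_toFun (E := E) h.measurableSet h.mono h.iUnion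
    ((E.integralGraph φ ω).toLinearPMap u))
  have t2 := (Filter.Tendsto.inner (tendsto_const_nhds (x := (u : H))) t1 (𝕜 := ℂ))
  refine tendsto_nhds_unique t2 ?_
  have e : ∀ n, ⟪(u : H), E.toFun (ω n) ((E.integralGraph φ ω).toLinearPMap u)⟫_ℂ =
      ∫ s, (ω n).indicator φ s ∂(E.diag (u : H)) := by
    intro n
    rw [← inner_bcalc_self (h.bddMeas n), hmem n]
  simp only [e]
  have hint := integrable_of_lintegral_sq h.measurable ((hdom u).1 u.2)
  refine tendsto_integral_of_dominated_convergence (fun s => ‖φ s‖)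
    (fun n => (h.bddMeas n).1.aestronglyMeasurable) hint.norm
    (fun n => Eventually.of_forall fun s => norm_indicator_le_norm_self _ _)
    (Eventually.of_forall fun s => ?_)
  obtain ⟨i, hi⟩ := Set.mem_iUnion.1 (h.iUnion ▸ Set.mem_univ s : s ∈ ⋃ n, ω n)
  refine tendsto_const_nhds.congr' ?_
  filter_upwards [eventually_ge_atTop i] with n hn
  rw [Set.indicator_of_mem (h.mono hn hi)]

theorem toFun_mem_domain (h : BddExhaustion φ ω) {T : H →ₗ.[ℂ] H} (hT : E.IsIntegral φ T)
    {ω' : Set α} (hω' : MeasurableSet ω') {C : ℝ} (hC : ∀ x ∈ ω', ‖φ x‖ ≤ C) (u : H) :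
    E.toFun ω' u ∈ T.domain := by
  rw [hT.1, ← exists_forall_toFun_eq_iff h]
  have hb : BddMeas (ω'.indicator φ) := BddMeas.indicator h.measurable hω' hC
  refine ⟨E.bcalc (ω'.indicator φ) u, fun n => ?_⟩
  rw [← bcalc_indicator_one (h.measurableSet n), ← bcalc_indicator_one hω',
    bcalc_bcalc (BddMeas.indicator_one (h.measurableSet n)) hb,
    bcalc_bcalc (h.bddMeas n) (BddMeas.indicator_one hω')]
  congr 2
  ext x
  by_cases hx : x ∈ ω n <;> by_cases hx' : x ∈ ω' <;> simp [hx, hx']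

theorem IsIntegral.dense_domain (h : BddExhaustion φ ω) {T : H →ₗ.[ℂ] H}
    (hT : E.IsIntegral φ T) : Dense (T.domain : Set H) := fun u =>
  mem_closure_of_tendsto (tendsto_toFun (E := E) h.measurableSet h.mono h.iUnion u)
    (Eventually.of_forall fun n =>
      toFun_mem_domain h hT (h.measurableSet n) (h.bdd n).choose_spec u)

/-- Only diagonal values are prescribed. The difference of two candidates has zero quadratic form on
their common dense domain, and comparing `u + v` with `u + i v` isolates the off-diagonal terms. -/
theorem IsIntegral.unique (h : BddExhaustion φ ω) {S T : H →ₗ.[ℂ] H} (hS : E.IsIntegral φ S)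
    (hT : E.IsIntegral φ T) : S = T := by
  have hdom : S.domain = T.domain := by
    ext u
    rw [hS.1, hT.1]
  refine LinearPMap.ext hdom fun u hu hu' => ?_
  have key : ∀ w (hw : w ∈ S.domain) (hw' : w ∈ T.domain),
      ⟪w, S ⟨w, hw⟩ - T ⟨w, hw'⟩⟫_ℂ = 0 := by
    intro w hw hw'
    rw [inner_sub_right, hS.2 ⟨w, hw⟩, hT.2 ⟨w, hw'⟩, sub_self]
  rw [← sub_eq_zero]
  refine (hS.dense_domain h).eq_zero_of_inner_right ℂ fun v hv => ?_
  have hv' : v ∈ T.domain := hdom ▸ hv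
  have hIv := S.domain.smul_mem Complex.I hv
  have hIv' := T.domain.smul_mem Complex.I hv'
  have eS : ∀ a (ha : a ∈ S.domain) b (hb : b ∈ S.domain),
      S ⟨a + b, S.domain.add_mem ha hb⟩ = S ⟨a, ha⟩ + S ⟨b, hb⟩ :=
    fun a ha b hb => S.map_add ⟨a, ha⟩ ⟨b, hb⟩
  have eT : ∀ a (ha : a ∈ T.domain) b (hb : b ∈ T.domain),
      T ⟨a + b, T.domain.add_mem ha hb⟩ = T ⟨a, ha⟩ + T ⟨b, hb⟩ :=
    fun a ha b hb => T.map_add ⟨a, ha⟩ ⟨b, hb⟩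
  have sS : S ⟨Complex.I • v, hIv⟩ = Complex.I • S ⟨v, hv⟩ := S.map_smul Complex.I ⟨v, hv⟩
  have sT : T ⟨Complex.I • v, hIv'⟩ = Complex.I • T ⟨v, hv'⟩ := T.map_smul Complex.I ⟨v, hv'⟩
  have k0 := key u hu hu'
  have k1 := key v hv hv'
  have k2 := key (u + v) (S.domain.add_mem hu hv) (T.domain.add_mem hu' hv')
  have k3 := key (u + Complex.I • v) (S.domain.add_mem hu hIv) (T.domain.add_mem hu' hIv')
  rw [eS u hu v hv, eT u hu' v hv'] at k2
  rw [eS u hu _ hIv, eT u hu' _ hIv', sS, sT] at k3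
  simp only [inner_sub_right, inner_add_left, inner_add_right, inner_smul_left, inner_smul_right,
    Complex.conj_I] at k0 k1 k2 k3 ⊢
  linear_combination k2 / 2 + Complex.I * k3 / 2 - (1 + Complex.I) / 2 * (k0 + k1)
    + ((⟪v, S ⟨u, hu⟩⟫_ℂ - ⟪v, T ⟨u, hu'⟩⟫_ℂ) / 2 +
      Complex.I / 2 * (⟪v, S ⟨v, hv⟩⟫_ℂ - ⟪v, T ⟨v, hv'⟩⟫_ℂ) -
      (⟪u, S ⟨v, hv⟩⟫_ℂ - ⟪u, T ⟨v, hv'⟩⟫_ℂ) / 2) * Complex.I_sq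

theorem exists_isIntegral (h : BddExhaustion φ ω) : ∃ T, E.IsIntegral φ T :=
  (exists_isIntegral_graph h).imp fun _ h => h.1

theorem isIntegral_integral (h : BddExhaustion φ ω) : E.IsIntegral φ (E.integral φ) :=
  Classical.epsilon_spec (exists_isIntegral (E := E) h)

theorem IsIntegral.mem_graph_iff (h : BddExhaustion φ ω) {T : H →ₗ.[ℂ] H}
    (hT : E.IsIntegral φ T) {u y : H} :
    (u, y) ∈ T.graph ↔ ∀ n, E.toFun (ω n) y = E.bcalc ((ω n).indicator φ) u := by
  obtain ⟨S, hS, hg⟩ := exists_isIntegral_graph (E := E) h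
  rw [hT.unique h hS, hg]
  rfl

/-- When `1/φ` is bounded, `∫ φ dE` is the inverse of a bounded operator, and its graph can be
described without truncations. -/
theorem IsIntegral.mem_graph_iff_of_inv (h : BddExhaustion φ ω) {T : H →ₗ.[ℂ] H}
    (hT : E.IsIntegral φ T) {ψ : α → ℂ} (hψ : BddMeas ψ) (hinv : ∀ s, ψ s * φ s = 1) {u y : H} :
    (u, y) ∈ T.graph ↔ E.bcalc ψ y = u := by
  have hmul : ∀ n, ψ * (ω n).indicator φ = (ω n).indicator 1 := by
    intro n
    ext s
    by_cases hs : s ∈ ω n <;> simp [hs, hinv]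
  rw [hT.mem_graph_iff h]
  constructor
  · intro hy
    refine eq_of_toFun_eq (E := E) h.measurableSet h.mono h.iUnion fun n => ?_
    rw [toFun_comm_bcalc (h.measurableSet n) hψ, hy n, bcalc_bcalc hψ (h.bddMeas n), hmul,
      bcalc_indicator_one (h.measurableSet n)]
  · rintro rfl n
    rw [bcalc_bcalc (h.bddMeas n) hψ, mul_comm, hmul, bcalc_indicator_one (h.measurableSet n)]

theorem IsIntegral.toFun_apply (h : BddExhaustion φ ω) {T : H →ₗ.[ℂ] H}
    (hT : E.IsIntegral φ T) (u : T.domain) (n : ℕ) :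
    E.toFun (ω n) (T u) = E.bcalc ((ω n).indicator φ) u :=
  (hT.mem_graph_iff h).1 (T.mem_graph u) n

theorem IsIntegral.mem_graph_toFun (h : BddExhaustion φ ω) {T : H →ₗ.[ℂ] H}
    (hT : E.IsIntegral φ T) (n : ℕ) (u : H) :
    (E.toFun (ω n) u, E.bcalc ((ω n).indicator φ) u) ∈ T.graph := by
  rw [hT.mem_graph_iff h]
  intro m
  rw [← bcalc_indicator_one (h.measurableSet n), ← bcalc_indicator_one (h.measurableSet m),
    bcalc_bcalc (BddMeas.indicator_one (h.measurableSet m)) (h.bddMeas n),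
    bcalc_bcalc (h.bddMeas m) (BddMeas.indicator_one (h.measurableSet n))]
  congr 2
  ext x
  by_cases hx : x ∈ ω n <;> by_cases hx' : x ∈ ω m <;> simp [hx, hx']

end SpectralMeasure

/-! ### Resolvent and bounded inverse of a strictly positive selfadjoint operator -/

section Resolvent

variable {H : Type*} [NormedAddCommGroup H] [InnerProductSpace ℂ H] [CompleteSpace H]
  {A : H →ₗ.[ℂ] H}

theorem inner_apply_left (hA : IsSelfAdjoint A) (u v : A.domain) :
    ⟪A u, (v : H)⟫_ℂ = ⟪(u : H), A v⟫_ℂ := by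
  have h := LinearPMap.adjoint_isFormalAdjoint hA.dense_domain
  rw [LinearPMap.isSelfAdjoint_def.1 hA] at h
  exact h u v

theorem mem_graph_of_forall_inner (hA : IsSelfAdjoint A) {y z : H}
    (h : ∀ u : A.domain, ⟪z, (u : H)⟫_ℂ = ⟪y, A u⟫_ℂ) : (y, z) ∈ A.graph := by
  have hy : y ∈ A.adjoint.domain := LinearPMap.mem_adjoint_domain_of_exists y ⟨z, h⟩
  have he := LinearPMap.adjoint_apply_eq hA.dense_domain ⟨y, hy⟩ h
  have hm : (y, z) ∈ A.adjoint.graph := he ▸ A.adjoint.mem_graph ⟨y, hy⟩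
  rwa [LinearPMap.isSelfAdjoint_def.1 hA] at hm

/-- The operator `A - s` is bounded below by `c - s`, and `A` is closed, so the range is closed. A
vector orthogonal to the range satisfies `A y = s y` by selfadjointness, and the lower bound makes
it zero. -/
theorem mem_resolventSet_of_lt (hA : IsSelfAdjoint A) {c : ℝ}
    (hc : ∀ u : A.domain, c * ‖(u : H)‖ ^ 2 ≤ (⟪(u : H), A u⟫_ℂ).re) {s : ℝ} (hs : s < c) :
    (s : ℂ) ∈ resolventSet A := by
  have hcs : 0 < c - s := sub_pos.2 hs
  let L : A.domain →ₗ[ℂ] H := A.toFun - (s : ℂ) • A.domain.subtype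
  have hL : ∀ u : A.domain, L u = A u - (s : ℂ) • (u : H) := fun u => rfl
  have hbelow : ∀ u : A.domain, (c - s) * ‖(u : H)‖ ≤ ‖L u‖ := by
    intro u
    rcases eq_or_ne (u : H) 0 with h0 | h0
    · simp [h0]
    have hu : 0 < ‖(u : H)‖ := norm_pos_iff.2 h0
    have h1 : (c - s) * ‖(u : H)‖ ^ 2 ≤ (⟪(u : H), L u⟫_ℂ).re := by
      rw [hL, inner_sub_right, inner_smul_right, inner_self_eq_norm_sq_to_K, Complex.sub_re]
      have : ((s : ℂ) * ((‖(u : H)‖ : ℝ) : ℂ) ^ 2).re = s * ‖(u : H)‖ ^ 2 := by norm_cast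
      have h2 := hc u
      simp only [Complex.coe_algebraMap] at *
      rw [this]
      linarith
    have h2 : (⟪(u : H), L u⟫_ℂ).re ≤ ‖(u : H)‖ * ‖L u‖ := re_inner_le_norm (𝕜 := ℂ) _ _
    have h3 : ‖(u : H)‖ * ((c - s) * ‖(u : H)‖) ≤ ‖(u : H)‖ * ‖L u‖ := by nlinarith
    exact le_of_mul_le_mul_left h3 hu
  have hclosed : IsClosed (LinearMap.range L : Set H) := by
    refine IsSeqClosed.isClosed fun y z hy hz => ?_
    choose u hu using fun n => LinearMap.mem_range.1 (hy n)
    have hcu : CauchySeq fun n => (u n : H) := by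
      have hcy := hz.cauchySeq
      rw [Metric.cauchySeq_iff'] at hcy ⊢
      intro ε hε
      obtain ⟨N, hN⟩ := hcy ((c - s) * ε) (by positivity)
      refine ⟨N, fun n hn => ?_⟩
      have h1 := hN n hn
      have h2 := hbelow (u n - u N)
      rw [map_sub, hu, hu, ← dist_eq_norm] at h2
      rw [dist_eq_norm]
      exact lt_of_mul_lt_mul_left (h2.trans_lt h1) hcs.le
    obtain ⟨w, hw⟩ := cauchySeq_tendsto_of_complete hcu
    have hAu : Tendsto (fun n => A (u n)) atTop (𝓝 (z + (s : ℂ) • w)) := by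
      refine (hz.add (hw.const_smul (s : ℂ))).congr fun n => ?_
      rw [← hu n, hL, sub_add_cancel]
    have hg : (w, z + (s : ℂ) • w) ∈ A.graph :=
      hA.isClosed.mem_of_tendsto (hw.prodMk_nhds hAu)
        (Eventually.of_forall fun n => A.mem_graph (u n))
    obtain ⟨x, hx, hx'⟩ := A.mem_graph_iff.1 hg
    refine ⟨x, ?_⟩
    rw [hL, hx', hx]
    simp
  have hrange : LinearMap.range L = ⊤ := by
    have : CompleteSpace (LinearMap.range L) := hclosed.completeSpace_coe
    rw [← Submodule.orthogonal_eq_bot_iff, Submodule.eq_bot_iff]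
    intro y hy
    have hy' : ∀ u : A.domain, ⟪(s : ℂ) • y, (u : H)⟫_ℂ = ⟪y, A u⟫_ℂ := by
      intro u
      have h1 := (Submodule.mem_orthogonal' _ _).1 hy (L u) ⟨u, rfl⟩
      rw [hL, inner_sub_right, inner_smul_right, sub_eq_zero] at h1
      rw [h1, inner_smul_left, Complex.conj_ofReal]
    obtain ⟨x, hx, hx'⟩ := A.mem_graph_iff.1 (mem_graph_of_forall_inner hA hy')
    have h1 := hbelow x
    rw [hL, hx', hx] at h1
    simp only [sub_self, norm_zero] at h1
    have : ‖y‖ ≤ 0 := nonpos_of_mul_nonpos_right h1 hcs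
    simpa using this
  refine ⟨⟨?_, LinearMap.range_eq_top.1 hrange⟩, (c - s)⁻¹, fun u => ?_⟩
  · refine (injective_iff_map_eq_zero L).2 fun u hu => ?_
    have h1 := hbelow u
    rw [hu, norm_zero] at h1
    have : ‖(u : H)‖ ≤ 0 := nonpos_of_mul_nonpos_right h1 hcs
    exact Subtype.ext (by simpa using this)
  · rw [inv_mul_eq_div, le_div_iff₀ hcs, mul_comm]
    exact hbelow u

theorem le_of_mem_spec (hA : IsSelfAdjoint A) {c : ℝ}
    (hc : ∀ u : A.domain, c * ‖(u : H)‖ ^ 2 ≤ (⟪(u : H), A u⟫_ℂ).re) (s : spec A) :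
    c ≤ s := by
  by_contra! h
  exact s.2 (mem_resolventSet_of_lt hA hc h)

theorem exists_bounded_inverse (hA : IsSelfAdjoint A) (h0 : (0 : ℂ) ∈ resolventSet A) :
    ∃ B : H →L[ℂ] H, IsSelfAdjoint B ∧ ∀ u y, (u, y) ∈ A.graph ↔ B y = u := by
  obtain ⟨hbij, C, hC⟩ := h0
  simp only [zero_smul, sub_zero] at hbij hC
  let e : A.domain ≃ₗ[ℂ] H := LinearEquiv.ofBijective A.toFun hbij
  have he : ∀ y, A (e.symm y) = y := fun y => e.apply_symm_apply y
  let B : H →L[ℂ] H := (A.domain.subtype ∘ₗ (e.symm : H →ₗ[ℂ] A.domain)).mkContinuous C (by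
    intro y
    have := hC (e.symm y)
    rwa [he] at this)
  have hB : ∀ y, B y = (e.symm y : H) := fun y => rfl
  refine ⟨B, ?_, fun u y => ?_⟩
  · rw [ContinuousLinearMap.isSelfAdjoint_iff_isSymmetric]
    intro x y
    have := inner_apply_left hA (e.symm x) (e.symm y)
    rw [he, he] at this
    simpa only [ContinuousLinearMap.coe_coe, hB] using this.symm
  · rw [A.mem_graph_iff]
    constructor
    · rintro ⟨x, hx, hx'⟩
      have : e x = y := hx'
      rw [hB, ← this, e.symm_apply_apply]
      exact hx
    · intro h
      exact ⟨e.symm y, h, he y⟩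

/-- Since `r - B = r (A - r⁻¹) B` and `B` maps `H` bijectively onto the domain of `A`, bijectivity
of `A - r⁻¹` would make `r - B` invertible. -/
theorem inv_mem_spec {B : H →L[ℂ] H} (hB : ∀ u y, (u, y) ∈ A.graph ↔ B y = u) {r : ℝ}
    (hr : r ∈ spectrum ℝ B) (hr0 : r ≠ 0) : r⁻¹ ∈ spec A := by
  rintro ⟨hbij, -⟩
  refine hr ?_
  rw [spectrum.mem_resolventSet_iff, ContinuousLinearMap.isUnit_iff_bijective]
  have hr' : (r : ℂ) ≠ 0 := by exact_mod_cast hr0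
  have hdom : ∀ y, ∃ h : B y ∈ A.domain, A ⟨B y, h⟩ = y := by
    intro y
    obtain ⟨x, hx, hx'⟩ := A.mem_graph_iff.1 ((hB (B y) y).2 rfl)
    have hx : (x : H) = B y := hx
    have hxe : x = ⟨B y, hx ▸ x.2⟩ := Subtype.ext hx
    exact ⟨hx ▸ x.2, by rw [← hxe]; exact hx'⟩
  choose hd hAB using hdom
  have key : ∀ y, (algebraMap ℝ (H →L[ℂ] H) r - B) y =
      (r : ℂ) • (A ⟨B y, hd y⟩ - ((r⁻¹ : ℝ) : ℂ) • (B y)) := by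
    intro y
    rw [hAB, smul_sub, smul_smul]
    push_cast
    rw [mul_inv_cancel₀ hr', one_smul]
    simp [Algebra.algebraMap_eq_smul_one]
  constructor
  · refine (injective_iff_map_eq_zero _).2 fun y hy => ?_
    rw [key, smul_eq_zero, or_iff_right hr'] at hy
    have h0 : (⟨B y, hd y⟩ : A.domain) = 0 := hbij.1 (hy.trans (by simp))
    rw [← hAB y, h0]
    simp
  · intro z
    obtain ⟨u, hu⟩ := hbij.2 ((r : ℂ)⁻¹ • z)
    have hBu : B (A u) = u := (hB u (A u)).1 (A.mem_graph u)
    refine ⟨A u, ?_⟩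
    rw [key]
    have : (⟨B (A u), hd (A u)⟩ : A.domain) = u := Subtype.ext hBu
    rw [this, hBu]
    simp only at hu
    rw [hu, smul_inv_smul₀ hr']

end Resolvent

/-! ### Spectral measure of a bounded selfadjoint operator -/

section BoundedSelfAdjoint

variable {H : Type*} [NormedAddCommGroup H] [InnerProductSpace ℂ H]

section RepresentsMul

variable {X : Type*} [MeasurableSpace X] [TopologicalSpace X] [BorelSpace X]
  [HasOuterApproxClosed X] {μ : H → Measure X} [∀ u, IsFiniteMeasure (μ u)]

theorem Represents.mul_left_of_continuous (hex : ∀ φ, BddMeas φ → ∃ T, Represents μ φ T)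
    {ψ : X → ℂ} (hψ : BddMeas ψ) {T : H →L[ℂ] H}
    (h : ∀ (g : C(X, ℝ)) S, BddMeas (fun x => (g x : ℂ)) → Represents μ (fun x => (g x : ℂ)) S →
      Represents μ ((fun x => (g x : ℂ)) * ψ) (S * T))
    {φ : X → ℂ} (hφ : BddMeas φ) {S : H →L[ℂ] H} (hS : Represents μ φ S) :
    Represents μ (φ * ψ) (S * T) := by
  refine BddMeas.induction_continuous
    (P := fun φ => ∀ S, Represents μ φ S → Represents μ (φ * ψ) (S * T)) ?_ ?_ ?_ ?_ hφ S hS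
  · intro g h0 h1 S hS
    refine h g S ⟨by fun_prop, 1, fun x => ?_⟩ hS
    rw [Complex.norm_real, Real.norm_of_nonneg (h0 x)]
    exact h1 x
  · intro φ₁ φ₂ h₁ h₂ e₁ e₂ S hS
    obtain ⟨S₁, hS₁⟩ := hex φ₁ h₁
    obtain ⟨S₂, hS₂⟩ := hex φ₂ h₂
    rw [hS.unique (hS₁.add h₁ h₂ hS₂), add_mul, add_mul]
    exact (e₁ _ hS₁).add (h₁.mul hψ) (h₂.mul hψ) (e₂ _ hS₂)
  · intro c φ₁ h₁ e₁ S hS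
    obtain ⟨S₁, hS₁⟩ := hex φ₁ h₁
    rw [hS.unique (hS₁.smul c), smul_mul_assoc, smul_mul_assoc]
    exact (e₁ _ hS₁).smul c
  · intro φ φ' C hm hm' hC hC' hlim e S hS u
    choose S' hS' using fun n => hex (φ n) ⟨hm n, C, hC n⟩
    obtain ⟨hψm, D, hD⟩ := hψ
    have hb : ∀ n x, ‖(φ n * ψ) x‖ ≤ C * D := by
      intro n x
      rw [Pi.mul_apply, norm_mul]
      exact mul_le_mul (hC n x) (hD x) (norm_nonneg _) ((norm_nonneg _).trans (hC n x))
    have t1 := tendsto_integral_of_bounded (ν := μ u) (fun n => (hm n).mul hψm) hb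
      (fun x => (hlim x).mul_const (ψ x))
    have t2 := tendsto_inner_of_represents hm hC hlim hS' hS (T u) u
    refine tendsto_nhds_unique t2 (t1.congr fun n => ?_)
    exact (e n (S' n) (hS' n) u).symm

end RepresentsMul

variable [CompleteSpace H]

theorem inner_self_of_isSelfAdjoint {T : H →L[ℂ] H} (hT : IsSelfAdjoint T) (u : H) :
    ⟪u, T u⟫_ℂ = (((⟪u, T u⟫_ℂ).re : ℝ) : ℂ) := by
  rw [eq_comm, ← Complex.conj_eq_iff_re, inner_conj_symm]
  exact (ContinuousLinearMap.isSelfAdjoint_iff_isSymmetric.1 hT) u u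

variable {B : H →L[ℂ] H} (hB : IsSelfAdjoint B)

/-- The positive functional `g ↦ ⟨u, g(B) u⟩` on the continuous functions on `σ(B)`. -/
def cfcFunctional (u : H) :
    CompactlySupportedContinuousMap (spectrum ℝ B) ℝ →ₚ[ℝ] ℝ :=
  PositiveLinearMap.mk₀
    { toFun := fun g => (⟪u, cfcHom hB (g : C(spectrum ℝ B, ℝ)) u⟫_ℂ).re
      map_add' := by
        intro g g'
        have : ((g + g' : CompactlySupportedContinuousMap (spectrum ℝ B) ℝ) :
          C(spectrum ℝ B, ℝ)) = (g : C(spectrum ℝ B, ℝ)) + g' := rfl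
        rw [this, map_add]
        simp
      map_smul' := by
        intro c g
        have : ((c • g : CompactlySupportedContinuousMap (spectrum ℝ B) ℝ) :
          C(spectrum ℝ B, ℝ)) = c • (g : C(spectrum ℝ B, ℝ)) := rfl
        rw [this, map_smul]
        simp [inner_smul_right_eq_smul] }
    (by
      intro g hg
      have hg0 : ∀ x, 0 ≤ g x := fun x => hg x
      -- With `g = h²` the value becomes `⟨u, g(B)u⟩ = ‖h(B)u‖²`.
      let h : C(spectrum ℝ B, ℝ) := ⟨fun x => Real.sqrt (g x), by fun_prop⟩
      have hh : (g : C(spectrum ℝ B, ℝ)) = h * h := by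
        ext x
        exact (Real.mul_self_sqrt (hg0 x)).symm
      change 0 ≤ (⟪u, cfcHom hB (g : C(spectrum ℝ B, ℝ)) u⟫_ℂ).re
      rw [hh, map_mul]
      have hs : IsSelfAdjoint (cfcHom hB h) := cfcHom_predicate hB h
      have := (ContinuousLinearMap.isSelfAdjoint_iff_isSymmetric.1 hs) u (cfcHom hB h u)
      change 0 ≤ (⟪u, cfcHom hB h (cfcHom hB h u)⟫_ℂ).re
      simp only [ContinuousLinearMap.coe_coe] at this
      rw [← this]
      exact inner_self_nonneg (𝕜 := ℂ))

/-- The scalar spectral measure of `B` at `u`. -/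
def scalarMeasure (u : H) : Measure (spectrum ℝ B) :=
  RealRMK.rieszMeasure (cfcFunctional hB u)

instance (u : H) : IsFiniteMeasure (scalarMeasure hB u) := by
  unfold scalarMeasure
  infer_instance

theorem represents_cfcHom (g : C(spectrum ℝ B, ℝ)) :
    Represents (scalarMeasure hB) (fun x => (g x : ℂ)) (cfcHom hB g) := by
  intro u
  rw [inner_self_of_isSelfAdjoint (cfcHom_predicate hB g), integral_complex_ofReal]
  congr 1
  exact (RealRMK.integral_rieszMeasure (cfcFunctional hB u)
    (CompactlySupportedContinuousMap.continuousMapEquiv g)).symm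

theorem represents_one : Represents (scalarMeasure hB) 1 1 := by
  have h := represents_cfcHom hB 1
  rw [map_one] at h
  convert h using 1
  ext x
  simp

theorem scalarMeasure_real_univ (u : H) : (scalarMeasure hB u).real Set.univ = ‖u‖ ^ 2 := by
  have h := congrArg Complex.re (represents_one hB u)
  rw [← inner_self_eq_norm_sq (𝕜 := ℂ)]
  refine Eq.trans ?_ h.symm
  simp

theorem exists_represents_scalarMeasure {φ : spectrum ℝ B → ℂ} (hφ : BddMeas φ) :
    ∃ T, Represents (scalarMeasure hB) φ T := by
  refine BddMeas.induction_continuous (P := fun φ => ∃ T, Represents (scalarMeasure hB) φ T)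
    ?_ ?_ ?_ ?_ hφ
  · exact fun g _ _ => ⟨_, represents_cfcHom hB g⟩
  · rintro φ ψ hφ hψ ⟨S, hS⟩ ⟨T, hT⟩
    exact ⟨_, hS.add hφ hψ hT⟩
  · rintro c φ - ⟨S, hS⟩
    exact ⟨_, hS.smul c⟩
  · intro φ ψ C hm _ hC _ hlim h
    exact exists_represents_of_tendsto (fun u => (scalarMeasure_real_univ hB u).le) hm hC hlim h

/-- For two continuous functions this is multiplicativity of the continuous functional calculus. The
left factor is extended to bounded Borel functions, adjoints exchange the factors, and the extension
is applied once more. -/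
theorem represents_scalarMeasure_mul {φ ψ : spectrum ℝ B → ℂ} (hφ : BddMeas φ) (hψ : BddMeas ψ)
    {S T : H →L[ℂ] H} (hS : Represents (scalarMeasure hB) φ S)
    (hT : Represents (scalarMeasure hB) ψ T) : Represents (scalarMeasure hB) (φ * ψ) (S * T) := by
  have hex : ∀ φ, BddMeas φ → ∃ T, Represents (scalarMeasure hB) φ T :=
    fun φ => exists_represents_scalarMeasure hB
  have h1 : ∀ (h : C(spectrum ℝ B, ℝ)) T, BddMeas (fun x => (h x : ℂ)) →
      Represents (scalarMeasure hB) (fun x => (h x : ℂ)) T → ∀ φ S, BddMeas φ →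
      Represents (scalarMeasure hB) φ S →
      Represents (scalarMeasure hB) (φ * (fun x => (h x : ℂ))) (S * T) := by
    intro h T hb hT φ S hφ hS
    refine Represents.mul_left_of_continuous hex hb ?_ hφ hS
    intro g S _ hS
    rw [hS.unique (represents_cfcHom hB g), hT.unique (represents_cfcHom hB h), ← map_mul]
    convert represents_cfcHom hB (g * h) using 1
    ext x
    simp
  refine Represents.mul_left_of_continuous hex hψ ?_ hφ hS
  intro g S hg hS
  have h2 := (h1 g _ hg hS _ _ hψ.star hT.adjoint).adjoint
  have hgs : star (fun x => (g x : ℂ)) = fun x => (g x : ℂ) := by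
    ext x
    simp
  have hSs : ContinuousLinearMap.adjoint S = S := by
    have := hS.adjoint
    rw [hgs] at this
    exact this.unique hS
  rw [star_mul, star_star, hgs, ← ContinuousLinearMap.star_eq_adjoint, star_mul,
    ContinuousLinearMap.star_eq_adjoint, ContinuousLinearMap.star_eq_adjoint, hSs,
    ContinuousLinearMap.adjoint_adjoint] at h2
  exact h2

open Classical in
/-- The spectral measure of a bounded selfadjoint operator. -/
def boundedSpectralMeasure : SpectralMeasure (spectrum ℝ B) H where
  toFun ω := if h : MeasurableSet ω then
    (exists_represents_scalarMeasure hB (BddMeas.indicator_one h)).choose else 0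
  not_measurable ω h := dif_neg h
  isStarProjection ω h := by
    rw [dif_pos h]
    have hr := (exists_represents_scalarMeasure hB (BddMeas.indicator_one h)).choose_spec
    have hb := BddMeas.indicator_one h
    constructor
    · have := represents_scalarMeasure_mul hB hb hb hr hr
      have e : ω.indicator 1 * ω.indicator 1 = ω.indicator (1 : spectrum ℝ B → ℂ) := by
        ext x
        by_cases hx : x ∈ ω <;> simp [hx]
      rw [e] at this
      exact this.unique hr
    · have := hr.adjoint
      have e : star (ω.indicator (1 : spectrum ℝ B → ℂ)) = ω.indicator 1 := by
        ext x
        by_cases hx : x ∈ ω <;> simp [hx]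
      rw [e] at this
      exact this.unique hr
  empty := by
    rw [dif_pos .empty]
    have hr := (exists_represents_scalarMeasure hB (BddMeas.indicator_one .empty)).choose_spec
    refine hr.unique fun u => ?_
    simp
  univ := by
    rw [dif_pos .univ]
    have hr := (exists_represents_scalarMeasure hB (BddMeas.indicator_one .univ)).choose_spec
    refine hr.unique ?_
    rw [Set.indicator_univ]
    exact represents_one hB
  inter ω₁ ω₂ h₁ h₂ := by
    rw [dif_pos h₁, dif_pos h₂, dif_pos (h₁.inter h₂)]
    have hr := (exists_represents_scalarMeasure hB
      (BddMeas.indicator_one (h₁.inter h₂))).choose_spec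
    refine hr.unique ?_
    have := represents_scalarMeasure_mul hB (BddMeas.indicator_one h₁) (BddMeas.indicator_one h₂)
      (exists_represents_scalarMeasure hB (BddMeas.indicator_one h₁)).choose_spec
      (exists_represents_scalarMeasure hB (BddMeas.indicator_one h₂)).choose_spec
    convert this using 1
    ext x
    by_cases hx : x ∈ ω₁ <;> by_cases hx' : x ∈ ω₂ <;> simp [hx, hx']
  iUnion ω hω hd u v := by
    simp only [dif_pos (hω _), dif_pos (MeasurableSet.iUnion hω)]
    have hr := fun i => (exists_represents_scalarMeasure hB
      (BddMeas.indicator_one (hω i))).choose_spec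
    have hr' := (exists_represents_scalarMeasure hB
      (BddMeas.indicator_one (MeasurableSet.iUnion hω))).choose_spec
    have key : ∀ w : H, HasSum (fun i => ⟪w, (exists_represents_scalarMeasure hB
        (BddMeas.indicator_one (hω i))).choose w⟫_ℂ) ⟪w, (exists_represents_scalarMeasure hB
        (BddMeas.indicator_one (MeasurableSet.iUnion hω))).choose w⟫_ℂ := by
      intro w
      simp only [hr _ w, hr' w, integral_indicator (hω _),
        integral_indicator (MeasurableSet.iUnion hω)]
      exact hasSum_integral_iUnion hω hd (integrable_const (1 : ℂ)).integrableOn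
    have hT := fun i => inner_polarization ((exists_represents_scalarMeasure hB
        (BddMeas.indicator_one (hω i))).choose : H →ₗ[ℂ] H) u v
    have hS := inner_polarization ((exists_represents_scalarMeasure hB
        (BddMeas.indicator_one (MeasurableSet.iUnion hω))).choose : H →ₗ[ℂ] H) u v
    simp only [ContinuousLinearMap.coe_coe] at hT hS
    simp only [hT, hS]
    exact ((((key _).sub (key _)).add ((key _).mul_left _)).sub ((key _).mul_left _)).div_const _

theorem boundedSpectralMeasure_toFun {ω : Set (spectrum ℝ B)} (hω : MeasurableSet ω) :
    Represents (scalarMeasure hB) (ω.indicator 1) ((boundedSpectralMeasure hB).toFun ω) := by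
  have h := (exists_represents_scalarMeasure hB (BddMeas.indicator_one hω)).choose_spec
  simpa only [boundedSpectralMeasure, dif_pos hω] using h

theorem boundedSpectralMeasure_diag : (boundedSpectralMeasure hB).diag = scalarMeasure hB := by
  ext u ω hω
  rw [SpectralMeasure.diag, Measure.ofMeasurable_apply _ hω,
    boundedSpectralMeasure_toFun hB hω u, integral_indicator hω]
  simp

theorem boundedSpectralMeasure_bcalc_id :
    BddMeas (fun r : spectrum ℝ B => ((r : ℝ) : ℂ)) ∧
      (boundedSpectralMeasure hB).bcalc (fun r => ((r : ℝ) : ℂ)) = B := by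
  have hb : BddMeas (fun r : spectrum ℝ B => ((r : ℝ) : ℂ)) := by
    refine ⟨by fun_prop, ‖B‖ * ‖(1 : H →L[ℂ] H)‖, fun r => ?_⟩
    rw [Complex.norm_real]
    exact spectrum.norm_le_norm_mul_of_mem r.2
  refine ⟨hb, SpectralMeasure.bcalc_eq hb ?_⟩
  rw [boundedSpectralMeasure_diag]
  have h := represents_cfcHom hB ((ContinuousMap.id ℝ).restrict (spectrum ℝ B))
  rw [cfcHom_id] at h
  exact h

end BoundedSelfAdjoint

/-! ### Images of spectral measures and the spectral measure of `A` -/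

namespace SpectralMeasure

variable {α β : Type*} [MeasurableSpace α] [MeasurableSpace β]
  {H : Type*} [NormedAddCommGroup H] [InnerProductSpace ℂ H] [CompleteSpace H]

open Classical in
/-- The image of a spectral measure under a measurable map. -/
def map (E : SpectralMeasure α H) {g : α → β} (hg : Measurable g) : SpectralMeasure β H where
  toFun ω := if MeasurableSet ω then E.toFun (g ⁻¹' ω) else 0
  not_measurable ω h := if_neg h
  isStarProjection ω h := by
    rw [if_pos h]
    exact E.isStarProjection _ (hg h)
  empty := by simp [E.empty]
  univ := by simp [E.univ]
  inter ω₁ ω₂ h₁ h₂ := by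
    rw [if_pos h₁, if_pos h₂, if_pos (h₁.inter h₂), Set.preimage_inter, E.inter _ _ (hg h₁) (hg h₂)]
  iUnion ω hω hd u v := by
    simp only [if_pos (hω _), if_pos (MeasurableSet.iUnion hω), Set.preimage_iUnion]
    exact E.iUnion _ (fun i => hg (hω i)) (fun i j hij => (hd hij).preimage g) u v

theorem map_toFun (E : SpectralMeasure α H) {g : α → β} (hg : Measurable g) {ω : Set β}
    (hω : MeasurableSet ω) : (E.map hg).toFun ω = E.toFun (g ⁻¹' ω) := if_pos hω

theorem map_diag (E : SpectralMeasure α H) {g : α → β} (hg : Measurable g) (u : H) :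
    (E.map hg).diag u = (E.diag u).map g := by
  ext ω hω
  rw [Measure.map_apply hg hω, diag_apply _ _ hω, diag_apply _ _ (hg hω), map_toFun E hg hω]

theorem map_bcalc (E : SpectralMeasure α H) {g : α → β} (hg : Measurable g) {φ : β → ℂ}
    (hφ : BddMeas φ) : (E.map hg).bcalc φ = E.bcalc (φ ∘ g) := by
  refine bcalc_eq hφ fun u => ?_
  rw [map_diag, integral_map hg.aemeasurable hφ.1.aestronglyMeasurable,
    inner_bcalc_self (hφ.comp hg)]
  rfl

end SpectralMeasure

open SpectralMeasure

theorem bddExhaustion_sublevel {σ : Set ℝ} {φ : σ → ℂ}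
    (hφ : Measurable φ) {f : σ → ℝ} (hf : Measurable f)
    (hb : ∀ n : ℕ, ∃ C : ℝ, ∀ s : σ, (s : ℝ) ≤ n → f s ≤ n → ‖φ s‖ ≤ C) :
    BddExhaustion φ (fun n : ℕ => {s : σ | (s : ℝ) ≤ n ∧ f s ≤ n}) where
  measurable := hφ
  measurableSet n := (measurableSet_le measurable_subtype_coe measurable_const).inter
    (measurableSet_le hf measurable_const)
  mono n m hnm s hs := by
    have : (n : ℝ) ≤ m := by exact_mod_cast hnm
    exact ⟨hs.1.trans this, hs.2.trans this⟩
  iUnion := by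
    refine Set.eq_univ_of_forall fun s => Set.mem_iUnion.2 ?_
    obtain ⟨n, hn⟩ := exists_nat_ge (max (s : ℝ) (f s))
    exact ⟨n, (le_max_left _ _).trans hn, (le_max_right _ _).trans hn⟩
  bdd n := by
    obtain ⟨C, hC⟩ := hb n
    exact ⟨C, fun s hs => hC s hs.1 hs.2⟩

theorem bddMeas_inv {σ : Set ℝ} {c : ℝ} (hc0 : 0 < c) (hc : ∀ s : σ, c ≤ s) :
    BddMeas (fun s : σ => (((s : ℝ)⁻¹ : ℝ) : ℂ)) := by
  refine ⟨Complex.measurable_ofReal.comp measurable_subtype_coe.inv, c⁻¹, fun s => ?_⟩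
  have hs : 0 < (s : ℝ) := hc0.trans_le (hc s)
  rw [Complex.norm_real, Real.norm_of_nonneg (by positivity)]
  exact inv_anti₀ hc0 (hc s)

section Existence

variable {H : Type*} [NormedAddCommGroup H] [InnerProductSpace ℂ H] [CompleteSpace H]
  {A : H →ₗ.[ℂ] H}

/-- On a spectrum contained in `{0}` the identity function vanishes, so the operator would be zero.
The point found here provides a value for the inversion map at `r = 0`. -/
theorem exists_mem_spectrum_ne_zero [Nontrivial H] {B : H →L[ℂ] H} (hB : IsSelfAdjoint B)
    (hinj : Function.Injective B) : ∃ r ∈ spectrum ℝ B, r ≠ 0 := by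
  by_contra! h
  have hz : ((ContinuousMap.id ℝ).restrict (spectrum ℝ B)) = 0 := by
    ext r
    exact h r r.2
  have h0 : B = 0 := by
    rw [← cfcHom_id (R := ℝ) hB, hz, map_zero]
  obtain ⟨x, hx⟩ := exists_ne (0 : H)
  exact hx (hinj (by simp [h0]))

/-- The spectral measure of `B = A⁻¹` is pushed forward under `r ↦ 1/r`. The resulting calculus
sends `1/s` to `B`, so `∫ s dE` and `A` have the same inverse. -/
theorem exists_isSpectralMeasureOf [Nontrivial H] (hA : IsSelfAdjoint A)
    (hpos : StrictlyPositive A) : ∃ E : SpectralMeasure (spec A) H, IsSpectralMeasureOf A E := by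
  obtain ⟨c, hc0, hc⟩ := hpos
  have hspec := le_of_mem_spec hA hc
  have hres : (0 : ℂ) ∈ resolventSet A := by
    have := mem_resolventSet_of_lt hA hc hc0
    rwa [Complex.ofReal_zero] at this
  obtain ⟨B, hB, hgr⟩ := exists_bounded_inverse hA hres
  have hinj : Function.Injective B := by
    refine (injective_iff_map_eq_zero B).2 fun y hy => ?_
    exact A.graph_fst_eq_zero_snd ((hgr 0 y).2 hy) rfl
  obtain ⟨r₀, hr₀, hr₀'⟩ := exists_mem_spectrum_ne_zero hB hinj
  let F := boundedSpectralMeasure hB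
  obtain ⟨hid, hFB⟩ := boundedSpectralMeasure_bcalc_id hB
  classical
  -- The point `0` may belong to the spectrum of `B`; it is sent to an arbitrary point of `σ(A)`,
  -- which is harmless because its spectral projection vanishes.
  let g : spectrum ℝ B → spec A := fun r =>
    if h : (r : ℝ) = 0 then ⟨r₀⁻¹, inv_mem_spec hgr hr₀ hr₀'⟩ else ⟨(r : ℝ)⁻¹, inv_mem_spec hgr r.2 h⟩
  have hgval : ∀ r, (g r : ℝ) = if (r : ℝ) = 0 then r₀⁻¹ else (r : ℝ)⁻¹ := by
    intro r
    simp only [g]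
    split_ifs <;> rfl
  have hg : Measurable g := by
    refine Measurable.subtype_mk (f := fun r : spectrum ℝ B => (g r : ℝ)) ?_
    simp only [hgval]
    refine Measurable.ite ?_ measurable_const measurable_subtype_coe.inv
    exact measurable_subtype_coe (measurableSet_singleton 0)
  have hzero : MeasurableSet {r : spectrum ℝ B | (r : ℝ) = 0} :=
    measurable_subtype_coe (measurableSet_singleton 0)
  -- The projection onto `{r = 0}` is annihilated by `B`, which is injective.
  have hnull : ∀ u, F.diag u {r : spectrum ℝ B | (r : ℝ) = 0} = 0 := by
    intro u
    rw [diag_apply _ _ hzero]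
    have : F.toFun {r : spectrum ℝ B | (r : ℝ) = 0} u = 0 := by
      refine hinj ?_
      rw [map_zero, ← congrArg (fun T : H →L[ℂ] H => T _) hFB, ← bcalc_indicator_one hzero,
        bcalc_bcalc hid (BddMeas.indicator_one hzero)]
      have : (fun r : spectrum ℝ B => ((r : ℝ) : ℂ)) *
          {r : spectrum ℝ B | (r : ℝ) = 0}.indicator 1 = (0 : ℂ) • 1 := by
        ext r
        by_cases hr : (r : ℝ) = 0 <;> simp [hr]
      rw [this, bcalc_smul 0 (φ := 1) (BddMeas.const 1), zero_smul]
      rfl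
    simp [this]
  let E := F.map hg
  have hinv := bddMeas_inv hc0 hspec
  have hEB : E.bcalc (fun s : spec A => (((s : ℝ)⁻¹ : ℝ) : ℂ)) = B := by
    rw [map_bcalc F hg hinv]
    refine (bcalc_congr_ae (hinv.comp hg) hid fun u => ?_).trans hFB
    have hae : ∀ᵐ r : spectrum ℝ B ∂(F.diag u), (r : ℝ) ≠ 0 := by
      rw [ae_iff]
      simpa only [not_not] using hnull u
    filter_upwards [hae] with r hr
    simp [hgval, hr]
  have hex : BddExhaustion (fun s : spec A => ((s : ℝ) : ℂ))
      (fun n : ℕ => {s : spec A | (s : ℝ) ≤ n ∧ (0 : ℝ) ≤ n}) := by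
    refine bddExhaustion_sublevel (by fun_prop) measurable_const fun n => ⟨n, fun s hs _ => ?_⟩
    rw [Complex.norm_real, Real.norm_of_nonneg (hc0.le.trans (hspec s))]
    exact hs
  obtain ⟨T, hT⟩ := exists_isIntegral (E := E) hex
  have hTA : T = A := by
    refine LinearPMap.eq_of_eq_graph ?_
    ext ⟨u, y⟩
    rw [hgr, ← hEB]
    refine hT.mem_graph_iff_of_inv hex hinv fun s => ?_
    have hs : (s : ℝ) ≠ 0 := (hc0.trans_le (hspec s)).ne'
    rw [← Complex.ofReal_mul, inv_mul_cancel₀ hs, Complex.ofReal_one]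
  exact ⟨E, by rwa [hTA] at hT⟩

end Existence

/-! ### The spectral measure charges every neighbourhood in `σ(A)` -/

section Support

variable {H : Type*} [NormedAddCommGroup H] [InnerProductSpace ℂ H] [CompleteSpace H]
  {A : H →ₗ.[ℂ] H} {E : SpectralMeasure (spec A) H} {ω : ℕ → Set (spec A)}

/-- Neighbourhoods of spectral points carry nonzero spectral projections. -/
theorem exists_toFun_ne_zero (hE : IsSpectralMeasureOf A E)
    (h : BddExhaustion (fun s : spec A => ((s : ℝ) : ℂ)) ω) (s₀ : spec A) {δ : ℝ} (hδ : 0 < δ)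
    {U : Set (spec A)} (hU : MeasurableSet U)
    (hUs : ∀ s : spec A, |(s : ℝ) - s₀| < δ → s ∈ U) : ∃ w, E.toFun U w ≠ 0 := by
  by_contra! h0
  refine s₀.2 ?_
  have hnull : ∀ u, ∀ᵐ s ∂(E.diag u), s ∉ U := by
    intro u
    rw [ae_iff]
    simp only [not_not, Set.ofPred_mem_eq]
    rw [diag_apply _ _ hU, h0 u]
    simp
  -- Off `U` the function `1/(s - s₀)` is bounded by `1/δ`. If `E(U)` vanishes, its integral is a
  -- bounded inverse of `A - s₀`, contrary to `s₀ ∈ σ(A)`.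
  let ψ : spec A → ℂ := Uᶜ.indicator fun s => (((s : ℝ) - s₀ : ℝ) : ℂ)⁻¹
  have hψ : BddMeas ψ := by
    refine BddMeas.indicator (C := δ⁻¹) (by fun_prop) hU.compl fun s hs => ?_
    have : δ ≤ |(s : ℝ) - s₀| := by
      by_contra! hlt
      exact hs (hUs s hlt)
    rw [norm_inv, Complex.norm_real, Real.norm_eq_abs]
    exact inv_anti₀ hδ this
  let R := E.bcalc ψ
  have hmul : ∀ n, ψ * ((ω n).indicator (fun s => ((s : ℝ) : ℂ)) -
      ((s₀ : ℝ) : ℂ) • (ω n).indicator 1) = (ω n ∩ Uᶜ).indicator 1 := by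
    intro n
    ext s
    by_cases hs : s ∈ ω n <;> by_cases hs' : s ∈ U
    · simp [ψ, hs, hs']
    · have hne : ((s : ℝ) : ℂ) - ((s₀ : ℝ) : ℂ) ≠ 0 := by
        intro he
        refine hs' (hUs s ?_)
        have : (s : ℝ) - s₀ = 0 := by exact_mod_cast he
        simpa [this] using hδ
      simp [ψ, hs, hs', inv_mul_cancel₀ hne]
    · simp [ψ, hs, hs']
    · simp [ψ, hs, hs']
  have hone : ∀ n, E.bcalc ((ω n ∩ Uᶜ).indicator 1) = E.toFun (ω n) := by
    intro n
    rw [← bcalc_indicator_one (h.measurableSet n)]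
    refine bcalc_congr_ae (BddMeas.indicator_one ((h.measurableSet n).inter hU.compl))
      (BddMeas.indicator_one (h.measurableSet n)) fun u => ?_
    filter_upwards [hnull u] with s hs
    by_cases hs' : s ∈ ω n <;> simp [hs, hs']
  have hb : ∀ n, BddMeas ((ω n).indicator (fun s => ((s : ℝ) : ℂ)) -
      ((s₀ : ℝ) : ℂ) • (ω n).indicator 1) := fun n =>
    (h.bddMeas n).sub ((BddMeas.indicator_one (h.measurableSet n)).smul _)
  have hbc : ∀ n u, E.bcalc ((ω n).indicator (fun s => ((s : ℝ) : ℂ)) -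
      ((s₀ : ℝ) : ℂ) • (ω n).indicator 1) u =
      E.bcalc ((ω n).indicator fun s => ((s : ℝ) : ℂ)) u - ((s₀ : ℝ) : ℂ) • E.toFun (ω n) u := by
    intro n u
    rw [bcalc_sub (h.bddMeas n) ((BddMeas.indicator_one (h.measurableSet n)).smul _),
      bcalc_smul _ (BddMeas.indicator_one (h.measurableSet n)),
      bcalc_indicator_one (h.measurableSet n)]
    rfl
  have hleft : ∀ u : A.domain, R (A u - ((s₀ : ℝ) : ℂ) • (u : H)) = u := by
    intro u
    refine eq_of_toFun_eq (E := E) h.measurableSet h.mono h.iUnion fun n => ?_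
    rw [toFun_comm_bcalc (h.measurableSet n) hψ, map_sub, map_smul,
      IsIntegral.toFun_apply h hE u n, ← hbc, bcalc_bcalc hψ (hb n), hmul, hone]
  have hright : ∀ y, (R y, y + ((s₀ : ℝ) : ℂ) • R y) ∈ A.graph := by
    intro y
    rw [IsIntegral.mem_graph_iff h hE]
    intro n
    have h1 : E.bcalc ((ω n).indicator (fun s => ((s : ℝ) : ℂ)) -
      ((s₀ : ℝ) : ℂ) • (ω n).indicator 1) (R y) = E.toFun (ω n) y := by
      rw [bcalc_bcalc (hb n) hψ, mul_comm, hmul, hone]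
    rw [hbc] at h1
    rw [map_add, map_smul, ← h1, sub_add_cancel]
  refine ⟨⟨fun u v huv => ?_, fun y => ?_⟩, ‖R‖, fun u => ?_⟩
  · simp only at huv
    exact Subtype.ext (by rw [← hleft u, ← hleft v, huv])
  · obtain ⟨x, hx, hx'⟩ := A.mem_graph_iff.1 (hright y)
    refine ⟨x, ?_⟩
    simp only at hx hx' ⊢
    rw [hx', hx, add_sub_cancel_right]
  · conv_lhs => rw [← hleft u]
    exact R.le_opNorm _

end Support

/-! ### Exponentials of bounded operators -/

section Exponentials

variable {K : Type*} [NormedAddCommGroup K] [InnerProductSpace ℂ K]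

theorem hasDerivAt_norm_sq {z : ℝ → K} {z' : K} {t : ℝ} (h : HasDerivAt z z' t) :
    HasDerivAt (fun t => ‖z t‖ ^ 2) (2 * (⟪z t, z'⟫_ℂ).re) t := by
  have h1 := h.inner ℂ h
  have h2 := (Complex.reCLM.hasFDerivAt.comp_hasDerivAt t h1)
  have e : (fun t => ‖z t‖ ^ 2) = Complex.reCLM ∘ fun t => ⟪z t, z t⟫_ℂ := by
    ext s
    exact (inner_self_eq_norm_sq (𝕜 := ℂ) (z s)).symm
  rw [e]
  refine h2.congr_deriv ?_
  rw [map_add, ← inner_conj_symm z' (z t)]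
  simp only [Complex.reCLM_apply, Complex.conj_re]
  ring

variable [CompleteSpace K]

theorem hasDerivAt_exp_apply (G : K →L[ℂ] K) (z : K) (t : ℝ) :
    HasDerivAt (fun t : ℝ => NormedSpace.exp (t • G) z) (NormedSpace.exp (t • G) (G z)) t :=
  (((ContinuousLinearMap.apply ℂ K z).restrictScalars ℝ).hasFDerivAt).comp_hasDerivAt t
    (hasDerivAt_exp_smul_const G t)

theorem exp_apply_comm (G : K →L[ℂ] K) (z : K) (t : ℝ) :
    NormedSpace.exp (t • G) (G z) = G (NormedSpace.exp (t • G) z) :=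
  congrArg (fun T : K →L[ℂ] K => T z) (((Commute.refl G).smul_left t).exp_left).eq

theorem exp_add_apply (G : K →L[ℂ] K) (z : K) (s t : ℝ) :
    NormedSpace.exp ((s + t) • G) z = NormedSpace.exp (s • G) (NormedSpace.exp (t • G) z) := by
  let _ : NormedAlgebra ℚ (K →L[ℂ] K) := .restrictScalars ℚ ℂ _
  rw [add_smul, NormedSpace.exp_add_of_commute (((Commute.refl G).smul_left s).smul_right t)]
  rfl

theorem exp_zero_apply (G : K →L[ℂ] K) (z : K) : NormedSpace.exp ((0 : ℝ) • G) z = z := by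
  rw [zero_smul, NormedSpace.exp_zero]
  rfl

/-- Along `z(t) = exp(tG)z` the derivative of `‖z(t)‖²` is `2 Re ⟨z(t), G z(t)⟩ ≤ 0`. -/
theorem norm_exp_apply_le {G : K →L[ℂ] K} (hG : ∀ z, (⟪z, G z⟫_ℂ).re ≤ 0) {t : ℝ} (ht : 0 ≤ t)
    (z : K) : ‖NormedSpace.exp (t • G) z‖ ≤ ‖z‖ := by
  have hd := fun s => hasDerivAt_norm_sq (hasDerivAt_exp_apply G z s)
  have ha : Antitone fun s : ℝ => ‖NormedSpace.exp (s • G) z‖ ^ 2 := by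
    refine antitone_of_hasDerivAt_nonpos hd fun s => ?_
    rw [exp_apply_comm]
    have := hG (NormedSpace.exp (s • G) z)
    simp only [Pi.zero_apply]
    linarith
  have h := ha ht
  simp only [exp_zero_apply] at h
  exact le_of_sq_le_sq h (norm_nonneg _)

theorem exp_apply_of_semiconj {P G G' : K →L[ℂ] K} (h : P * G = G' * P) (t : ℝ) (z : K) :
    P (NormedSpace.exp (t • G) z) = NormedSpace.exp (t • G') (P z) := by
  have hs : SemiconjBy P (t • G) (t • G') := by
    rw [SemiconjBy, mul_smul_comm, smul_mul_assoc, h]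
  let _ : NormedAlgebra ℚ (K →L[ℂ] K) := .restrictScalars ℚ ℂ _
  exact congrArg (fun T : K →L[ℂ] K => T z) hs.exp_right.eq

end Exponentials

/-! ### Orbits of strongly continuous semigroups -/

section Semigroup

variable {K : Type*} [NormedAddCommGroup K] [NormedSpace ℂ K] {S : ℝ≥0 → K →L[ℂ] K}

theorem IsC0Semigroup.apply_mem_generatorGraph (hS : IsC0Semigroup S) {z z' : K}
    (h : (z, z') ∈ generatorGraph S) (t : ℝ≥0) : (S t z, S t z') ∈ generatorGraph S := by
  have h1 := ((S t).continuous.tendsto z').comp h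
  refine h1.congr fun s => ?_
  have e : S s (S t z) = S t (S s z) := by
    have h2 := hS.add s t
    have h3 := hS.add t s
    rw [add_comm, h2] at h3
    exact congrArg (fun T : K →L[ℂ] K => T z) h3
  simp only [Function.comp_apply, map_smul, map_sub, e]

/-- The semigroup law reduces the right difference quotient at `t` to the one at `0` of the vector
`S t z`. A one-sided derivative suffices for the constancy argument in
`DissipativeApprox.proj_semigroup`. -/
theorem hasDerivWithinAt_of_mem_generatorGraph (hS : IsC0Semigroup S) {z z' : K}
    (h : (z, z') ∈ generatorGraph S) {t : ℝ} (ht : 0 ≤ t) :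
    HasDerivWithinAt (fun s : ℝ => S s.toNNReal z) (S t.toNNReal z') (Set.Ici t) t := by
  rw [hasDerivWithinAt_iff_tendsto_slope, Set.Ici_sdiff_left]
  have hg := hS.apply_mem_generatorGraph h t.toNNReal
  have hmap : Tendsto (fun s : ℝ => (s - t).toNNReal) (𝓝[>] t) (𝓝[≠] 0) := by
    refine tendsto_nhdsWithin_iff.2 ⟨?_, ?_⟩
    · have : Continuous fun s : ℝ => (s - t).toNNReal := by fun_prop
      refine (this.tendsto' t 0 (by simp)).mono_left nhdsWithin_le_nhds
    · filter_upwards [self_mem_nhdsWithin] with s hs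
      have : 0 < s - t := sub_pos.2 hs
      simpa using this
  refine (hg.comp hmap).congr' ?_
  filter_upwards [self_mem_nhdsWithin] with s hs
  have hst : 0 < s - t := sub_pos.2 hs
  have e : s.toNNReal = (s - t).toNNReal + t.toNNReal := by
    rw [← Real.toNNReal_add hst.le ht, sub_add_cancel]
  rw [slope_def_module, Function.comp_apply, Real.coe_toNNReal _ hst.le, e, hS.add]
  simp only [ContinuousLinearMap.comp_apply]
  rw [← Complex.ofReal_inv]
  exact Complex.coe_smul _ _

variable [CompleteSpace K]

/-- Otherwise there are times `h k → 0` with `‖S (h k)‖ > k`, while every orbit `S (h k) z`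
converges, against the uniform boundedness principle. -/
theorem IsC0Semigroup.exists_bound_near_zero (hS : IsC0Semigroup S) :
    ∃ δ : ℝ≥0, 0 < δ ∧ ∃ C : ℝ, ∀ h ≤ δ, ‖S h‖ ≤ C := by
  by_contra! hcon
  have hp : ∀ k : ℕ, ∃ h : ℝ≥0, h ≤ 1 / ((k : ℝ≥0) + 1) ∧ (k : ℝ) < ‖S h‖ :=
    fun k => hcon (1 / ((k : ℝ≥0) + 1)) (by positivity) k
  choose h hh hk using hp
  have hlim : Tendsto h atTop (𝓝 0) :=
    tendsto_of_tendsto_of_tendsto_of_le_of_le tendsto_const_nhds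
      tendsto_one_div_add_atTop_nhds_zero_nat (fun _ => zero_le) hh
  obtain ⟨C, hC⟩ := banach_steinhaus (g := fun k => S (h k)) (fun z => by
    obtain ⟨C, hC⟩ := ((hS.tendsto z).comp hlim).norm.bddAbove_range
    exact ⟨C, fun k => hC ⟨k, rfl⟩⟩)
  obtain ⟨k, hk'⟩ := exists_nat_gt C
  exact absurd (hC k) (not_le.2 (hk'.trans (hk k)))

theorem IsC0Semigroup.exists_bound (hS : IsC0Semigroup S) (T : ℝ≥0) :
    ∃ C : ℝ, ∀ t ≤ T, ‖S t‖ ≤ C := by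
  obtain ⟨δ, hδ, C₀, hC₀⟩ := hS.exists_bound_near_zero
  have key : ∀ k : ℕ, ∃ C : ℝ, ∀ t ≤ k * δ, ‖S t‖ ≤ C := by
    intro k
    induction k with
    | zero =>
      refine ⟨C₀, fun t ht => hC₀ t (ht.trans ?_)⟩
      simp
    | succ k ih =>
      obtain ⟨C, hC⟩ := ih
      refine ⟨max C (C₀ * C), fun t ht => ?_⟩
      rcases le_total t (k * δ) with h | h
      · exact (hC t h).trans (le_max_left _ _)
      · have e : t = (t - k * δ) + k * δ := (tsub_add_cancel_of_le h).symm
        have h1 : t - k * δ ≤ δ := by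
          rw [tsub_le_iff_right]
          refine ht.trans (le_of_eq ?_)
          push_cast
          ring
        rw [e, hS.add]
        refine (ContinuousLinearMap.opNorm_comp_le _ _).trans (le_trans ?_ (le_max_right _ _))
        exact mul_le_mul (hC₀ _ h1) (hC _ le_rfl) (norm_nonneg _)
          ((norm_nonneg _).trans (hC₀ _ h1))
  obtain ⟨k, hk⟩ := exists_nat_ge (T / δ)
  obtain ⟨C, hC⟩ := key k
  refine ⟨C, fun t ht => hC t (ht.trans ?_)⟩
  rwa [div_le_iff₀ hδ] at hk

theorem IsC0Semigroup.continuous (hS : IsC0Semigroup S) (z : K) : Continuous fun t => S t z := by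
  rw [continuous_iff_continuousAt]
  intro t
  obtain ⟨C, hC⟩ := hS.exists_bound (t + 1)
  have hC0 : 0 ≤ C := (norm_nonneg _).trans (hC 0 zero_le)
  have key : ∀ a b : ℝ≥0, a ≤ t + 1 → a ≤ b → ‖S b z - S a z‖ ≤ C * ‖S (b - a) z - z‖ := by
    intro a b ha hab
    have e : b = a + (b - a) := (add_tsub_cancel_of_le hab).symm
    have : S b z - S a z = S a (S (b - a) z - z) := by
      rw [map_sub]
      conv_lhs => rw [e, hS.add]
      rfl
    rw [this]
    exact (ContinuousLinearMap.le_opNorm _ _).trans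
      (mul_le_mul_of_nonneg_right (hC a ha) (norm_nonneg _))
  -- Subtraction in `ℝ≥0` is truncated, so at least one summand is zero and the other handles the
  -- actual order of `s` and `t`.
  have hbd : ∀ᶠ s in 𝓝 t, ‖S s z - S t z‖ ≤
      C * ‖S (s - t) z - z‖ + C * ‖S (t - s) z - z‖ := by
    filter_upwards with s
    have ht1 : t ≤ t + 1 := le_self_add
    rcases le_total s t with h | h
    · rw [norm_sub_rev]
      refine (key s t (h.trans ht1) h).trans ?_
      have : 0 ≤ C * ‖S (s - t) z - z‖ := by positivity
      linarith
    · refine (key t s ht1 h).trans ?_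
      have : 0 ≤ C * ‖S (t - s) z - z‖ := by positivity
      linarith
  have t1 : Tendsto (fun s => s - t) (𝓝 t) (𝓝 0) := by
    have : Continuous fun s => s - t := by fun_prop
    simpa using this.tendsto t
  have t2 : Tendsto (fun s => t - s) (𝓝 t) (𝓝 0) := by
    have : Continuous fun s => t - s := by fun_prop
    simpa using this.tendsto t
  have t3 : ∀ g : ℝ≥0 → ℝ≥0, Tendsto g (𝓝 t) (𝓝 0) →
      Tendsto (fun s => C * ‖S (g s) z - z‖) (𝓝 t) (𝓝 0) := by
    intro g hg
    have h1 := (((hS.tendsto z).comp hg).sub_const z).norm.const_mul C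
    simpa using h1
  have t4 := (t3 _ t1).add (t3 _ t2)
  rw [add_zero] at t4
  rw [ContinuousAt, tendsto_iff_norm_sub_tendsto_zero]
  exact squeeze_zero' (Eventually.of_forall fun s => norm_nonneg _) hbd t4

end Semigroup

/-! ### Semigroups as limits of truncated exponentials -/

section Approximation

variable {K : Type*} [NormedAddCommGroup K] [InnerProductSpace ℂ K]

/-- Bounded dissipative operators `G n` on an increasing sequence of projections `P n` that
converges strongly to the identity, each `G n` being the part of the later ones on the range
of `P n`. -/
structure DissipativeApprox (P G : ℕ → K →L[ℂ] K) : Prop where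
  tendsto : ∀ z, Tendsto (fun n => P n z) atTop (𝓝 z)
  norm_le : ∀ n z, ‖P n z‖ ≤ ‖z‖
  mul_proj : ∀ m n, m ≤ n → P n * P m = P m
  gen_mul_proj : ∀ m n, m ≤ n → G n * P m = G m
  proj_mul_gen : ∀ m n, m ≤ n → P m * G n = G m
  dissipative : ∀ n z, (⟪z, G n z⟫_ℂ).re ≤ 0

namespace DissipativeApprox

variable {P G : ℕ → K →L[ℂ] K} (h : DissipativeApprox P G)

include h

theorem eq_of_proj_eq {z z' : K} (he : ∀ n, P n z = P n z') : z = z' :=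
  tendsto_nhds_unique (h.tendsto z) ((h.tendsto z').congr fun n => (he n).symm)

/-- Both sides equal `G (min m n) z`. Consequently `(P n z, G n z)` lies in the graph of the
limiting generator. -/
theorem gen_proj_eq (m n : ℕ) (z : K) : G m (P n z) = P m (G n z) := by
  have happ : ∀ {S T : K →L[ℂ] K}, S = T → S z = T z := fun e => congrArg (fun U => U z) e
  rcases le_total m n with hmn | hmn
  · have h1 : P m (G n z) = G m z := happ (h.proj_mul_gen m n hmn)
    have h2 : G m * P n = G m := by
      rw [← h.proj_mul_gen m n hmn, mul_assoc, h.gen_mul_proj n n le_rfl]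
    exact (happ h2).trans h1.symm
  · have h1 : G m (P n z) = G n z := happ (h.gen_mul_proj n m hmn)
    have h2 : P m * G n = G n := by
      rw [← h.proj_mul_gen n m hmn, ← mul_assoc, h.mul_proj n m hmn]
    exact h1.trans (happ h2).symm

variable [CompleteSpace K]

theorem proj_exp {m n : ℕ} (hmn : m ≤ n) (t : ℝ) (z : K) :
    P m (NormedSpace.exp (t • G n) z) = NormedSpace.exp (t • G m) (P m z) :=
  exp_apply_of_semiconj ((h.proj_mul_gen m n hmn).trans (h.gen_mul_proj m m le_rfl).symm) t z

theorem exp_proj {m n : ℕ} (hmn : m ≤ n) (t : ℝ) (z : K) :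
    NormedSpace.exp (t • G n) (P m z) = NormedSpace.exp (t • G m) (P m z) := by
  rw [← h.proj_exp le_rfl]
  exact (exp_apply_of_semiconj ((h.proj_mul_gen m m le_rfl).trans
    (h.gen_mul_proj m n hmn).symm) t z).symm

/-- On `P m z` the exponentials with index at least `m` agree, and being contractions they move the
remainder `z - P m z` to vectors no longer than it; hence the sequence is Cauchy. -/
theorem exists_limit : ∃ S : ℝ≥0 → K →L[ℂ] K, ∀ (t : ℝ≥0) z,
    Tendsto (fun n => NormedSpace.exp ((t : ℝ) • G n) z) atTop (𝓝 (S t z)) := by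
  have hlim : ∀ (t : ℝ≥0) z, ∃ y, Tendsto (fun n => NormedSpace.exp ((t : ℝ) • G n) z) atTop
      (𝓝 y) := by
    intro t z
    refine cauchySeq_tendsto_of_complete (Metric.cauchySeq_iff'.2 fun ε hε => ?_)
    obtain ⟨m, hm⟩ := (Metric.tendsto_atTop.1 (h.tendsto z) (ε / 2) (by positivity))
    refine ⟨m, fun n hn => ?_⟩
    have hm' := hm m le_rfl
    rw [dist_comm, dist_eq_norm] at hm'
    have e : ∀ k, m ≤ k → NormedSpace.exp ((t : ℝ) • G k) z =
        NormedSpace.exp ((t : ℝ) • G m) (P m z) + NormedSpace.exp ((t : ℝ) • G k) (z - P m z) := by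
      intro k hk
      rw [map_sub, h.exp_proj hk]
      abel
    have hb : ∀ k, ‖NormedSpace.exp ((t : ℝ) • G k) (z - P m z)‖ < ε / 2 := fun k =>
      (norm_exp_apply_le (h.dissipative k) t.2 _).trans_lt hm'
    rw [dist_eq_norm, e n hn, e m le_rfl, add_sub_add_left_eq_sub]
    calc _ ≤ _ := norm_sub_le _ _
      _ < ε / 2 + ε / 2 := add_lt_add (hb n) (hb m)
      _ = ε := by ring
  choose y hy using hlim
  exact ⟨fun t => continuousLinearMapOfTendsto (fun n => NormedSpace.exp ((t : ℝ) • G n))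
    (f := y t) (tendsto_pi_nhds.2 (hy t)), fun t z => hy t z⟩

/-- After applying `P n` the limit is `exp(t G n)`, which gives the semigroup law and one inclusion
for the generator. The reverse inclusion needs a remainder estimate for `S t z - z - t z'` that is
uniform in `n`. -/
theorem exists_semigroup : ∃ S : ℝ≥0 → K →L[ℂ] K, IsC0Semigroup S ∧ (∀ t z, ‖S t z‖ ≤ ‖z‖) ∧
    generatorGraph S = {p | ∀ n, G n p.1 = P n p.2} := by
  obtain ⟨S, hS⟩ := h.exists_limit
  have hproj : ∀ n t z, P n (S t z) = NormedSpace.exp ((t : ℝ) • G n) (P n z) := by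
    intro n t z
    refine tendsto_nhds_unique (((P n).continuous.tendsto _).comp (hS t z))
      (tendsto_const_nhds.congr' ?_)
    filter_upwards [eventually_ge_atTop n] with m hm
    exact (h.proj_exp hm t z).symm
  have hSproj : ∀ n t z, S t (P n z) = NormedSpace.exp ((t : ℝ) • G n) (P n z) := by
    intro n t z
    refine tendsto_nhds_unique (hS t (P n z)) (tendsto_const_nhds.congr' ?_)
    filter_upwards [eventually_ge_atTop n] with m hm
    exact (h.exp_proj hm t z).symm
  have hcontr : ∀ t z, ‖S t z‖ ≤ ‖z‖ := fun t z =>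
    le_of_tendsto (hS t z).norm
      (Eventually.of_forall fun n => norm_exp_apply_le (h.dissipative n) t.2 z)
  have hC0 : IsC0Semigroup S := by
    refine ⟨?_, ?_, ?_⟩
    · ext z
      refine h.eq_of_proj_eq fun n => ?_
      rw [hproj, NNReal.coe_zero, exp_zero_apply]
      rfl
    · intro s t
      ext z
      refine h.eq_of_proj_eq fun n => ?_
      rw [hproj, NNReal.coe_add, exp_add_apply, ContinuousLinearMap.comp_apply, hproj, hproj]
    · intro z
      rw [Metric.tendsto_nhds]
      intro ε hε
      obtain ⟨m, hm⟩ := (Metric.tendsto_atTop.1 (h.tendsto z) (ε / 3) (by positivity))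
      have hm' := hm m le_rfl
      have hd : Tendsto (fun t : ℝ≥0 => NormedSpace.exp ((t : ℝ) • G m) (P m z)) (𝓝 0)
          (𝓝 (P m z)) := by
        have h1 : Tendsto (fun t : ℝ => NormedSpace.exp (t • G m) (P m z)) (𝓝 0) (𝓝 (P m z)) := by
          simpa only [exp_zero_apply] using (hasDerivAt_exp_apply (G m) (P m z) 0).continuousAt.tendsto
        exact h1.comp (NNReal.continuous_coe.tendsto' 0 0 rfl)
      filter_upwards [Metric.tendsto_nhds.1 hd (ε / 3) (by positivity)] with t ht
      rw [← hSproj] at ht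
      calc dist (S t z) z ≤ dist (S t z) (S t (P m z)) + dist (S t (P m z)) (P m z)
            + dist (P m z) z := dist_triangle4 _ _ _ _
        _ < ε / 3 + ε / 3 + ε / 3 := by
            gcongr
            rw [dist_eq_norm, ← map_sub]
            refine (hcontr t _).trans_lt ?_
            rwa [← dist_eq_norm, dist_comm]
        _ = ε := by ring
  refine ⟨S, hC0, hcontr, Set.Subset.antisymm ?_ ?_⟩
  · rintro ⟨z, z'⟩ hz n
    have h1 := ((P n).continuous.tendsto z').comp hz
    have h2 := hasDerivAt_iff_tendsto_slope.1 (hasDerivAt_exp_apply (G n) (P n z) 0)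
    have hmap : Tendsto (fun t : ℝ≥0 => (t : ℝ)) (𝓝[≠] 0) (𝓝[≠] 0) := by
      refine tendsto_nhdsWithin_iff.2 ⟨?_, ?_⟩
      · exact (NNReal.continuous_coe.tendsto' 0 0 rfl).mono_left nhdsWithin_le_nhds
      · filter_upwards [self_mem_nhdsWithin] with t ht
        simpa using ht
    have h3 := h2.comp hmap
    rw [exp_zero_apply, h.gen_proj_eq n n,
      show P n (G n z) = G n z from
        congrArg (fun U : K →L[ℂ] K => U z) (h.proj_mul_gen n n le_rfl)] at h3
    refine tendsto_nhds_unique h3 (h1.congr fun t => ?_)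
    simp only [Function.comp_apply, map_smul, map_sub, hproj, slope_def_module, exp_zero_apply,
      sub_zero]
    rw [← Complex.ofReal_inv]
    exact Complex.coe_smul _ _
  · rintro ⟨z, z'⟩ hz
    have hz : ∀ n, G n z = P n z' := hz
    have hP : ∀ n, G n (P n z) = P n z' := fun n => by
      rw [h.gen_proj_eq, ← hz n]
      exact congrArg (fun U : K →L[ℂ] K => U z) (h.proj_mul_gen n n le_rfl)
    change Tendsto (fun t : ℝ≥0 => ((t : ℝ) : ℂ)⁻¹ • (S t z - z)) (𝓝[≠] 0) (𝓝 z')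
    rw [Metric.tendsto_nhds]
    intro ε hε
    have hcont := Metric.tendsto_nhds.1 (hC0.tendsto z') (ε / 2) (by positivity)
    obtain ⟨δ, hδ, hball⟩ := Metric.eventually_nhds_iff.1 hcont
    have hsmall : ∀ t : ℝ≥0, (t : ℝ) < δ → ‖S t z - z - (t : ℝ) • z'‖ ≤ ε / 2 * t := by
      intro t ht
      -- The derivative of `exp(τ G n) P n z - τ P n z'` is `P n (S τ z' - z')`, which is small for
      -- small `τ` uniformly in `n`; the mean value inequality then applies.
      have hn : ∀ n, ‖S t (P n z) - P n z - (t : ℝ) • P n z'‖ ≤ ε / 2 * t := by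
        intro n
        have hder : ∀ τ ∈ Set.Icc (0 : ℝ) t, HasDerivWithinAt
            (fun τ : ℝ => NormedSpace.exp (τ • G n) (P n z) - τ • P n z')
            (NormedSpace.exp (τ • G n) (P n z') - P n z') (Set.Icc 0 (t : ℝ)) τ := by
          intro τ _
          have h1 := (hasDerivAt_exp_apply (G n) (P n z) τ).sub
            ((hasDerivAt_id τ).smul_const (P n z'))
          rw [hP, one_smul] at h1
          exact h1.hasDerivWithinAt
        have hb : ∀ τ ∈ Set.Ico (0 : ℝ) t,
            ‖NormedSpace.exp (τ • G n) (P n z') - P n z'‖ ≤ ε / 2 := by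
          intro τ hτ
          obtain ⟨σ, rfl⟩ : ∃ σ : ℝ≥0, (σ : ℝ) = τ := ⟨⟨τ, hτ.1⟩, rfl⟩
          rw [← hproj, ← map_sub]
          refine (h.norm_le n _).trans ?_
          rw [← dist_eq_norm]
          refine (hball ?_).le
          rw [NNReal.dist_eq, NNReal.coe_zero, sub_zero, NNReal.abs_eq]
          exact hτ.2.trans ht
        have := norm_image_sub_le_of_norm_deriv_le_segment' hder hb t (Set.right_mem_Icc.2 t.2)
        beta_reduce at this
        rw [exp_zero_apply, zero_smul, sub_zero, sub_zero] at this
        rw [hSproj]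
        convert this using 2
        abel
      have hl : Tendsto (fun n => S t (P n z) - P n z - (t : ℝ) • P n z') atTop
          (𝓝 (S t z - z - (t : ℝ) • z')) :=
        ((((S t).continuous.tendsto z).comp (h.tendsto z)).sub (h.tendsto z)).sub
          ((h.tendsto z').const_smul (t : ℝ))
      exact le_of_tendsto hl.norm (Eventually.of_forall hn)
    have hev : ∀ᶠ t : ℝ≥0 in 𝓝[≠] 0, (t : ℝ) < δ :=
      nhdsWithin_le_nhds ((NNReal.continuous_coe.tendsto' 0 0 rfl).eventually (gt_mem_nhds hδ))
    filter_upwards [hev, self_mem_nhdsWithin] with t ht ht0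
    have htpos : 0 < (t : ℝ) := NNReal.coe_pos.2 (pos_iff_ne_zero.2 ht0)
    have e : ((t : ℝ) : ℂ)⁻¹ • (S t z - z) - z' = (t : ℝ)⁻¹ • (S t z - z - (t : ℝ) • z') := by
      rw [smul_sub (t : ℝ)⁻¹ (S t z - z), inv_smul_smul₀ htpos.ne', ← Complex.ofReal_inv]
      congr 1
    rw [dist_eq_norm, e, norm_smul, norm_inv, Real.norm_of_nonneg htpos.le]
    calc _ ≤ (t : ℝ)⁻¹ * (ε / 2 * t) := by
            gcongr
            exact hsmall t ht
      _ = ε / 2 := by field_simp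
      _ < ε := by linarith

/-- This is uniqueness of the semigroup with the given generator, without assuming contractivity: on
the domain, `exp(-s G n) P n S(s) z` has right derivative zero and is therefore constant. -/
theorem proj_semigroup {S : ℝ≥0 → K →L[ℂ] K} (hS : IsC0Semigroup S)
    (hgen : generatorGraph S = {p | ∀ n, G n p.1 = P n p.2}) (n : ℕ) (t : ℝ≥0) (z : K) :
    P n (S t z) = NormedSpace.exp ((t : ℝ) • G n) (P n z) := by
  have hdom : ∀ z z', (z, z') ∈ generatorGraph S →
      P n (S t z) = NormedSpace.exp ((t : ℝ) • G n) (P n z) := by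
    intro z z' hz
    let w : ℝ → K := fun s => NormedSpace.exp (s • (-G n)) (P n (S s.toNNReal z))
    have hcont : ContinuousOn w (Set.Icc 0 (t : ℝ)) := by
      have h1 : Continuous fun s : ℝ => NormedSpace.exp (s • (-G n)) :=
        continuous_iff_continuousAt.2 fun s => (hasDerivAt_exp_smul_const (-G n) s).continuousAt
      have h2 : Continuous fun s : ℝ => P n (S s.toNNReal z) :=
        (P n).continuous.comp ((hS.continuous z).comp continuous_real_toNNReal)
      exact (h1.clm_apply h2).continuousOn
    have hder : ∀ s ∈ Set.Ico (0 : ℝ) t, HasDerivWithinAt w 0 (Set.Ici s) s := by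
      intro s hs
      have h1 := (hasDerivAt_exp_smul_const (-G n) s).hasDerivWithinAt (s := Set.Ici s)
      have h2 := hasDerivWithinAt_of_mem_generatorGraph hS hz hs.1
      have h3 := ((P n).restrictScalars ℝ).hasFDerivAt.comp_hasDerivWithinAt s h2
      have hm := hS.apply_mem_generatorGraph hz s.toNNReal
      rw [hgen] at hm
      have hm : G n (S s.toNNReal z) = P n (S s.toNNReal z') := hm n
      have h4 := (((ContinuousLinearMap.restrictScalarsL ℂ K K ℝ ℝ).hasFDerivAt).comp_hasDerivWithinAt
        s h1).clm_apply h3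
      refine HasDerivWithinAt.congr_deriv (f := w) h4 ?_
      change (NormedSpace.exp (s • -G n) * -G n) (P n (S s.toNNReal z)) +
        NormedSpace.exp (s • -G n) (P n (S s.toNNReal z')) = 0
      rw [← hm]
      have e : G n (P n (S s.toNNReal z)) = G n (S s.toNNReal z) :=
        congrArg (fun U : K →L[ℂ] K => U _) (h.gen_mul_proj n n le_rfl)
      have e2 : (NormedSpace.exp (s • -G n) * -G n) (P n (S s.toNNReal z)) =
          -NormedSpace.exp (s • -G n) (G n (S s.toNNReal z)) := by
        rw [← e]
        simp
      rw [e2]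
      simp
    have hconst := constant_of_has_deriv_right_zero hcont hder t (Set.right_mem_Icc.2 t.2)
    simp only [w, exp_zero_apply, Real.toNNReal_coe, Real.toNNReal_zero, hS.zero] at hconst
    have h5 := congrArg (fun y => NormedSpace.exp ((t : ℝ) • G n) y) hconst
    simp only [ContinuousLinearMap.id_apply] at h5
    rw [← h5]
    have h6 : NormedSpace.exp ((t : ℝ) • G n) * NormedSpace.exp ((t : ℝ) • -G n) = 1 := by
      let _ : NormedAlgebra ℚ (K →L[ℂ] K) := .restrictScalars ℚ ℂ _
      rw [← NormedSpace.exp_add_of_commute]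
      · simp
      · exact (((Commute.refl (G n)).neg_right).smul_left _).smul_right _
    exact (congrArg (fun U : K →L[ℂ] K => U (P n (S t z))) h6).symm
  -- The vectors `P m z` lie in the domain and converge to `z`, which removes the restriction to the
  -- domain.
  have hd : ∀ m, P n (S t (P m z)) = NormedSpace.exp ((t : ℝ) • G n) (P n (P m z)) := by
    intro m
    refine hdom (P m z) (G m z) ?_
    rw [hgen]
    exact fun k => h.gen_proj_eq k m z
  have hl : ∀ T : K →L[ℂ] K, Tendsto (fun m => T (P m z)) atTop (𝓝 (T z)) := fun T =>
    (T.continuous.tendsto z).comp (h.tendsto z)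
  refine tendsto_nhds_unique (hl (P n * S t)) ((hl (NormedSpace.exp ((t : ℝ) • G n) * P n)).congr
    fun m => ?_)
  exact (hd m).symm

end DissipativeApprox

end Approximation

/-! ### Block operators and truncated wave generators on `H × H` -/

section Blocks

variable {H : Type*} [NormedAddCommGroup H] [InnerProductSpace ℂ H]

/-- An operator on `H × H` viewed on the Hilbert space direct sum. -/
def blockOp (T : H × H →L[ℂ] H × H) : WithLp 2 (H × H) →L[ℂ] WithLp 2 (H × H) :=
  ((WithLp.prodContinuousLinearEquiv 2 ℂ H H).symm : H × H →L[ℂ] WithLp 2 (H × H)) ∘L T ∘L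
    ((WithLp.prodContinuousLinearEquiv 2 ℂ H H) : WithLp 2 (H × H) →L[ℂ] H × H)

/-- The operator `(x, y) ↦ (Q x, Q y)`. -/
def diagOp (Q : H →L[ℂ] H) : WithLp 2 (H × H) →L[ℂ] WithLp 2 (H × H) := blockOp (Q.prodMap Q)

/-- The operator `(x, y) ↦ (a y, - a x - f y)`. -/
def waveOp (a f : H →L[ℂ] H) : WithLp 2 (H × H) →L[ℂ] WithLp 2 (H × H) :=
  blockOp ((a ∘L ContinuousLinearMap.snd ℂ H H).prod
    (-(a ∘L ContinuousLinearMap.fst ℂ H H) - f ∘L ContinuousLinearMap.snd ℂ H H))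

theorem withLp_prod_ext {z z' : WithLp 2 (H × H)} (h₁ : z.fst = z'.fst) (h₂ : z.snd = z'.snd) :
    z = z' :=
  WithLp.ofLp_injective 2 (Prod.ext h₁ h₂)

end Blocks

section Multipliers

variable {α : Type*} [MeasurableSpace α] {H : Type*} [NormedAddCommGroup H]
  [InnerProductSpace ℂ H] [CompleteSpace H]

/-- The part of multiplication by the real function `f` on the set `ω`. -/
def partOp (E : SpectralMeasure α H) (f : α → ℝ) (ω : Set α) : H →L[ℂ] H :=
  E.bcalc (ω.indicator fun s => (f s : ℂ))

variable {E : SpectralMeasure α H} {f : α → ℝ} {ω : ℕ → Set α}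

theorem star_indicator_ofReal (f : α → ℝ) (ω : Set α) :
    star (ω.indicator fun s => (f s : ℂ)) = ω.indicator fun s => (f s : ℂ) := by
  ext s
  by_cases hs : s ∈ ω <;> simp [hs]

theorem inner_partOp_left (h : BddExhaustion (fun s => (f s : ℂ)) ω) (n : ℕ) (x y : H) :
    ⟪partOp E f (ω n) x, y⟫_ℂ = ⟪x, partOp E f (ω n) y⟫_ℂ :=
  inner_bcalc_left_of_real (h.bddMeas n) (star_indicator_ofReal f (ω n)) x y

theorem inner_partOp_self (h : BddExhaustion (fun s => (f s : ℂ)) ω) (n : ℕ) (x : H) :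
    ⟪x, partOp E f (ω n) x⟫_ℂ = ((∫ s in ω n, f s ∂(E.diag x) : ℝ) : ℂ) := by
  rw [partOp, inner_bcalc_self (h.bddMeas n), integral_indicator (h.measurableSet n),
    integral_complex_ofReal]

theorem partOp_toFun (h : BddExhaustion (fun s => (f s : ℂ)) ω) {m n : ℕ} (hmn : m ≤ n) (x : H) :
    partOp E f (ω n) (E.toFun (ω m) x) = partOp E f (ω m) x :=
  bcalc_indicator_toFun (h.measurableSet m) (h.bddMeas n) (h.mono hmn) x

theorem toFun_partOp (h : BddExhaustion (fun s => (f s : ℂ)) ω) {m n : ℕ} (hmn : m ≤ n) (x : H) :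
    E.toFun (ω m) (partOp E f (ω n) x) = partOp E f (ω m) x :=
  toFun_bcalc_indicator (h.measurableSet m) (h.bddMeas n) (h.mono hmn) x

theorem dissipativeApprox {a f : α → ℝ} (ha : BddExhaustion (fun s => (a s : ℂ)) ω)
    (hf : BddExhaustion (fun s => (f s : ℂ)) ω) (hf0 : ∀ s, 0 ≤ f s) :
    DissipativeApprox (fun n => diagOp (E.toFun (ω n)))
      (fun n => waveOp (partOp E a (ω n)) (partOp E f (ω n))) where
  tendsto z := by
    have h := fun x => tendsto_toFun (E := E) ha.measurableSet ha.mono ha.iUnion x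
    have h1 := (h z.fst).prodMk_nhds (h z.snd)
    exact ((WithLp.prodContinuousLinearEquiv 2 ℂ H H).symm.continuous.tendsto _).comp h1
  norm_le n z := by
    refine le_of_sq_le_sq ?_ (norm_nonneg _)
    rw [WithLp.prod_norm_sq_eq_of_L2, WithLp.prod_norm_sq_eq_of_L2]
    exact add_le_add (pow_le_pow_left₀ (norm_nonneg _) (norm_toFun_le _ _) 2)
      (pow_le_pow_left₀ (norm_nonneg _) (norm_toFun_le _ _) 2)
  mul_proj m n hmn := by
    have h : ∀ x, E.toFun (ω n) (E.toFun (ω m) x) = E.toFun (ω m) x := by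
      intro x
      have e := E.inter _ _ (ha.measurableSet n) (ha.measurableSet m)
      rw [Set.inter_eq_right.2 (ha.mono hmn)] at e
      exact (congrArg (fun T : H →L[ℂ] H => T x) e).symm
    ext z
    exact withLp_prod_ext (h _) (h _)
  gen_mul_proj m n hmn := by
    ext z
    refine withLp_prod_ext (partOp_toFun ha hmn _) ?_
    change -partOp E a (ω n) (E.toFun (ω m) z.fst) - partOp E f (ω n) (E.toFun (ω m) z.snd) = _
    rw [partOp_toFun ha hmn, partOp_toFun hf hmn]
    rfl
  proj_mul_gen m n hmn := by
    ext z
    refine withLp_prod_ext (toFun_partOp ha hmn _) ?_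
    change E.toFun (ω m) (-partOp E a (ω n) z.fst - partOp E f (ω n) z.snd) = _
    rw [map_sub, map_neg, toFun_partOp ha hmn, toFun_partOp hf hmn]
    rfl
  dissipative n z := by
    rw [WithLp.prod_inner_apply]
    change (⟪z.fst, partOp E a (ω n) z.snd⟫_ℂ +
      ⟪z.snd, -partOp E a (ω n) z.fst - partOp E f (ω n) z.snd⟫_ℂ).re ≤ 0
    -- The two terms with `a` are conjugate up to sign, so their real parts cancel and only `-∫ f
    -- d⟨E y, y⟩` remains.
    rw [inner_sub_right, inner_neg_right, ← inner_partOp_left ha, inner_partOp_self hf,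
      ← inner_conj_symm z.snd (partOp E a (ω n) z.fst)]
    simp only [Complex.add_re, Complex.sub_re, Complex.neg_re, Complex.conj_re, Complex.ofReal_re]
    have : 0 ≤ ∫ s in ω n, f s ∂(E.diag z.snd) := integral_nonneg hf0
    linarith

end Multipliers

/-! ### The phase space in the coordinates `(A^{1/2}u, v)` -/

section PhaseSpace

variable {H : Type*} [NormedAddCommGroup H] [InnerProductSpace ℂ H] [CompleteSpace H]
  {A : H →ₗ.[ℂ] H}

theorem exists_spectralMeasure_funCalc [Nontrivial H] (hA : IsSelfAdjoint A)
    (hpos : StrictlyPositive A) : ∃ E : SpectralMeasure (spec A) H, IsSpectralMeasureOf A E ∧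
      ∀ φ, funCalc A φ = E.integral φ := by
  have h := exists_isSpectralMeasureOf hA hpos
  exact ⟨h.choose, h.choose_spec, fun φ => dif_pos h⟩

/-- The sets `{s ∈ σ(A) : s ≤ n, f(s) ≤ n}`. -/
def sublevel (f : spec A → ℝ) (n : ℕ) : Set (spec A) := {s | (s : ℝ) ≤ n ∧ f s ≤ n}

theorem bddExhaustion_sublevel_of_le {f g : spec A → ℝ} (hf : Measurable f) (hg : Measurable g)
    (hg0 : ∀ s, 0 ≤ g s) (hb : ∀ n : ℕ, ∃ C : ℝ, ∀ s : spec A, (s : ℝ) ≤ n → f s ≤ n → g s ≤ C) :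
    BddExhaustion (fun s => (g s : ℂ)) (sublevel f) := by
  refine bddExhaustion_sublevel (by fun_prop) hf fun n => ?_
  obtain ⟨C, hC⟩ := hb n
  refine ⟨C, fun s h1 h2 => ?_⟩
  rw [Complex.norm_real, Real.norm_of_nonneg (hg0 s)]
  exact hC s h1 h2

variable {c : ℝ} {f : spec A → ℝ}

theorem bddExhaustion_id (hc0 : 0 < c) (hc : ∀ s : spec A, c ≤ s) (hf : Measurable f) :
    BddExhaustion (fun s : spec A => ((s : ℝ) : ℂ)) (sublevel f) :=
  bddExhaustion_sublevel_of_le hf measurable_subtype_coe (fun s => hc0.le.trans (hc s))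
    fun n => ⟨n, fun _ h _ => h⟩

theorem bddExhaustion_sqrt (hf : Measurable f) :
    BddExhaustion (fun s : spec A => ((Real.sqrt (s : ℝ) : ℝ) : ℂ)) (sublevel f) :=
  bddExhaustion_sublevel_of_le hf measurable_subtype_coe.sqrt (fun _ => Real.sqrt_nonneg _)
    fun n => ⟨Real.sqrt n, fun _ h _ => Real.sqrt_le_sqrt h⟩

theorem bddExhaustion_self (hf : Measurable f) (hf0 : ∀ s, 0 ≤ f s) :
    BddExhaustion (fun s : spec A => (f s : ℂ)) (sublevel f) :=
  bddExhaustion_sublevel_of_le hf hf hf0 fun n => ⟨n, fun _ _ h => h⟩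

/-- The function `s ↦ s^{-1/2}`. -/
def invSqrt (s : spec A) : ℂ := (((Real.sqrt (s : ℝ))⁻¹ : ℝ) : ℂ)

theorem bddMeas_invSqrt (hc0 : 0 < c) (hc : ∀ s : spec A, c ≤ s) :
    BddMeas (invSqrt : spec A → ℂ) ∧ ∀ s : spec A, ‖invSqrt s‖ ≤ (Real.sqrt c)⁻¹ := by
  have hb : ∀ s : spec A, ‖invSqrt s‖ ≤ (Real.sqrt c)⁻¹ := by
    intro s
    rw [invSqrt, Complex.norm_real, Real.norm_of_nonneg (by positivity)]
    exact inv_anti₀ (Real.sqrt_pos.2 hc0) (Real.sqrt_le_sqrt (hc s))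
  exact ⟨⟨Complex.measurable_ofReal.comp measurable_subtype_coe.sqrt.inv, _, hb⟩, hb⟩

theorem invSqrt_mul_sqrt (hc0 : 0 < c) (hc : ∀ s : spec A, c ≤ s) (s : spec A) :
    invSqrt s * ((Real.sqrt (s : ℝ) : ℝ) : ℂ) = 1 := by
  have hs : Real.sqrt (s : ℝ) ≠ 0 := (Real.sqrt_pos.2 (hc0.trans_le (hc s))).ne'
  rw [invSqrt, ← Complex.ofReal_mul, inv_mul_cancel₀ hs, Complex.ofReal_one]

variable {E : SpectralMeasure (spec A) H}

theorem mem_graph_sqrtOp_iff (hE : ∀ φ, funCalc A φ = E.integral φ) (hc0 : 0 < c)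
    (hc : ∀ s : spec A, c ≤ s) {u x : H} :
    (u, x) ∈ (sqrtOp A).graph ↔ E.bcalc invSqrt x = u := by
  -- The graph criterion to be proved involves no truncation, so any exhaustion with `√s` bounded on
  -- its sets will do.
  have h := bddExhaustion_sqrt (A := A) (f := fun _ => 0) measurable_const
  rw [sqrtOp, hE]
  exact (isIntegral_integral (E := E) h).mem_graph_iff_of_inv h (bddMeas_invSqrt hc0 hc).1
    (invSqrt_mul_sqrt hc0 hc)

theorem bcalc_invSqrt_sqrtMap (hE : ∀ φ, funCalc A φ = E.integral φ) (hc0 : 0 < c)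
    (hc : ∀ s : spec A, c ≤ s) (u : HOne A) :
    E.bcalc invSqrt (HOne.sqrtMap A u) = HOne.incl A u :=
  (mem_graph_sqrtOp_iff hE hc0 hc).1 ((sqrtOp A).mem_graph u)

/-- The bounded multiplier `s^{-1/2}` is an everywhere defined inverse. This identifies the phase
space with `H × H`, where a genuine complete norm is available. -/
theorem bijective_sqrtMap (hE : ∀ φ, funCalc A φ = E.integral φ) (hc0 : 0 < c)
    (hc : ∀ s : spec A, c ≤ s) : Function.Bijective (HOne.sqrtMap A) := by
  constructor
  · intro u v huv
    refine Subtype.ext (?_ : HOne.incl A u = HOne.incl A v)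
    rw [← bcalc_invSqrt_sqrtMap hE hc0 hc, ← bcalc_invSqrt_sqrtMap hE hc0 hc, huv]
  · intro x
    obtain ⟨u, -, hu⟩ := (sqrtOp A).mem_graph_iff.1
      ((mem_graph_sqrtOp_iff hE hc0 hc (x := x)).2 rfl)
    exact ⟨u, hu⟩

/-- The isometric isomorphism `(u, v) ↦ (A^{1/2} u, v)`. -/
def phaseEquiv (h : Function.Bijective (HOne.sqrtMap A)) : Phase A ≃ₗᵢ[ℂ] WithLp 2 (H × H) where
  toLinearEquiv := (WithLp.linearEquiv 2 ℂ (HOne A × H)).trans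
    (((LinearEquiv.ofBijective (HOne.sqrtMap A) h).prodCongr (LinearEquiv.refl ℂ H)).trans
      (WithLp.linearEquiv 2 ℂ (H × H)).symm)
  norm_map' z := by
    rw [← sq_eq_sq₀ (norm_nonneg _) (norm_nonneg _), Phase.norm_sq, WithLp.prod_norm_sq_eq_of_L2]
    rfl

/-- The generator in the coordinates `(A^{1/2} u, v)`, cut off to `{s ≤ n, f(s) ≤ n}`. -/
def waveGen (E : SpectralMeasure (spec A) H) (f : spec A → ℝ) (n : ℕ) :
    WithLp 2 (H × H) →L[ℂ] WithLp 2 (H × H) :=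
  waveOp (partOp E (fun s => Real.sqrt (s : ℝ)) (sublevel f n)) (partOp E f (sublevel f n))

/-- The spectral projection onto `{s ≤ n, f(s) ≤ n}`, in both components. -/
def waveProj (E : SpectralMeasure (spec A) H) (f : spec A → ℝ) (n : ℕ) :
    WithLp 2 (H × H) →L[ℂ] WithLp 2 (H × H) :=
  diagOp (E.toFun (sublevel f n))

theorem dissipativeApprox_wave (hf : Measurable f) (hf0 : ∀ s, 0 ≤ f s) :
    DissipativeApprox (waveProj E f) (waveGen E f) :=
  dissipativeApprox (bddExhaustion_sqrt hf) (bddExhaustion_self hf hf0) hf0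

theorem bcalc_invSqrt_partOp_sqrt (hc0 : 0 < c) (hc : ∀ s : spec A, c ≤ s) (hf : Measurable f)
    (n : ℕ) (x : H) :
    E.bcalc invSqrt (partOp E (fun s => Real.sqrt (s : ℝ)) (sublevel f n) x) =
      E.toFun (sublevel f n) x := by
  have h := bddExhaustion_sqrt (A := A) hf
  rw [partOp, bcalc_bcalc (bddMeas_invSqrt hc0 hc).1 (h.bddMeas n),
    ← bcalc_indicator_one (h.measurableSet n)]
  congr 2
  ext s
  by_cases hs : s ∈ sublevel f n
  · simp only [Pi.mul_apply, Set.indicator_of_mem hs, invSqrt_mul_sqrt hc0 hc s, Pi.one_apply]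
  · simp [hs]

theorem partOp_sqrt_bcalc_invSqrt (hc0 : 0 < c) (hc : ∀ s : spec A, c ≤ s) (hf : Measurable f)
    (n : ℕ) (x : H) :
    partOp E (fun s => Real.sqrt (s : ℝ)) (sublevel f n) (E.bcalc invSqrt x) =
      E.toFun (sublevel f n) x := by
  have h := bddExhaustion_sqrt (A := A) hf
  rw [← bcalc_invSqrt_partOp_sqrt hc0 hc hf, partOp,
    bcalc_bcalc (bddMeas_invSqrt hc0 hc).1 (h.bddMeas n),
    bcalc_bcalc (h.bddMeas n) (bddMeas_invSqrt hc0 hc).1, mul_comm]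

theorem partOp_id_bcalc_invSqrt (hc0 : 0 < c) (hc : ∀ s : spec A, c ≤ s) (hf : Measurable f)
    (n : ℕ) (x : H) :
    partOp E (fun s => (s : ℝ)) (sublevel f n) (E.bcalc invSqrt x) =
      partOp E (fun s => Real.sqrt (s : ℝ)) (sublevel f n) x := by
  have h := bddExhaustion_id (A := A) hc0 hc hf
  rw [partOp, partOp, bcalc_bcalc (h.bddMeas n) (bddMeas_invSqrt hc0 hc).1]
  congr 2
  ext s
  by_cases hs : s ∈ sublevel f n
  · have e : ((s : ℝ) : ℂ) = ((Real.sqrt (s : ℝ) : ℝ) : ℂ) * ((Real.sqrt (s : ℝ) : ℝ) : ℂ) := by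
      rw [← Complex.ofReal_mul, Real.mul_self_sqrt (hc0.le.trans (hc s))]
    simp only [Pi.mul_apply, Set.indicator_of_mem hs]
    rw [e, mul_assoc, mul_comm _ (invSqrt s), invSqrt_mul_sqrt hc0 hc s, mul_one]
  · simp [hs]

/-- With `u = A^{-1/2}x`, moving the truncated `A` onto `u` gives the truncated `A^{1/2}x`, so the
weak equation can be compared with the truncations although `A u` and `f(A) v` need not exist
separately in `H`. -/
theorem mem_evolutionGraph_iff (hA : IsSpectralMeasureOf A E)
    (hE : ∀ φ, funCalc A φ = E.integral φ) (hc0 : 0 < c) (hc : ∀ s : spec A, c ≤ s)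
    (hf : Measurable f) (hf0 : ∀ s, 0 ≤ f s) (h : Function.Bijective (HOne.sqrtMap A))
    (p : Phase A × Phase A) :
    p ∈ evolutionGraph A f ↔
      ∀ n, waveGen E f n (phaseEquiv h p.1) = waveProj E f n (phaseEquiv h p.2) := by
  have hid := bddExhaustion_id (A := A) hc0 hc hf
  have hsq := bddExhaustion_sqrt (A := A) hf
  have hff := bddExhaustion_self (A := A) hf hf0
  have hF : E.IsIntegral (fun s => (f s : ℂ)) (funCalc A fun s => (f s : ℂ)) := by
    rw [hE]
    exact isIntegral_integral hff
  set x := HOne.sqrtMap A p.1.fst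
  set y := p.1.snd
  set x' := HOne.sqrtMap A p.2.fst
  set y' := p.2.snd
  have hx : HOne.incl A p.1.fst = E.bcalc invSqrt x := (bcalc_invSqrt_sqrtMap hE hc0 hc _).symm
  have hx' : HOne.incl A p.2.fst = E.bcalc invSqrt x' := (bcalc_invSqrt_sqrtMap hE hc0 hc _).symm
  have hR := (bddMeas_invSqrt hc0 hc).1
  have hsplit : (∀ n, waveGen E f n (phaseEquiv h p.1) = waveProj E f n (phaseEquiv h p.2)) ↔
      (∀ n, partOp E (fun s => Real.sqrt (s : ℝ)) (sublevel f n) y = E.toFun (sublevel f n) x') ∧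
      ∀ n, -partOp E (fun s => Real.sqrt (s : ℝ)) (sublevel f n) x - partOp E f (sublevel f n) y =
        E.toFun (sublevel f n) y' := by
    rw [← forall_and]
    refine forall_congr' fun n => ⟨fun e => ⟨congrArg (fun z => z.fst) e,
      congrArg (fun z => z.snd) e⟩, fun e => withLp_prod_ext e.1 e.2⟩
  rw [hsplit]
  change HOne.incl A p.2.fst = y ∧ _ ↔ _
  rw [hx, hx']
  refine and_congr ⟨?_, ?_⟩ ⟨?_, ?_⟩
  · rintro e n
    rw [← e, partOp_sqrt_bcalc_invSqrt hc0 hc hf]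
  · intro e
    refine eq_of_toFun_eq (E := E) hid.measurableSet hid.mono hid.iUnion fun n => ?_
    rw [toFun_comm_bcalc (hid.measurableSet n) hR, ← e n, bcalc_invSqrt_partOp_sqrt hc0 hc hf]
  -- Vectors `E(ω n)w` lie in both domains and are admissible test vectors; symmetry moves the
  -- truncated multipliers to the other side.
  · intro e n
    refine ext_inner_left ℂ fun w => ?_
    obtain ⟨a, ha, ha'⟩ := A.mem_graph_iff.1 (IsIntegral.mem_graph_toFun hid hA n w)
    obtain ⟨b, hb, hb'⟩ := (funCalc A fun s => (f s : ℂ)).mem_graph_iff.1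
      (hF.mem_graph_toFun hff n w)
    have ha : (a : H) = E.toFun (sublevel f n) w := ha
    have hb : (b : H) = E.toFun (sublevel f n) w := hb
    have e1 := e (E.toFun (sublevel f n) w) (ha ▸ a.2) (hb ▸ b.2)
    have ea : A ⟨E.toFun (sublevel f n) w, ha ▸ a.2⟩ = partOp E (fun s => (s : ℝ)) (sublevel f n) w := by
      rw [← show a = ⟨E.toFun (sublevel f n) w, ha ▸ a.2⟩ from Subtype.ext ha]
      exact ha'
    have eb : (funCalc A fun s => (f s : ℂ)) ⟨E.toFun (sublevel f n) w, hb ▸ b.2⟩ =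
        partOp E f (sublevel f n) w := by
      rw [← show b = ⟨E.toFun (sublevel f n) w, hb ▸ b.2⟩ from Subtype.ext hb]
      exact hb'
    rw [ea, eb, inner_partOp_left hid, inner_partOp_left hff, partOp_id_bcalc_invSqrt hc0 hc hf,
      E.inner_toFun_left (hid.measurableSet n), map_neg, inner_neg_right] at e1
    rw [inner_sub_right, inner_neg_right]
    linear_combination -e1
  -- For a general test vector both sides are truncated by `E(ω n)`, where the identity is known,
  -- and `n → ∞`.
  · intro e w hw hw'
    have hlim := fun v => tendsto_toFun (E := E) hid.measurableSet hid.mono hid.iUnion v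
    have t1 := ((hlim (A ⟨w, hw⟩)).inner (𝕜 := ℂ) (tendsto_const_nhds (x := E.bcalc invSqrt x))).add
      ((hlim ((funCalc A fun s => (f s : ℂ)) ⟨w, hw'⟩)).inner (𝕜 := ℂ) (tendsto_const_nhds (x := y)))
    have t2 := (tendsto_const_nhds (x := w)).inner (𝕜 := ℂ) (hlim (-y'))
    refine tendsto_nhds_unique t1 (t2.congr fun n => ?_)
    rw [IsIntegral.toFun_apply hid hA ⟨w, hw⟩ n, hF.toFun_apply hff ⟨w, hw'⟩ n]
    have e1 := inner_partOp_left (E := E) hid n w (E.bcalc invSqrt x)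
    have e2 := inner_partOp_left (E := E) hff n w y
    rw [partOp_id_bcalc_invSqrt hc0 hc hf] at e1
    simp only [partOp] at e1 e2
    rw [e1, e2, map_neg, inner_neg_right, ← e n, inner_sub_right, inner_neg_right]
    simp only [partOp]
    ring

end PhaseSpace

/-! ### Transport of semigroups along an isometry -/

section Transport

variable {X Y : Type*} [SeminormedAddCommGroup X] [NormedSpace ℂ X] [SeminormedAddCommGroup Y]
  [NormedSpace ℂ Y]

/-- The operator `J⁻¹ T J`. -/
def conjOp (J : X ≃ₗᵢ[ℂ] Y) (T : Y →L[ℂ] Y) : X →L[ℂ] X :=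
  (J.symm.toContinuousLinearEquiv : Y →L[ℂ] X) ∘L T ∘L (J.toContinuousLinearEquiv : X →L[ℂ] Y)

theorem conjOp_apply (J : X ≃ₗᵢ[ℂ] Y) (T : Y →L[ℂ] Y) (x : X) : conjOp J T x = J.symm (T (J x)) :=
  rfl

variable {S : ℝ≥0 → Y →L[ℂ] Y}

theorem IsC0Semigroup.conjOp (hS : IsC0Semigroup S) (J : X ≃ₗᵢ[ℂ] Y) :
    IsC0Semigroup fun t => conjOp J (S t) where
  zero := by
    ext x
    rw [conjOp_apply, hS.zero]
    exact J.symm_apply_apply x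
  add s t := by
    ext x
    rw [ContinuousLinearMap.comp_apply, conjOp_apply, conjOp_apply, conjOp_apply, hS.add,
      J.apply_symm_apply, ContinuousLinearMap.comp_apply]
  tendsto x := by
    have h := (J.symm.continuous.tendsto (J x)).comp (hS.tendsto (J x))
    rwa [J.symm_apply_apply] at h

theorem mem_generatorGraph_conjOp (J : X ≃ₗᵢ[ℂ] Y) (p : X × X) :
    p ∈ generatorGraph (fun t => conjOp J (S t)) ↔ (J p.1, J p.2) ∈ generatorGraph S := by
  change Tendsto _ _ _ ↔ Tendsto _ _ _
  rw [J.toHomeomorph.isInducing.tendsto_nhds_iff]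
  refine tendsto_congr fun t => ?_
  change J (((t : ℝ) : ℂ)⁻¹ • (conjOp J (S t) p.1 - p.1)) = _
  rw [map_smul, map_sub, conjOp_apply, J.apply_symm_apply]

theorem ExponentiallyStable.conjOp (hS : ExponentiallyStable S) (J : X ≃ₗᵢ[ℂ] Y) :
    ExponentiallyStable fun t => conjOp J (S t) := by
  obtain ⟨κ, hκ, M, hM, h⟩ := hS
  refine ⟨κ, hκ, M, hM, fun t x => ?_⟩
  rw [conjOp_apply, J.symm.norm_map, ← J.norm_map x]
  exact h t (J x)

theorem conjOp_symm_conjOp (J : X ≃ₗᵢ[ℂ] Y) (T : Y →L[ℂ] Y) : conjOp J.symm (conjOp J T) = T := by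
  ext y
  simp [conjOp_apply]

end Transport

/-! ### Decay estimates and approximate eigenvalues -/

section Decay

theorem le_exp_mul_of_hasDerivAt_le {v v' : ℝ → ℝ} {κ : ℝ} (hv : ∀ t, HasDerivAt v (v' t) t)
    (h : ∀ t, v' t ≤ -κ * v t) {t : ℝ} (ht : 0 ≤ t) : v t ≤ Real.exp (-κ * t) * v 0 := by
  have hd : ∀ s, HasDerivAt (fun s => Real.exp (κ * s) * v s)
      (Real.exp (κ * s) * κ * v s + Real.exp (κ * s) * v' s) s := by
    intro s
    have h1 : HasDerivAt (fun s : ℝ => κ * s) κ s := by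
      simpa using (hasDerivAt_id s).const_mul κ
    exact h1.exp.mul (hv s)
  have ha : Antitone fun s => Real.exp (κ * s) * v s := by
    refine antitone_of_hasDerivAt_nonpos hd fun s => ?_
    change Real.exp (κ * s) * κ * v s + Real.exp (κ * s) * v' s ≤ 0
    have := mul_le_mul_of_nonneg_left (h s) (Real.exp_pos (κ * s)).le
    linarith
  have h1 : Real.exp (κ * t) * v t ≤ Real.exp (κ * 0) * v 0 := ha ht
  rw [mul_zero, Real.exp_zero, one_mul] at h1
  calc v t = Real.exp (-κ * t) * (Real.exp (κ * t) * v t) := by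
        rw [← mul_assoc, ← Real.exp_add]
        simp
    _ ≤ _ := mul_le_mul_of_nonneg_left h1 (Real.exp_pos _).le

variable {K : Type*} [NormedAddCommGroup K] [InnerProductSpace ℂ K] [CompleteSpace K]

/-- The curve `exp(-tμ) exp(tG) z` has derivative `exp(-tμ) exp(tG) (G z - μ z)`; on `[0, T]` the
scalar is at most `exp(T‖μ‖)` and the operator is a contraction. -/
theorem norm_exp_smul_sub_le {G : K →L[ℂ] K} (hG : ∀ z, (⟪z, G z⟫_ℂ).re ≤ 0) (μ : ℂ) (z : K)
    {T : ℝ} (hT : 0 ≤ T) :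
    ‖Complex.exp (-(T * μ)) • NormedSpace.exp (T • G) z - z‖ ≤
      Real.exp (T * ‖μ‖) * ‖G z - μ • z‖ * T := by
  have hd : ∀ t : ℝ, HasDerivAt (fun t : ℝ => Complex.exp (-(t * μ)) • NormedSpace.exp (t • G) z)
      (Complex.exp (-(t * μ)) • NormedSpace.exp (t • G) (G z - μ • z)) t := by
    intro t
    have h1 : HasDerivAt (fun t : ℝ => -((t : ℂ) * μ)) (-μ) t := by
      have h := ((hasDerivAt_id t).ofReal_comp.mul_const μ).neg
      rw [Complex.ofReal_one, one_mul] at h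
      exact h
    have h2 := h1.cexp.smul (hasDerivAt_exp_apply G z t)
    refine h2.congr_deriv ?_
    rw [map_sub, map_smul, smul_sub, smul_smul, mul_neg, neg_smul, sub_eq_add_neg]
  have key := norm_image_sub_le_of_norm_deriv_le_segment' (a := 0) (b := T)
    (C := Real.exp (T * ‖μ‖) * ‖G z - μ • z‖) (fun t _ => (hd t).hasDerivWithinAt)
    (fun t ht => by
      rw [norm_smul, Complex.norm_exp]
      refine mul_le_mul (Real.exp_le_exp.2 ?_) (norm_exp_apply_le hG ht.1 _) (norm_nonneg _)
        (Real.exp_pos _).le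
      calc (-((t : ℂ) * μ)).re ≤ ‖-((t : ℂ) * μ)‖ := Complex.re_le_norm _
        _ = t * ‖μ‖ := by rw [norm_neg, norm_mul, Complex.norm_real, Real.norm_of_nonneg ht.1]
        _ ≤ T * ‖μ‖ := mul_le_mul_of_nonneg_right ht.2.le (norm_nonneg _)) T ⟨hT, le_rfl⟩
  simpa [exp_zero_apply] using key

/-- Approximate eigenvalues of the generator of a decaying semigroup have real part at most the
growth bound. -/
theorem exists_pos_forall_eq_zero {κ M : ℝ} {μ : ℂ} (hμ : -κ < μ.re) :
    ∃ δ : ℝ, 0 < δ ∧ ∀ (G : K →L[ℂ] K), (∀ z, (⟪z, G z⟫_ℂ).re ≤ 0) → ∀ z : K,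
      (∀ t : ℝ, 0 ≤ t → ‖NormedSpace.exp (t • G) z‖ ≤ M * Real.exp (-κ * t) * ‖z‖) →
      ‖G z - μ • z‖ ≤ δ * ‖z‖ → z = 0 := by
  -- The time `T` is chosen so that decay, compared with growth at rate `Re μ`, leaves less than
  -- half of `‖z‖`.
  have hlim : Tendsto (fun t : ℝ => M * Real.exp (-((κ + μ.re) * t))) atTop (𝓝 (M * 0)) :=
    (Real.tendsto_exp_neg_atTop_nhds_zero.comp
      (tendsto_id.const_mul_atTop (by linarith))).const_mul M
  rw [mul_zero] at hlim
  obtain ⟨T, hT, hT0⟩ := ((hlim.eventually (gt_mem_nhds (show (0 : ℝ) < 1 / 2 by norm_num))).and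
    (eventually_gt_atTop 0)).exists
  -- This `δ` limits the drift over `[0, T]` to `‖z‖/2`, so a nonzero `z` would give `‖z‖ < ‖z‖`. It
  -- does not depend on `G`, so one value serves every truncation.
  refine ⟨(1 / 2) / (Real.exp (T * ‖μ‖) * T), by positivity, fun G hG z hz hδ => ?_⟩
  by_contra h0
  have hz0 : 0 < ‖z‖ := norm_pos_iff.2 h0
  have h1 := norm_exp_smul_sub_le hG μ z hT0.le
  have h2 : Real.exp (T * ‖μ‖) * ‖G z - μ • z‖ * T ≤ 1 / 2 * ‖z‖ := by
    calc Real.exp (T * ‖μ‖) * ‖G z - μ • z‖ * T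
        ≤ Real.exp (T * ‖μ‖) * ((1 / 2) / (Real.exp (T * ‖μ‖) * T) * ‖z‖) * T := by gcongr
      _ = 1 / 2 * ‖z‖ := by field_simp
  have h3 : ‖Complex.exp (-(T * μ)) • NormedSpace.exp (T • G) z‖ ≤
      M * Real.exp (-((κ + μ.re) * T)) * ‖z‖ := by
    rw [norm_smul, Complex.norm_exp]
    calc _ ≤ Real.exp (-((T : ℂ) * μ)).re * (M * Real.exp (-κ * T) * ‖z‖) :=
          mul_le_mul_of_nonneg_left (hz T hT0.le) (Real.exp_pos _).le
      _ = M * (Real.exp (-((T : ℂ) * μ)).re * Real.exp (-κ * T)) * ‖z‖ := by ring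
      _ = _ := by
          rw [← Real.exp_add]
          congr 3
          simp
          ring
  have h4 : ‖z‖ ≤ ‖Complex.exp (-(T * μ)) • NormedSpace.exp (T • G) z‖ +
      ‖Complex.exp (-(T * μ)) • NormedSpace.exp (T • G) z - z‖ := by
    simpa using norm_sub_le (Complex.exp (-(T * μ)) • NormedSpace.exp (T • G) z)
      (Complex.exp (-(T * μ)) • NormedSpace.exp (T • G) z - z)
  have h5 := mul_lt_mul_of_pos_right hT hz0
  linarith

end Decay

/-! ### Sufficiency: a Lyapunov function -/

section Sufficiency

variable {H : Type*} [NormedAddCommGroup H] [InnerProductSpace ℂ H] [CompleteSpace H]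
  {A : H →ₗ.[ℂ] H} {E : SpectralMeasure (spec A) H} {c : ℝ} {f : spec A → ℝ}

theorem star_invSqrt : star (invSqrt : spec A → ℂ) = invSqrt := by
  ext s
  exact Complex.conj_ofReal _

theorem mul_norm_sq_le_integral (hf : Measurable f) (hf0 : ∀ s, 0 ≤ f s) {m : ℝ}
    (hm : ∀ s, m ≤ f s) (n : ℕ) {y : H} (hy : E.toFun (sublevel f n) y = y) :
    m * ‖y‖ ^ 2 ≤ ∫ s in sublevel f n, f s ∂(E.diag y) := by
  have h := bddExhaustion_self (A := A) hf hf0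
  have hi : IntegrableOn f (sublevel f n) (E.diag y) := by
    refine Measure.integrableOn_of_bounded (M := n) (measure_ne_top _ _)
      hf.aestronglyMeasurable ?_
    filter_upwards [ae_restrict_mem (h.measurableSet n)] with s hs
    rw [Real.norm_of_nonneg (hf0 s)]
    exact hs.2
  have h1 := setIntegral_mono_on (integrableOn_const (measure_ne_top (E.diag y) (sublevel f n)))
    hi (h.measurableSet n) (fun s _ => hm s)
  rwa [setIntegral_const, smul_eq_mul, E.diag_real y (h.measurableSet n), hy, mul_comm] at h1

/-- The pointwise inequality is `f²/s ≤ C f`. Here the bound on `f/s` enters: it lets the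
dissipation `∫ f d⟨E y, y⟩` control the damping term paired with `x`. -/
theorem norm_sq_bcalc_invSqrt_partOp_le (hc0 : 0 < c) (hc : ∀ s : spec A, c ≤ s)
    (hf : Measurable f) (hf0 : ∀ s, 0 ≤ f s) {C : ℝ} (hC : ∀ s : spec A, f s ≤ C * s) (n : ℕ)
    (y : H) : ‖E.bcalc invSqrt (partOp E f (sublevel f n) y)‖ ^ 2 ≤
      C * ∫ s in sublevel f n, f s ∂(E.diag y) := by
  have h := bddExhaustion_self (A := A) hf hf0
  have hR := (bddMeas_invSqrt hc0 hc).1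
  have hi : Integrable (fun s => ‖(sublevel f n).indicator (fun s => (f s : ℂ)) s‖) (E.diag y) :=
    ((h.bddMeas n).integrable _).norm
  have hi2 : Integrable (fun s => ‖(invSqrt * (sublevel f n).indicator (fun s => (f s : ℂ)) :
      spec A → ℂ) s‖ ^ 2) (E.diag y) := by
    have hb := hR.mul (h.bddMeas n)
    have := ((hb.mul hb).integrable (E.diag y)).norm
    refine this.congr (ae_of_all _ fun s => ?_)
    dsimp only
    rw [Pi.mul_apply, norm_mul, sq]
  rw [partOp, bcalc_bcalc hR (h.bddMeas n), norm_sq_bcalc (hR.mul (h.bddMeas n)),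
    ← integral_indicator (h.measurableSet n), ← integral_const_mul]
  have hi3 : Integrable (fun s => C * (sublevel f n).indicator f s) (E.diag y) := by
    refine (hi.const_mul C).congr (ae_of_all _ fun s => ?_)
    by_cases hs : s ∈ sublevel f n
    · simp [hs, abs_of_nonneg (hf0 s)]
    · simp [hs]
  refine integral_mono hi2 hi3 fun s => ?_
  by_cases hs : s ∈ sublevel f n
  · have hs0 : 0 < (s : ℝ) := hc0.trans_le (hc s)
    simp only [Pi.mul_apply, Set.indicator_of_mem hs, invSqrt]
    rw [← Complex.ofReal_mul, Complex.norm_real, Real.norm_eq_abs, sq_abs, mul_pow, inv_pow,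
      Real.sq_sqrt hs0.le, sq, ← mul_assoc]
    refine mul_le_mul_of_nonneg_right ?_ (hf0 s)
    rw [inv_mul_le_iff₀ hs0, mul_comm]
    exact hC s
  · simp [hs]

/-- The energy alone dissipates only `y`. Adding `ε Re ⟨A^{-1/2}x, y⟩` contributes `-ε‖x‖²` to the
derivative, at the cost of `ε‖y‖²` and an error that the dissipation absorbs. All constants are
independent of `n`. -/
theorem exists_norm_exp_waveGen_le (hc0 : 0 < c) (hc : ∀ s : spec A, c ≤ s) (hf : Measurable f)
    {m C : ℝ} (hm0 : 0 < m) (hm : ∀ s, m ≤ f s) (hC0 : 0 < C) (hC : ∀ s : spec A, f s ≤ C * s) :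
    ∃ κ : ℝ, 0 < κ ∧ ∀ (n : ℕ) (z : WithLp 2 (H × H)) (t : ℝ), 0 ≤ t →
      ‖NormedSpace.exp (t • waveGen E f n) (waveProj E f n z)‖ ≤
        2 * Real.exp (-κ * t) * ‖z‖ := by
  have hf0 : ∀ s, 0 ≤ f s := fun s => hm0.le.trans (hm s)
  have hsq := bddExhaustion_sqrt (A := A) hf
  have hff := bddExhaustion_self (A := A) hf hf0
  have hD := dissipativeApprox_wave (E := E) hf hf0
  obtain ⟨hR, hRb⟩ := bddMeas_invSqrt (A := A) hc0 hc
  have hc1 : 0 < Real.sqrt c := Real.sqrt_pos.2 hc0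
  -- The first condition absorbs the damping error into half of the dissipation, the second absorbs
  -- `ε‖y‖²` into the other half, and the third keeps the cross term below `¼‖z‖²`.
  obtain ⟨ε, hε0, hε1, hε2, hε3⟩ : ∃ ε : ℝ, 0 < ε ∧ ε * C ≤ 1 ∧ ε ≤ m / 4 ∧
      ε * (Real.sqrt c)⁻¹ ≤ 1 / 2 := by
    refine ⟨min (1 / C) (min (m / 4) (Real.sqrt c / 2)), by positivity, ?_, ?_, ?_⟩
    · exact (le_div_iff₀ hC0).1 (min_le_left _ _)
    · exact (min_le_right _ _).trans (min_le_left _ _)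
    · rw [← div_eq_mul_inv, div_le_iff₀ hc1]
      exact ((min_le_right _ _).trans (min_le_right _ _)).trans_eq (by ring)
  set κ := min (m / 4) (ε / 2) with hκ
  have hκ0 : 0 < κ := by positivity
  -- From `¼‖z‖² ≤ v ≤ ‖z‖²` and `v' ≤ -κ v` follows `‖z(t)‖² ≤ 4 exp(-κt)‖z₀‖²`; the square root
  -- yields the factor 2 and the rate `κ/2`.
  refine ⟨κ / 2, by positivity, fun n z₀ t ht => ?_⟩
  let z : ℝ → WithLp 2 (H × H) := fun t => NormedSpace.exp (t • waveGen E f n) (waveProj E f n z₀)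
  have hz : ∀ t, HasDerivAt z (waveGen E f n (z t)) t := fun t =>
    (hasDerivAt_exp_apply _ _ t).congr_deriv (exp_apply_comm _ _ t)
  -- The trajectory stays in the range of the projection, where `s^{-1/2}` inverts the truncated
  -- square root exactly.
  have hPz : ∀ t, waveProj E f n (z t) = z t := by
    intro t
    have e : waveProj E f n (waveProj E f n z₀) = waveProj E f n z₀ :=
      congrArg (fun T => T z₀) (hD.mul_proj n n le_rfl)
    exact (hD.proj_exp le_rfl t _).trans (by rw [e])
  let a := partOp E (fun s => Real.sqrt (s : ℝ)) (sublevel f n)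
  let F := partOp E f (sublevel f n)
  let R := E.bcalc (invSqrt : spec A → ℂ)
  let v : ℝ → ℝ := fun t => 1 / 2 * ‖z t‖ ^ 2 + ε * (⟪R (z t).fst, (z t).snd⟫_ℂ).re
  let v' : ℝ → ℝ := fun t => 1 / 2 * (2 * (⟪z t, waveGen E f n (z t)⟫_ℂ).re) +
    ε * (⟪R (z t).fst, -a (z t).fst - F (z t).snd⟫_ℂ + ⟪R (a (z t).snd), (z t).snd⟫_ℂ).re
  have hv : ∀ t, HasDerivAt v (v' t) t := by
    intro t
    have hx : HasDerivAt (fun t => R (z t).fst) (R (a (z t).snd)) t :=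
      ((R ∘L WithLp.fstL 2 ℂ H H).restrictScalars ℝ).hasFDerivAt.comp_hasDerivAt t (hz t)
    have hy : HasDerivAt (fun t => (z t).snd) (-a (z t).fst - F (z t).snd) t :=
      ((WithLp.sndL 2 ℂ H H).restrictScalars ℝ).hasFDerivAt.comp_hasDerivAt t (hz t)
    exact ((hasDerivAt_norm_sq (hz t)).const_mul (1 / 2)).add
      ((Complex.reCLM.hasFDerivAt.comp_hasDerivAt t (hx.inner ℂ hy)).const_mul ε)
  have hnorm : ∀ t, ‖z t‖ ^ 2 = ‖(z t).fst‖ ^ 2 + ‖(z t).snd‖ ^ 2 := fun t =>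
    WithLp.prod_norm_sq_eq_of_L2 (z t)
  have hcross : ∀ t, |ε * (⟪R (z t).fst, (z t).snd⟫_ℂ).re| ≤ 1 / 4 * ‖z t‖ ^ 2 := by
    intro t
    have h1 : |(⟪R (z t).fst, (z t).snd⟫_ℂ).re| ≤ (Real.sqrt c)⁻¹ * ‖(z t).fst‖ * ‖(z t).snd‖ :=
      ((Complex.abs_re_le_norm _).trans (norm_inner_le_norm _ _)).trans
        (mul_le_mul_of_nonneg_right (norm_bcalc_le hR.1 (by positivity) hRb _) (norm_nonneg _))
    rw [abs_mul, abs_of_pos hε0, hnorm]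
    have h2 := mul_le_mul_of_nonneg_right hε3
      (mul_nonneg (norm_nonneg (z t).fst) (norm_nonneg (z t).snd))
    nlinarith [mul_le_mul_of_nonneg_left h1 hε0.le, sq_nonneg (‖(z t).fst‖ - ‖(z t).snd‖)]
  have hv' : ∀ t, v' t ≤ -κ * v t := by
    intro t
    set x := (z t).fst with hxdef
    set y := (z t).snd with hydef
    have hx : E.toFun (sublevel f n) x = x := congrArg (fun z => z.fst) (hPz t)
    have hy : E.toFun (sublevel f n) y = y := congrArg (fun z => z.snd) (hPz t)
    set I := ∫ s in sublevel f n, f s ∂(E.diag y) with hI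
    have hIm : m * ‖y‖ ^ 2 ≤ I := mul_norm_sq_le_integral hf hf0 hm n hy
    have hRF : ‖R (F y)‖ ^ 2 ≤ C * I := norm_sq_bcalc_invSqrt_partOp_le hc0 hc hf hf0 hC n y
    have e1 : (⟪z t, waveGen E f n (z t)⟫_ℂ).re = -I := by
      rw [WithLp.prod_inner_apply]
      change (⟪x, a y⟫_ℂ + ⟪y, -a x - F y⟫_ℂ).re = -I
      rw [inner_sub_right, inner_neg_right, ← inner_partOp_left hsq, inner_partOp_self hff,
        ← inner_conj_symm y (a x)]
      simp only [Complex.add_re, Complex.sub_re, Complex.neg_re, Complex.conj_re,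
        Complex.ofReal_re]
      ring
    have e2 : ⟪R (a y), y⟫_ℂ = ((‖y‖ ^ 2 : ℝ) : ℂ) := by
      rw [bcalc_invSqrt_partOp_sqrt hc0 hc hf, hy, inner_self_eq_norm_sq_to_K]
      norm_cast
    have e3 : ⟪R x, a x⟫_ℂ = ((‖x‖ ^ 2 : ℝ) : ℂ) := by
      rw [← inner_partOp_left hsq, partOp_sqrt_bcalc_invSqrt hc0 hc hf, hx,
        inner_self_eq_norm_sq_to_K]
      norm_cast
    have e4 : ⟪R x, F y⟫_ℂ = ⟪x, R (F y)⟫_ℂ := inner_bcalc_left_of_real hR star_invSqrt _ _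
    have e5 : -(⟪x, R (F y)⟫_ℂ).re ≤ 1 / 2 * ‖x‖ ^ 2 + 1 / 2 * (C * I) := by
      have h1 : |(⟪x, R (F y)⟫_ℂ).re| ≤ ‖x‖ * ‖R (F y)‖ :=
        (Complex.abs_re_le_norm _).trans (norm_inner_le_norm _ _)
      nlinarith [neg_abs_le (⟪x, R (F y)⟫_ℂ).re, sq_nonneg (‖x‖ - ‖R (F y)‖)]
    have e6 : v' t = -I + ε * (‖y‖ ^ 2 - ‖x‖ ^ 2 - (⟪x, R (F y)⟫_ℂ).re) := by
      change 1 / 2 * (2 * (⟪z t, waveGen E f n (z t)⟫_ℂ).re) +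
        ε * (⟪R x, -a x - F y⟫_ℂ + ⟪R (a y), y⟫_ℂ).re = _
      rw [e1, e2, inner_sub_right, inner_neg_right, e3, e4]
      simp only [Complex.add_re, Complex.sub_re, Complex.neg_re, Complex.ofReal_re]
      ring
    have hI0 : 0 ≤ I := le_trans (by positivity) hIm
    have h1 : v' t ≤ -(m / 4) * ‖y‖ ^ 2 - ε / 2 * ‖x‖ ^ 2 := by
      rw [e6]
      have h2 := mul_le_mul_of_nonneg_left e5 hε0.le
      have h3 := mul_le_mul_of_nonneg_right hε1 hI0
      have h4 := mul_le_mul_of_nonneg_right hε2 (sq_nonneg ‖y‖)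
      nlinarith
    have h2 : v t ≤ ‖z t‖ ^ 2 := by
      have := (abs_le.1 (hcross t)).2
      change 1 / 2 * ‖z t‖ ^ 2 + _ ≤ _
      nlinarith [sq_nonneg ‖z t‖]
    have h3 := mul_le_mul_of_nonneg_left h2 hκ0.le
    have h4 := mul_le_mul_of_nonneg_right (min_le_left (m / 4) (ε / 2)) (sq_nonneg ‖y‖)
    have h5 := mul_le_mul_of_nonneg_right (min_le_right (m / 4) (ε / 2)) (sq_nonneg ‖x‖)
    rw [hnorm t, ← hxdef, ← hydef] at h3
    rw [← hκ] at h4 h5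
    linarith
  have hfin := le_exp_mul_of_hasDerivAt_le hv hv' ht
  have hlow : 1 / 4 * ‖z t‖ ^ 2 ≤ v t := by
    have := (abs_le.1 (hcross t)).1
    change _ ≤ 1 / 2 * ‖z t‖ ^ 2 + _
    linarith
  have hup : v 0 ≤ ‖z₀‖ ^ 2 := by
    have h1 := (abs_le.1 (hcross 0)).2
    have h2 : ‖z 0‖ ≤ ‖z₀‖ := by
      change ‖NormedSpace.exp ((0 : ℝ) • waveGen E f n) (waveProj E f n z₀)‖ ≤ _
      rw [exp_zero_apply]
      exact hD.norm_le n z₀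
    have h3 := pow_le_pow_left₀ (norm_nonneg _) h2 2
    change 1 / 2 * ‖z 0‖ ^ 2 + _ ≤ _
    nlinarith [sq_nonneg ‖z 0‖]
  refine le_of_sq_le_sq ?_ (by positivity)
  have he : Real.exp (-(κ / 2) * t) ^ 2 = Real.exp (-κ * t) := by
    rw [← Real.exp_nat_mul]
    congr 1
    push_cast
    ring
  change ‖z t‖ ^ 2 ≤ _
  rw [mul_pow, mul_pow, he]
  have := mul_le_mul_of_nonneg_left hup (Real.exp_pos (-κ * t)).le
  linarith

end Sufficiency

/-! ### Necessity: approximate eigenvectors -/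

section Necessity

variable {H : Type*} [NormedAddCommGroup H] [InnerProductSpace ℂ H] [CompleteSpace H]

theorem norm_partOp_sub_le {α : Type*} [MeasurableSpace α] {E : SpectralMeasure α H} {a : α → ℝ}
    {ω : ℕ → Set α} (h : BddExhaustion (fun s => (a s : ℂ)) ω) (n : ℕ) {U : Set α}
    (hU : MeasurableSet U) (hUω : U ⊆ ω n) {a₀ η : ℝ} (hη : 0 ≤ η)
    (ha : ∀ s ∈ U, |a s - a₀| ≤ η) {w : H} (hw : E.toFun U w = w) :
    ‖partOp E a (ω n) w - (a₀ : ℂ) • w‖ ≤ η * ‖w‖ := by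
  have hb : BddMeas (U.indicator fun s => (a s : ℂ)) := by
    obtain ⟨C, hC⟩ := h.bdd n
    exact BddMeas.indicator h.measurable hU fun s hs => hC s (hUω hs)
  have h1 : partOp E a (ω n) w - (a₀ : ℂ) • w =
      E.bcalc ((U.indicator fun s => (a s : ℂ)) - (a₀ : ℂ) • U.indicator 1) w := by
    rw [bcalc_sub hb ((BddMeas.indicator_one hU).smul _),
      bcalc_smul _ (BddMeas.indicator_one hU), bcalc_indicator_one hU]
    change _ = E.bcalc _ w - (a₀ : ℂ) • E.toFun U w
    rw [hw, ← bcalc_indicator_toFun hU (h.bddMeas n) hUω w, hw]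
    rfl
  rw [h1]
  refine norm_bcalc_le (hb.sub ((BddMeas.indicator_one hU).smul _)).1 hη (fun s => ?_) w
  by_cases hs : s ∈ U
  · simp only [Pi.sub_apply, Pi.smul_apply, Set.indicator_of_mem hs, Pi.one_apply, smul_eq_mul,
      mul_one]
    rw [← Complex.ofReal_sub, Complex.norm_real]
    exact ha s hs
  · simpa [hs] using hη

variable {A : H →ₗ.[ℂ] H} {E : SpectralMeasure (spec A) H} {c : ℝ} {f : spec A → ℝ}

/-- The vector is `(√s₀ w, μ w)` with `w` spectrally concentrated near `s₀`. The pair `(√s₀, μ)` is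
an exact eigenvector of the planar system at `s₀`, and continuity of `f` and of the square root
makes the error small. -/
theorem exists_approx_eigenvector (hE : IsSpectralMeasureOf A E) (hc0 : 0 < c)
    (hc : ∀ s : spec A, c ≤ s) (hf : Continuous f) (hf0 : ∀ s, 0 ≤ f s) (s₀ : spec A) {μ : ℂ}
    (hμ : μ ^ 2 + f s₀ * μ + (s₀ : ℝ) = 0) {δ : ℝ} (hδ : 0 < δ) :
    ∃ (n : ℕ) (z : WithLp 2 (H × H)), z ≠ 0 ∧ waveProj E f n z = z ∧
      ‖waveGen E f n z - μ • z‖ ≤ δ * ‖z‖ := by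
  have hs0 : 0 < (s₀ : ℝ) := hc0.trans_le (hc s₀)
  set r := Real.sqrt (s₀ : ℝ) with hr
  have hr0 : 0 < r := Real.sqrt_pos.2 hs0
  -- The total error is at most `(2‖μ‖ + r) η ‖w‖`, and `r‖w‖ ≤ ‖z‖`; the cap at 1 keeps `f` below
  -- `f s₀ + 1` on `U`, so that `U` lies in one of the truncation sets.
  set η := min 1 (δ * r / (2 * ‖μ‖ + r)) with hη
  have hη0 : 0 < η := by positivity
  obtain ⟨δ₁, hδ₁, hf₁⟩ := Metric.continuousAt_iff.1 (hf.continuousAt (x := s₀)) η hη0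
  have hcs : Continuous fun s : spec A => Real.sqrt (s : ℝ) := by fun_prop
  obtain ⟨δ₂, hδ₂, hf₂⟩ := Metric.continuousAt_iff.1 (hcs.continuousAt (x := s₀)) η hη0
  set ρ := min 1 (min δ₁ δ₂) with hρ
  have hρ0 : 0 < ρ := by positivity
  let U : Set (spec A) := Metric.ball s₀ ρ
  have hU : MeasurableSet U := Metric.isOpen_ball.measurableSet
  have hUf : ∀ s ∈ U, |f s - f s₀| ≤ η := fun s hs =>
    (hf₁ (lt_of_lt_of_le hs ((min_le_right _ _).trans (min_le_left _ _)))).le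
  have hUr : ∀ s ∈ U, |Real.sqrt (s : ℝ) - r| ≤ η := fun s hs =>
    (hf₂ (lt_of_lt_of_le hs ((min_le_right _ _).trans (min_le_right _ _)))).le
  obtain ⟨n, hn⟩ := exists_nat_ge (max ((s₀ : ℝ) + 1) (f s₀ + 1))
  have hUn : U ⊆ sublevel f n := by
    intro s hs
    have h1 : |(s : ℝ) - s₀| < 1 := lt_of_lt_of_le hs (min_le_left _ _)
    have h2 := (hUf s hs).trans (min_le_left _ _)
    have h3 := (le_max_left _ _).trans hn
    have h4 := (le_max_right _ _).trans hn
    exact ⟨by linarith [(abs_lt.1 h1).2], by linarith [(abs_le.1 h2).2]⟩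
  obtain ⟨w₀, hw₀⟩ := exists_toFun_ne_zero hE (bddExhaustion_id hc0 hc hf.measurable) s₀ hρ0 hU
    (fun s hs => hs)
  set w := E.toFun U w₀ with hwdef
  have hw : E.toFun U w = w := E.toFun_toFun hU w₀
  have hff := bddExhaustion_self (A := A) hf.measurable hf0
  have hsq := bddExhaustion_sqrt (A := A) hf.measurable
  have h1 := norm_partOp_sub_le hsq n hU hUn hη0.le hUr hw
  have h2 := norm_partOp_sub_le hff n hU hUn hη0.le hUf hw
  have hwn : E.toFun (sublevel f n) w = w := by
    have e := E.inter _ _ (hff.measurableSet n) hU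
    rw [Set.inter_eq_right.2 hUn] at e
    have e' : E.toFun U w = E.toFun (sublevel f n) (E.toFun U w) :=
      congrArg (fun T : H →L[ℂ] H => T w) e
    rw [hw] at e'
    exact e'.symm
  let z : WithLp 2 (H × H) := WithLp.toLp 2 ((r : ℂ) • w, μ • w)
  have hzn : r * ‖w‖ ≤ ‖z‖ := by
    have h3 : ‖z‖ ^ 2 = ‖(r : ℂ) • w‖ ^ 2 + ‖μ • w‖ ^ 2 := WithLp.prod_norm_sq_eq_of_L2 z
    refine le_of_sq_le_sq ?_ (norm_nonneg _)
    rw [h3, norm_smul, Complex.norm_real, Real.norm_of_nonneg hr0.le]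
    exact le_add_of_nonneg_right (sq_nonneg _)
  refine ⟨n, z, ?_, ?_, ?_⟩
  · rw [← norm_pos_iff]
    exact lt_of_lt_of_le (mul_pos hr0 (norm_pos_iff.2 hw₀)) hzn
  · refine withLp_prod_ext ?_ ?_
    · change E.toFun (sublevel f n) ((r : ℂ) • w) = (r : ℂ) • w
      rw [map_smul, hwn]
    · change E.toFun (sublevel f n) (μ • w) = μ • w
      rw [map_smul, hwn]
  · set p := partOp E (fun s => Real.sqrt (s : ℝ)) (sublevel f n) w - (r : ℂ) • w with hp
    set q := partOp E f (sublevel f n) w - (f s₀ : ℂ) • w with hq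
    have e : waveGen E f n z - μ • z = WithLp.toLp 2 (μ • p, -((r : ℂ) • p) - μ • q) := by
      refine withLp_prod_ext ?_ ?_
      · change partOp E (fun s => Real.sqrt (s : ℝ)) (sublevel f n) (μ • w) - μ • (r : ℂ) • w =
          μ • p
        rw [map_smul, hp, smul_sub]
      · change -partOp E (fun s => Real.sqrt (s : ℝ)) (sublevel f n) ((r : ℂ) • w) -
          partOp E f (sublevel f n) (μ • w) - μ • μ • w = -((r : ℂ) • p) - μ • q
        have hr2 : (r : ℂ) * r = ((s₀ : ℝ) : ℂ) := by
          rw [← Complex.ofReal_mul, hr, Real.mul_self_sqrt hs0.le]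
        have h0 : (μ * μ + μ * (f s₀ : ℂ) + (r : ℂ) * r) • w = 0 := by
          rw [hr2, show μ * μ + μ * (f s₀ : ℂ) + ((s₀ : ℝ) : ℂ) = 0 by rw [← hμ]; ring, zero_smul]
        rw [add_smul, add_smul, mul_smul, mul_smul, mul_smul] at h0
        rw [map_smul, map_smul, hp, hq, smul_sub, smul_sub, ← sub_eq_zero, ← neg_eq_zero, ← h0]
        abel
    have hle : ‖(WithLp.toLp 2 (μ • p, -((r : ℂ) • p) - μ • q) : WithLp 2 (H × H))‖ ≤
        ‖μ • p‖ + ‖-((r : ℂ) • p) - μ • q‖ := by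
      refine le_of_sq_le_sq ?_ (by positivity)
      rw [WithLp.prod_norm_sq_eq_of_L2]
      change ‖μ • p‖ ^ 2 + ‖-((r : ℂ) • p) - μ • q‖ ^ 2 ≤ _
      nlinarith [mul_nonneg (norm_nonneg (μ • p)) (norm_nonneg (-((r : ℂ) • p) - μ • q))]
    have hq2 : ‖-((r : ℂ) • p) - μ • q‖ ≤ r * ‖p‖ + ‖μ‖ * ‖q‖ := by
      refine (norm_sub_le _ _).trans_eq ?_
      rw [norm_neg, norm_smul, norm_smul, Complex.norm_real, Real.norm_of_nonneg hr0.le]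
    rw [e]
    calc _ ≤ ‖μ‖ * ‖p‖ + (r * ‖p‖ + ‖μ‖ * ‖q‖) :=
          hle.trans (add_le_add (norm_smul μ p).le hq2)
      _ ≤ ‖μ‖ * (η * ‖w‖) + (r * (η * ‖w‖) + ‖μ‖ * (η * ‖w‖)) := by gcongr
      _ = (2 * ‖μ‖ + r) * η * ‖w‖ := by ring
      _ ≤ (2 * ‖μ‖ + r) * (δ * r / (2 * ‖μ‖ + r)) * ‖w‖ := by
          gcongr
          exact min_le_right _ _
      _ = δ * (r * ‖w‖) := by
          have : 2 * ‖μ‖ + r ≠ 0 := by positivity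
          field_simp
      _ ≤ δ * ‖z‖ := mul_le_mul_of_nonneg_left hzn hδ.le

/-- In the oscillating case the real part is `-b/2`, and `κb ≤ b²/2 < 2s`. In the overdamped case
the larger root gives `√(b² - 4s) ≤ b - 2κ`; squaring yields `κb ≤ s + κ²`, and `2κ ≤ b` absorbs
`κ²`. -/
theorem two_mul_le_and_mul_le_of_roots {b s κ : ℝ} (hκ : 0 < κ) (hb : 0 ≤ b)
    (h : ∀ μ : ℂ, μ ^ 2 + b * μ + s = 0 → μ.re ≤ -κ) : 2 * κ ≤ b ∧ κ * b ≤ 2 * s := by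
  rcases lt_or_ge (b ^ 2) (4 * s) with hlt | hge
  · have hd : 0 ≤ 4 * s - b ^ 2 := by linarith
    have h1 := h (((-b / 2 : ℝ) : ℂ) + ((Real.sqrt (4 * s - b ^ 2) / 2 : ℝ) : ℂ) * Complex.I) (by
      have h2 : ((Real.sqrt (4 * s - b ^ 2) : ℝ) : ℂ) ^ 2 = 4 * s - b ^ 2 := by
        rw [← Complex.ofReal_pow, Real.sq_sqrt hd]
        push_cast
        rfl
      push_cast
      linear_combination (1 / 4 : ℂ) * Complex.I ^ 2 * h2 +
        (1 / 4 : ℂ) * (4 * s - b ^ 2) * Complex.I_sq)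
    have h3 : -b / 2 ≤ -κ := by simpa using h1
    constructor
    · linarith
    · nlinarith
  · have hd : 0 ≤ b ^ 2 - 4 * s := by linarith
    have h1 := h (((-b + Real.sqrt (b ^ 2 - 4 * s)) / 2 : ℝ) : ℂ) (by
      have h2 : ((Real.sqrt (b ^ 2 - 4 * s) : ℝ) : ℂ) ^ 2 = b ^ 2 - 4 * s := by
        rw [← Complex.ofReal_pow, Real.sq_sqrt hd]
        push_cast
        rfl
      push_cast
      linear_combination (1 / 4 : ℂ) * h2)
    rw [Complex.ofReal_re] at h1
    have h0 := Real.sqrt_nonneg (b ^ 2 - 4 * s)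
    have h2 := Real.sq_sqrt hd
    have h3 : Real.sqrt (b ^ 2 - 4 * s) ≤ b - 2 * κ := by linarith
    have h4 := pow_le_pow_left₀ h0 h3 2
    constructor
    · linarith
    · nlinarith

theorem bounds_of_norm_exp_waveGen_le (hE : IsSpectralMeasureOf A E) (hc0 : 0 < c)
    (hc : ∀ s : spec A, c ≤ s) (hf : Continuous f) (hf0 : ∀ s, 0 ≤ f s) {κ M : ℝ} (hκ : 0 < κ)
    (h : ∀ (n : ℕ) (z : WithLp 2 (H × H)) (t : ℝ), 0 ≤ t →
      ‖NormedSpace.exp (t • waveGen E f n) (waveProj E f n z)‖ ≤ M * Real.exp (-κ * t) * ‖z‖)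
    (s : spec A) : 2 * κ ≤ f s ∧ κ * f s ≤ 2 * s := by
  refine two_mul_le_and_mul_le_of_roots hκ (hf0 s) fun μ hμ => ?_
  by_contra! hlt
  obtain ⟨δ, hδ, hG⟩ := exists_pos_forall_eq_zero (K := WithLp 2 (H × H)) (M := M) hlt
  obtain ⟨n, z, hz0, hz, hle⟩ := exists_approx_eigenvector hE hc0 hc hf hf0 s hμ hδ
  refine hz0 (hG _ ((dissipativeApprox_wave hf.measurable hf0).dissipative n) z (fun t ht => ?_)
    hle)
  have := h n z t ht
  rwa [hz] at this

/-- A real infimum over an empty index type is 0, so positivity of `inf f` requires a nonempty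
spectrum. -/
theorem SpectralMeasure.nonempty {α : Type*} [MeasurableSpace α] [Nontrivial H]
    (E : SpectralMeasure α H) : Nonempty α := by
  by_contra hα
  rw [not_nonempty_iff] at hα
  have h := E.univ
  rw [Set.univ_eq_empty_iff.2 hα, E.empty] at h
  exact zero_ne_one h

end Necessity

/-! ### The stability criterion -/

section Main

variable {H : Type*} [NormedAddCommGroup H] [InnerProductSpace ℂ H] [CompleteSpace H]
  {A : H →ₗ.[ℂ] H} {E : SpectralMeasure (spec A) H} {c : ℝ} {f : spec A → ℝ}

/-- The relation `P n S(t) = exp(t G n) P n` passes decay of `S` to the truncations with the same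
constants; strong convergence of `P n` to the identity passes it back. -/
theorem exponentiallyStable_wave_iff [Nontrivial H] (hE : IsSpectralMeasureOf A E) (hc0 : 0 < c)
    (hc : ∀ s : spec A, c ≤ s) (hf : Continuous f) (hf0 : ∀ s, 0 ≤ f s)
    {S : ℝ≥0 → WithLp 2 (H × H) →L[ℂ] WithLp 2 (H × H)} (hS : IsC0Semigroup S)
    (hgen : generatorGraph S = {p | ∀ n, waveGen E f n p.1 = waveProj E f n p.2}) :
    ExponentiallyStable S ↔ (0 < ⨅ s : spec A, f s) ∧
      BddAbove (Set.range fun s : spec A => f s / (s : ℝ)) := by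
  have hD := dissipativeApprox_wave (E := E) hf.measurable hf0
  have hproj := hD.proj_semigroup hS hgen
  constructor
  · rintro ⟨κ, hκ, M, -, hM⟩
    have hb := bounds_of_norm_exp_waveGen_le (M := M) hE hc0 hc hf hf0 hκ fun n z t ht => by
      have h1 : waveProj E f n (S ⟨t, ht⟩ z) =
          NormedSpace.exp (t • waveGen E f n) (waveProj E f n z) := hproj n ⟨t, ht⟩ z
      rw [← h1]
      exact (hD.norm_le n _).trans (hM ⟨t, ht⟩ z)
    have := E.nonempty
    refine ⟨lt_of_lt_of_le (by positivity : 0 < 2 * κ) (le_ciInf fun s => (hb s).1), 2 / κ, ?_⟩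
    rintro _ ⟨s, rfl⟩
    have hs0 : 0 < (s : ℝ) := hc0.trans_le (hc s)
    change f s / (s : ℝ) ≤ 2 / κ
    rw [div_le_div_iff₀ hs0 hκ, mul_comm (f s)]
    exact (hb s).2
  · rintro ⟨hm0, C, hC⟩
    have hbdd : BddBelow (Set.range f) := ⟨0, by rintro _ ⟨s, rfl⟩; exact hf0 s⟩
    -- The maximum with 1 makes the constant positive, as the choice of `ε` in the Lyapunov argument
    -- requires.
    have hC' : ∀ s : spec A, f s ≤ max C 1 * s := fun s =>
      (div_le_iff₀ (hc0.trans_le (hc s))).1 ((hC ⟨s, rfl⟩).trans (le_max_left _ _))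
    obtain ⟨κ, hκ, h⟩ := exists_norm_exp_waveGen_le (E := E) hc0 hc hf.measurable hm0
      (fun s => ciInf_le hbdd s) (lt_max_of_lt_right one_pos) hC'
    refine ⟨κ, hκ, 2, one_le_two, fun t z => ?_⟩
    refine le_of_tendsto (hD.tendsto (S t z)).norm (Eventually.of_forall fun n => ?_)
    rw [hproj]
    exact h n z t t.2

end Main

end DampedEvolution

end

open DampedEvolution in
theorem mainTheorem2 {H : Type*} [NormedAddCommGroup H] [InnerProductSpace ℂ H] [CompleteSpace H]
    [TopologicalSpace.SeparableSpace H] [Nontrivial H]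
    (A : H →ₗ.[ℂ] H) (hA : IsSelfAdjoint A) (hpos : StrictlyPositive A)
    (f : spec A → ℝ) (hf : Continuous f) (hf0 : ∀ s, 0 ≤ f s) :
    (∃ S : ℝ≥0 → Phase A →L[ℂ] Phase A, IsC0Semigroup S ∧ (∀ t z, ‖S t z‖ ≤ ‖z‖) ∧
        generatorGraph S = evolutionGraph A f) ∧
      ∀ S : ℝ≥0 → Phase A →L[ℂ] Phase A, IsC0Semigroup S →
        generatorGraph S = evolutionGraph A f →
          (ExponentiallyStable S ↔
            (0 < ⨅ s : spec A, f s) ∧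
              BddAbove (Set.range fun s : spec A => f s / (s : ℝ))) := by
  obtain ⟨E, hE, hcalc⟩ := exists_spectralMeasure_funCalc hA hpos
  obtain ⟨c, hc0, hAc⟩ := hpos
  have hc : ∀ s : spec A, c ≤ s := le_of_mem_spec hA hAc
  have hbij := bijective_sqrtMap hcalc hc0 hc
  let J := phaseEquiv hbij
  have hgraph := mem_evolutionGraph_iff hE hcalc hc0 hc hf.measurable hf0 hbij
  constructor
  · obtain ⟨S, hS, hcontr, hgen⟩ :=
      (dissipativeApprox_wave (E := E) hf.measurable hf0).exists_semigroup
    refine ⟨fun t => conjOp J (S t), hS.conjOp J, fun t z => ?_, ?_⟩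
    · rw [conjOp_apply, J.symm.norm_map, ← J.norm_map z]
      exact hcontr t (J z)
    · ext p
      rw [mem_generatorGraph_conjOp, hgen, hgraph]
      rfl
  · intro S hS hgen
    -- An arbitrary semigroup with the prescribed generator is carried to `H × H`, where its
    -- generator is determined by the truncations.
    have hgen' : generatorGraph (fun t => conjOp J.symm (S t)) =
        {p | ∀ n, waveGen E f n p.1 = waveProj E f n p.2} := by
      ext p
      rw [mem_generatorGraph_conjOp, hgen, hgraph]
      change (∀ n, waveGen E f n (J (J.symm p.1)) = waveProj E f n (J (J.symm p.2))) ↔ _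
      rw [J.apply_symm_apply, J.apply_symm_apply]
      rfl
    rw [← exponentiallyStable_wave_iff hE hc0 hc hf hf0 (hS.conjOp J.symm) hgen']
    refine ⟨fun h => h.conjOp J.symm, fun h => ?_⟩
    have h1 := h.conjOp J
    have e : (fun t => conjOp J (conjOp J.symm (S t))) = S :=
      funext fun t => conjOp_symm_conjOp J.symm (S t)
    rwa [e] at h1
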